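/- \textbf{Notation.} Let $C\subseteq[0,1]$ be the middle-thirds Cantor set. For a binary word $\sigma\in 2^n$ put $0(\sigma)=\sum_{k<n}2\sigma(k)/3^{k+1}$, $1(\sigma)=0(\sigma)+3^{-n}$ (the \emph{endpoints} of $C$) and $B(\sigma)=[0(\sigma),1(\sigma)]\cap C$. A set is \emph{hereditarily disconnected} if each of its connected subsets has at most one point. A connected set is \emph{biconnected} if it is not the union of two disjoint connected subsets with more than one point each. A \emph{dispersion point} of a connected set $S$ with more than one point is a point $x\in S$ such that $S\setminus\{x\}$ is hereditarily disconnected. A space is \emph{rim-discrete} (\emph{rational}) if it has a basis of open sets whose boundaries are discrete (countable). A \emph{continuum} is a connected compact metrizable space with more than one point. For $X\subseteq C\times(0,1)$ let $\nabla X=\{(\tfrac{y(2c-1)+1}{2},y):(c,y)\in X\}\cup\{(\tfrac12,0)\}\subseteq\mathbb R^2$. \textbf{Construction.} Let $(d_n)_{n\ge 0}$ be an enumeration without repetitions of a dense subset of $C$ that contains no endpoints. Let $f(c)=\sum_{\{n:d_n<c\}}2^{-n-1}$, $r_n=f(d_n)$, $s_n=f(d_n)+2^{-n-1}$, $$D=\{(c,f(c)):c\in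 C\}\cup\bigcup_n\{d_n\}\times[r_n,s_n],\qquad M=\{(d_n,\tfrac{r_n+s_n}2):n\ge 0\}.$$ For a rectangle $R=B(\sigma)\times[a,b]$ with $\sigma\in 2^n$ let $T_R(c,r)=(0(\sigma)+c/3^n,\ a+r(b-a))$ and call $T_R[D]$ the curve of $R$. Define sets $\mathcal R_n$ of rectangles $B(\sigma)\times[a,b]$, $\sigma\in 2^n$, recursively. Let $\mathcal R_0=\{C\times[0,1]\}$. Let $\mathcal R_1$ consist of $B(\langle0\rangle)\times[\frac{f(1/3)+1}2,1]$, $B(\langle0\rangle)\times[f(\frac13),\frac{f(1/3)+1}2]$, $B(\langle1\rangle)\times[\frac{f(2/3)}2,f(\frac23)]$, $B(\langle1\rangle)\times[0,\frac{f(2/3)}2]$ and the eight rectangles $B(\sigma)\times[a,a+\frac12]$ with $\sigma\in 2^1$ and $a\in\{-1,-\frac12,1,\frac32\}$. For $n\ge2$ and $\sigma\in2^n$ let $x_0<\dots<x_m$ and $y_0<\dots<y_m$ be the heights at which the curves of the rectangles in $\bigcup_{k<n}\mathcal R_k$ meet $\{0(\sigma)\}\times\mathbb R$ and $\{1(\sigma)\}\times\mathbb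 R$, respectively; the rectangles of $\mathcal R_n$ over $B(\sigma)$ are obtained by cutting each of the strips $B(\sigma)\times[-n,x_0]$, $B(\sigma)\times[y_j,x_{j+1}]$ ($j<m$) and $B(\sigma)\times[y_m,n+1]$, in an arbitrary way, horizontally into finitely many rectangles of positive height at most $\frac1{n+1}$. Finally let $$Y=(C\times\mathbb R)\setminus\bigcup_n\bigcup_{R\in\mathcal R_n}T_R[D\setminus M],\qquad X=\{(c,\tfrac1\pi\arctan r+\tfrac12):(c,r)\in Y\}.$$ \textbf{Theorem.} Sequences $(d_n)$ as above exist, and for each of them there is a sequence $(\mathcal R_n)$ as above. For every such $(d_n)$ and $(\mathcal R_n)$ the following hold. (a) For every $n$: $\mathcal R_n$ is finite; any two distinct members of $\mathcal R_n$ meet in a subset of some $B(\sigma)\times\{c\}$, where $\sigma$ is a binary word and $c\in\mathbb R$; every rectangle in $\mathcal R_n$ has height in $(0,\frac1{n+1}]$; the curves of two distinct rectangles of $\mathcal R_n$ are disjoint, and a curve of a rectangle of $\mathcal R_n$ is disjoint from that of any rectangle of $\mathcal R_k$, $k<n$. With $\Gamma_n$ the union of the curves of all rectangles in $\bigcup_{k\le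 n}\mathcal R_k$, the projection of $\Gamma_n\cap(B(\sigma)\times\mathbb R)$ to the second coordinate is $[-n,n+1]$ for every $\sigma\in2^n$. For every arc $I\subseteq (C\times[-n,n+1])\setminus\Gamma_n$ there are $R\in\mathcal R_n$, $k\le n$ and $R'\in\mathcal R_k$ such that $I\subseteq R\cup R'$ and the Euclidean distance of $I$ and the curve of $R'$ is less than $\frac1{n+1}+\frac1{3^n}$. If $n\ge2$ and $\sigma\in 2^n$, then the heights above satisfy $-n+1\le x_0<y_0<x_1<y_1<\dots<x_m<y_m\le n$, and for each $j\le m$ the points $(0(\sigma),x_j)$ and $(1(\sigma),y_j)$ lie on a common curve. (b) $X\subseteq C\times(0,1)$, and $X$ is hereditarily disconnected. (c) $\nabla X$ is connected. (d) $Y$ is rim-discrete. (e) $\nabla X$ is rim-discrete. (f) $X$ and $\nabla X$ are completely metrizable. (g) $\nabla X$ is biconnected, $(\frac12,0)$ is a dispersion point of $\nabla X$, and $\nabla X$ is homeomorphic to a subspace of a rational continuum. In particular, there is a biconnected subset of the plane that has a dispersion point and embeds in a rational continuum, so the question whether no biconnected set with a dispersion point can be embedded into a rational continuum has a negative answer.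 -/

import Mathlib

open Set Topology TopologicalSpace

noncomputable section

/-! ### Topological notions -/

/-- `X` has a basis of open sets with discrete boundaries. -/
def RimDiscrete (X : Type*) [TopologicalSpace X] : Prop :=
  ∃ 𝓑 : Set (Set X), IsTopologicalBasis 𝓑 ∧ ∀ U ∈ 𝓑, DiscreteTopology (frontier U)

/-- `X` has a basis of open sets with countable boundaries. -/
def RationalSpace (X : Type*) [TopologicalSpace X] : Prop :=
  ∃ 𝓑 : Set (Set X), IsTopologicalBasis 𝓑 ∧ ∀ U ∈ 𝓑, (frontier U).Countable

/-- A continuum: a connected compact metrizable space with more than one point. -/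
def IsContinuum (K : Type*) [TopologicalSpace K] : Prop :=
  ConnectedSpace K ∧ CompactSpace K ∧ MetrizableSpace K ∧ Nontrivial K

/-- `S` is homeomorphic to a subspace of some rational continuum. -/
def EmbedsInRationalContinuum (S : Type) [TopologicalSpace S] : Prop :=
  ∃ (K : Type) (_ : TopologicalSpace K),
    IsContinuum K ∧ RationalSpace K ∧ ∃ φ : S → K, IsEmbedding φ

/-- A connected set that is not the union of two disjoint non-degenerate connected subsets. -/
def IsBiconnected {E : Type*} [TopologicalSpace E] (S : Set E) : Prop :=
  IsConnected S ∧
    ¬ ∃ A B : Set E, A ∪ B = S ∧ Disjoint A B ∧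
      IsConnected A ∧ A.Nontrivial ∧ IsConnected B ∧ B.Nontrivial

/-- `x` is a dispersion point of the non-degenerate connected set `S`: every connected subset of
`S \ {x}` is degenerate (Mathlib's `IsTotallyDisconnected`, i.e. hereditarily disconnected). -/
def IsDispersionPoint {E : Type*} [TopologicalSpace E] (S : Set E) (x : E) : Prop :=
  IsConnected S ∧ S.Nontrivial ∧ x ∈ S ∧ IsTotallyDisconnected (S \ {x})

/-- An arc: a homeomorphic image of `[0,1]`. -/
def IsArc {E : Type*} [TopologicalSpace E] (I : Set E) : Prop :=
  ∃ γ : unitInterval → E, IsEmbedding γ ∧ range γ = I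

/-- The Euclidean metric of the plane (`dist` on `ℝ × ℝ` is the sup metric). -/
def planeDist (p q : ℝ × ℝ) : ℝ := Real.sqrt ((p.1 - q.1) ^ 2 + (p.2 - q.2) ^ 2)

/-! ### The Cantor set and the Cantor fan -/

/-- The endpoint `0(σ)`, for a binary word `σ` of length `n`. -/
def leftEnd {n : ℕ} (σ : Fin n → Bool) : ℝ :=
  ∑ k : Fin n, 2 * (if σ k then 1 else 0) / 3 ^ ((k : ℕ) + 1)

/-- The endpoint `1(σ)`. -/
def rightEnd {n : ℕ} (σ : Fin n → Bool) : ℝ := leftEnd σ + 1 / 3 ^ n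

/-- The basic clopen set `B(σ)` of the Cantor set. -/
def cantorBlock {n : ℕ} (σ : Fin n → Bool) : Set ℝ :=
  Icc (leftEnd σ) (rightEnd σ) ∩ cantorSet

/-- The map `∇`, which collapses the bottom edge of `C × [0,1]` to the vertex `(1/2, 0)`. -/
def nabla (p : ℝ × ℝ) : ℝ × ℝ := ((p.2 * (2 * p.1 - 1) + 1) / 2, p.2)

/-- `∇[X]` together with the vertex of the fan. -/
def fan (X : Set (ℝ × ℝ)) : Set (ℝ × ℝ) := nabla '' X ∪ {(1 / 2, 0)}

/-! ### The Dębski function -/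

/-- `d` enumerates, without repetition, a dense set of non-endpoints of the Cantor set. -/
structure IsDebskiSequence (d : ℕ → ℝ) : Prop where
  injective : Function.Injective d
  mem : ∀ n, d n ∈ cantorSet
  not_endpoint : ∀ n, ∀ (k : ℕ) (σ : Fin k → Bool), d n ≠ leftEnd σ ∧ d n ≠ rightEnd σ
  dense : cantorSet ⊆ closure (range d)

/-- The Dębski jump function `f(c) = ∑_{d_n < c} 2^{-n-1}`. -/
def debski (d : ℕ → ℝ) (c : ℝ) : ℝ := ∑' n : ℕ, if d n < c then (1 / 2 : ℝ) ^ (n + 1) else 0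

/-- The graph of `f` over the Cantor set, with the vertical arcs that fill its jumps. -/
def debskiCurve (d : ℕ → ℝ) : Set (ℝ × ℝ) :=
  {p | p.1 ∈ cantorSet ∧ p.2 = debski d p.1} ∪
    ⋃ n : ℕ, {d n} ×ˢ Icc (debski d (d n)) (debski d (d n) + (1 / 2) ^ (n + 1))

/-- The midpoints of the vertical arcs. -/
def debskiMidpoints (d : ℕ → ℝ) : Set (ℝ × ℝ) :=
  range fun n : ℕ => (d n, debski d (d n) + (1 / 2) ^ (n + 2))

/-! ### Tilings -/

/-- The data `σ ∈ 2ⁿ`, `a`, `b` of a rectangle `B(σ) × [a,b]`. -/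
@[ext]
structure Box (n : ℕ) where
  word : Fin n → Bool
  bot : ℝ
  top : ℝ

/-- The rectangle `B(σ) × [a,b]`. -/
def Box.region {n : ℕ} (ρ : Box n) : Set (ℝ × ℝ) := cantorBlock ρ.word ×ˢ Icc ρ.bot ρ.top

/-- The affine map that carries `C × [0,1]` onto the rectangle. -/
def Box.map {n : ℕ} (ρ : Box n) (p : ℝ × ℝ) : ℝ × ℝ :=
  (leftEnd ρ.word + p.1 / 3 ^ n, ρ.bot + p.2 * (ρ.top - ρ.bot))

/-- The copy of `D` in the rectangle. -/
def Box.curve (d : ℕ → ℝ) {n : ℕ} (ρ : Box n) : Set (ℝ × ℝ) := ρ.map '' debskiCurve d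

/-- A partial tiling of `C × ℝ`. -/
def IsPartialTiling (𝓡 : Set (Set (ℝ × ℝ))) : Prop :=
  (∀ S ∈ 𝓡, ∃ (n : ℕ) (σ : Fin n → Bool) (a b : ℝ), a < b ∧ S = cantorBlock σ ×ˢ Icc a b) ∧
  ∀ S₁ ∈ 𝓡, ∀ S₂ ∈ 𝓡, S₁ ≠ S₂ →
    ∃ (n : ℕ) (σ : Fin n → Bool) (c : ℝ), S₁ ∩ S₂ ⊆ cantorBlock σ ×ˢ {c}

/-- `S` is the set of pairs `(t_i, t_{i+1})` of consecutive points of a finite subdivision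
`u = t_0 < t_1 < ⋯ < t_p = v` with steps at most `ε`. -/
def IsSubdivision (ε u v : ℝ) (S : Set (ℝ × ℝ)) : Prop :=
  ∃ (p : ℕ) (t : ℕ → ℝ), t 0 = u ∧ t p = v ∧
    (∀ i < p, t i < t (i + 1) ∧ t (i + 1) - t i ≤ ε) ∧
    S = {q | ∃ i < p, q = (t i, t (i + 1))}

/-- The heights at which the curves of the stages before `n` meet the line `{c} × ℝ`. -/
def heightsAt (d : ℕ → ℝ) (R : ∀ n, Set (Box n)) (n : ℕ) (c : ℝ) : Set ℝ :=
  {h | ∃ k < n, ∃ ρ ∈ R k, (c, h) ∈ ρ.curve d}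

/-- `x_0 < ⋯ < x_m` and `y_0 < ⋯ < y_m` are the heights of the earlier curves at the two ends
`0(σ)` and `1(σ)` of `B(σ)`. -/
def EnumeratesHeights (d : ℕ → ℝ) (R : ∀ n, Set (Box n)) {n : ℕ} (σ : Fin n → Bool)
    (m : ℕ) (x y : ℕ → ℝ) : Prop :=
  StrictMonoOn x (Iic m) ∧ StrictMonoOn y (Iic m) ∧
    x '' Iic m = heightsAt d R n (leftEnd σ) ∧ y '' Iic m = heightsAt d R n (rightEnd σ)

/-- The rectangles of stage `n` over `B(σ)` arise by cutting each of the strips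
`B(σ) × [-n, x_0]`, `B(σ) × [y_j, x_{j+1}]` (`j < m`), `B(σ) × [y_m, n+1]`
into finitely many rectangles of height at most `1/(n+1)`. -/
def TilesStrips (d : ℕ → ℝ) (R : ∀ n, Set (Box n)) {n : ℕ} (σ : Fin n → Bool) : Prop :=
  ∃ (m : ℕ) (x y : ℕ → ℝ), EnumeratesHeights d R σ m x y ∧
    ∃ (S₀ S₁ : Set (ℝ × ℝ)) (S : ℕ → Set (ℝ × ℝ)),
      IsSubdivision (1 / (n + 1)) (-n) (x 0) S₀ ∧
      IsSubdivision (1 / (n + 1)) (y m) (n + 1) S₁ ∧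
      (∀ j < m, IsSubdivision (1 / (n + 1)) (y j) (x (j + 1)) (S j)) ∧
      {q : ℝ × ℝ | (⟨σ, q.1, q.2⟩ : Box n) ∈ R n} = S₀ ∪ S₁ ∪ ⋃ j < m, S j

/-- The recursive construction of the tilings `R_0, R_1, …`. -/
structure IsTilingSequence (d : ℕ → ℝ) (R : ∀ n, Set (Box n)) : Prop where
  zero : R 0 = {⟨![], 0, 1⟩}
  one : R 1 =
    {⟨![false], (debski d (1 / 3) + 1) / 2, 1⟩,
     ⟨![false], debski d (1 / 3), (debski d (1 / 3) + 1) / 2⟩,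
     ⟨![true], debski d (2 / 3) / 2, debski d (2 / 3)⟩,
     ⟨![true], 0, debski d (2 / 3) / 2⟩} ∪
    {ρ | ∃ a ∈ ({-1, -1 / 2, 1, 3 / 2} : Set ℝ), ρ.bot = a ∧ ρ.top = a + 1 / 2}
  step : ∀ n, 2 ≤ n → ∀ σ : Fin n → Bool, TilesStrips d R σ

/-- The properties that the tilings are built to have (that the words used at stage `n` have
length `n` is part of the type of `R`). -/
structure TilingConditions (d : ℕ → ℝ) (R : ∀ n, Set (Box n)) : Prop where
  finite : ∀ n, (R n).Finite
  tiling : ∀ n, IsPartialTiling (Box.region '' R n)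
  height : ∀ n : ℕ, ∀ ρ ∈ R n, 0 < ρ.top - ρ.bot ∧ ρ.top - ρ.bot ≤ 1 / (n + 1)
  disjoint_same : ∀ n, ∀ ρ ∈ R n, ∀ τ ∈ R n, ρ ≠ τ → Disjoint (ρ.curve d) (τ.curve d)
  disjoint_lt : ∀ n, ∀ k < n, ∀ ρ ∈ R n, ∀ τ ∈ R k, Disjoint (ρ.curve d) (τ.curve d)
  heights : ∀ (n : ℕ) (σ : Fin n → Bool),
    Prod.snd '' ((cantorBlock σ ×ˢ univ) ∩ ⋃ k ≤ n, ⋃ ρ ∈ R k, ρ.curve d) =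
      Icc (-(n : ℝ)) (n + 1)
  arcs : ∀ n : ℕ, ∀ I : Set (ℝ × ℝ), IsArc I →
    I ⊆ (cantorSet ×ˢ Icc (-(n : ℝ)) (n + 1)) \ ⋃ k ≤ n, ⋃ ρ ∈ R k, ρ.curve d →
    ∃ ρ ∈ R n, ∃ k ≤ n, ∃ τ ∈ R k, I ⊆ ρ.region ∪ τ.region ∧
      ∃ p ∈ I, ∃ q ∈ τ.curve d, planeDist p q < 1 / (n + 1) + 1 / 3 ^ n
  interlaced : ∀ n : ℕ, 2 ≤ n → ∀ (σ : Fin n → Bool) (m : ℕ) (x y : ℕ → ℝ),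
    EnumeratesHeights d R σ m x y →
      -(n : ℝ) + 1 ≤ x 0 ∧ (∀ j ≤ m, x j < y j) ∧ (∀ j < m, y j < x (j + 1)) ∧ y m ≤ n ∧
      ∀ j ≤ m, ∃ k < n, ∃ ρ ∈ R k,
        (leftEnd σ, x j) ∈ ρ.curve d ∧ (rightEnd σ, y j) ∈ ρ.curve d

/-! ### The sets `Y` and `X` -/

/-- `Y`: remove from `C × ℝ` all copies of `D` except for the midpoints of their vertical arcs. -/
def setY (d : ℕ → ℝ) (R : ∀ n, Set (Box n)) : Set (ℝ × ℝ) :=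
  (cantorSet ×ˢ univ) \ ⋃ n, ⋃ ρ ∈ R n, ρ.map '' (debskiCurve d \ debskiMidpoints d)

/-- The homeomorphism `Ξ` of `C × ℝ` onto `C × (0,1)`. -/
def squeeze (p : ℝ × ℝ) : ℝ × ℝ := (p.1, 1 / Real.pi * Real.arctan p.2 + 1 / 2)

/-- `X = Ξ[Y]`. -/
def setX (d : ℕ → ℝ) (R : ∀ n, Set (Box n)) : Set (ℝ × ℝ) := squeeze '' setY d R

end

/-! ### Blocks of the Cantor set -/

/-! The combinatorial core is the invariant `IsStacked`: over a block of level n the curves of the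
stages up to n occupy height intervals that do not overlap and fill [-n, n+1]. A proper subblock
loses at least one end of the block, and the curves increase strictly there, so neighbouring
intervals separate. The next stage fills exactly the resulting gaps, because the curve of a
rectangle runs from its lower left to its upper right corner (`isStacked_succ`). Hence the curves
are disjoint, and each nondegenerate vertical segment meets one of them (`exists_curve_meets`): a
segment that misses all of them would be covered by two rectangles that are too short. Everything
else is proved for an abstract `CurveSystem`, whose `space` is X.

Disconnectedness: a connected subset of the space lies on one vertical line. If it were a
nondegenerate segment it would meet a curve, and a curve leaves at most one point of each line in
the space. Complete metrizability holds because only closed curves are removed and the midpoints put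
back form Gδ sets.

Connectedness of the fan (`space_inter_eq_empty`): suppose U and V separate it and V contains the
vertex. Enlarge both to open sets of the plane. Over endpoints of the Cantor set, let F be the set
of points of a suitable window that are in neither enlargement; it is nonempty since a vertical
segment leads from V to U. Points of the closure of F lie on curves, so by Baire one curve contains
a relatively open part of that closure. Near such a point each side of the curve has a constant
label. Equal labels put the point into an enlargement. Different labels are impossible because the
midpoint of a nearby jump belongs to the space and is a limit of points below the curve from the
right and of points above it from the left (`not_mixed`).

Rim-discreteness: double each point of each curve, which gives the compact space `split`, where
"below the i-th curve" is clopen. Following curves that pass close to (c,t) yields a set whose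
frontier lies over (c,t) alone (`exists_cut`). Choosing (c,t) off the space gives neighbourhoods
with frontier over finitely many points off the space. Pushed down to the fan, their boundaries
consist of midpoints whose two copies were separated, and such midpoints are isolated from each
other (`eq_of_split`).

Rational continuum: in `split`, collapse the bottom, collapse the edges of every curve to a point,
and reunite the copies of each midpoint. The relation is closed since the curves become small and
almost all of them lie on one side of a given one (`isClosed_glued`), so the quotient is compact and
metrizable. Only countably many fibres have more than one point, which makes boundaries countable.
The fan embeds because over it the quotient has the same fibres as the projection of `split`, and
the closure of its image is the continuum. Biconnectedness follows from the dispersion point. -/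

theorem div_three_mem_cantorSet {c : ℝ} (hc : c ∈ cantorSet) : c / 3 ∈ cantorSet := by
  rw [cantorSet_eq_union_halves]
  exact Or.inl ⟨c, hc, rfl⟩

theorem two_add_div_three_mem_cantorSet {c : ℝ} (hc : c ∈ cantorSet) :
    (2 + c) / 3 ∈ cantorSet := by
  rw [cantorSet_eq_union_halves]
  exact Or.inr ⟨c, hc, rfl⟩

theorem one_mem_cantorSet : (1 : ℝ) ∈ cantorSet := by
  simp only [cantorSet, mem_iInter]
  intro n
  induction n with
  | zero => simp
  | succ n ih => exact Or.inr ⟨1, ih, by norm_num⟩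

theorem mem_cantorSet_cases {c : ℝ} (hc : c ∈ cantorSet) :
    (c ≤ 1 / 3 ∧ 3 * c ∈ cantorSet) ∨ (2 / 3 ≤ c ∧ 3 * c - 2 ∈ cantorSet) := by
  rw [cantorSet_eq_union_halves] at hc
  rcases hc with ⟨x, hx, rfl⟩ | ⟨x, hx, rfl⟩
  · have := (cantorSet_subset_unitInterval hx).2
    refine Or.inl ⟨by simp only; linarith, ?_⟩
    convert hx using 1
    ring
  · have := (cantorSet_subset_unitInterval hx).1
    refine Or.inr ⟨by simp only; linarith, ?_⟩
    convert hx using 1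
    ring

theorem leftEnd_succ {n : ℕ} (σ : Fin (n + 1) → Bool) :
    leftEnd σ = (2 * (if σ 0 then 1 else 0) + leftEnd (fun i => σ i.succ)) / 3 := by
  simp only [leftEnd, Fin.sum_univ_succ, Fin.val_zero, Fin.val_succ, add_div, Finset.sum_div]
  congr 1
  · ring
  · refine Finset.sum_congr rfl fun i _ => ?_
    rw [pow_succ _ ((i : ℕ) + 1), div_div]

theorem leftEnd_add_mem {n : ℕ} (σ : Fin n → Bool) {c : ℝ} (hc : c ∈ cantorSet) :
    leftEnd σ + c / 3 ^ n ∈ cantorSet := by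
  induction n with
  | zero => simpa [leftEnd] using hc
  | succ n ih =>
    have h := ih (fun i => σ i.succ)
    rw [leftEnd_succ]
    cases σ 0
    · convert div_three_mem_cantorSet h using 1
      simp [pow_succ]; ring
    · convert two_add_div_three_mem_cantorSet h using 1
      simp [pow_succ]; ring

/-- Strip the first digit: the bounds on `c` keep the point inside the block, so the half of the
Cantor set that contains it must agree with that digit. -/
theorem mem_of_leftEnd_add {n : ℕ} (σ : Fin n → Bool) {c : ℝ} (h0 : 0 ≤ c) (h1 : c ≤ 1)
    (hc : leftEnd σ + c / 3 ^ n ∈ cantorSet) : c ∈ cantorSet := by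
  induction n with
  | zero => simpa [leftEnd] using hc
  | succ n ih =>
    have hl : ∀ {n : ℕ} (τ : Fin n → Bool), 0 ≤ leftEnd τ := fun τ =>
      Finset.sum_nonneg fun i _ => by positivity
    have hr : ∀ {n : ℕ} (τ : Fin n → Bool), leftEnd τ + 1 / 3 ^ n ≤ 1 := fun τ =>
      (cantorSet_subset_unitInterval (leftEnd_add_mem τ one_mem_cantorSet)).2
    have h3 : c / 3 ^ n ≤ 1 / 3 ^ n := by gcongr
    have h4 : 0 ≤ c / 3 ^ n := by positivity
    have h5 := hr (fun i => σ i.succ)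
    have h6 := hl (fun i => σ i.succ)
    apply ih (fun i => σ i.succ)
    rw [leftEnd_succ] at hc
    rcases mem_cantorSet_cases hc with ⟨h, h'⟩ | ⟨h, h'⟩ <;> cases hσ : σ 0 <;>
      simp only [hσ, pow_succ, if_true, if_false, Bool.false_eq_true] at h h'
    · convert h' using 1; ring
    · have : c / (3 ^ n * 3) = c / 3 ^ n / 3 := by rw [div_div]
      linarith
    · have : c / (3 ^ n * 3) = c / 3 ^ n / 3 := by rw [div_div]
      linarith
    · convert h' using 1; ring

theorem leftEnd_mem {n : ℕ} (σ : Fin n → Bool) : leftEnd σ ∈ cantorSet := by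
  simpa using leftEnd_add_mem σ zero_mem_cantorSet

theorem rightEnd_mem {n : ℕ} (σ : Fin n → Bool) : rightEnd σ ∈ cantorSet :=
  leftEnd_add_mem σ one_mem_cantorSet

theorem leftEnd_lt_rightEnd {n : ℕ} (σ : Fin n → Bool) : leftEnd σ < rightEnd σ := by
  unfold rightEnd
  have : (0 : ℝ) < 1 / 3 ^ n := by positivity
  linarith

/-- The coordinate in `[0,1]` of a point of the block of `σ`. -/
noncomputable def blockCoord {n : ℕ} (σ : Fin n → Bool) (x : ℝ) : ℝ := (x - leftEnd σ) * 3 ^ n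

theorem blockCoord_add {n : ℕ} (σ : Fin n → Bool) (c : ℝ) :
    blockCoord σ (leftEnd σ + c / 3 ^ n) = c := by
  simp [blockCoord]

theorem leftEnd_add_blockCoord {n : ℕ} (σ : Fin n → Bool) (x : ℝ) :
    leftEnd σ + blockCoord σ x / 3 ^ n = x := by
  simp [blockCoord]

theorem blockCoord_strictMono {n : ℕ} (σ : Fin n → Bool) : StrictMono (blockCoord σ) := by
  intro x y h
  unfold blockCoord
  have : (0 : ℝ) < 3 ^ n := by positivity
  gcongr

theorem continuous_blockCoord {n : ℕ} (σ : Fin n → Bool) : Continuous (blockCoord σ) := by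
  unfold blockCoord
  fun_prop

theorem mem_cantorBlock_iff {n : ℕ} (σ : Fin n → Bool) (x : ℝ) :
    x ∈ cantorBlock σ ↔ blockCoord σ x ∈ cantorSet := by
  have h3 : (0 : ℝ) < 3 ^ n := by positivity
  constructor
  · rintro ⟨⟨h0, h1⟩, hx⟩
    refine mem_of_leftEnd_add σ ?_ ?_ (by rwa [leftEnd_add_blockCoord])
    · exact mul_nonneg (by linarith) h3.le
    · unfold rightEnd at h1
      unfold blockCoord
      rw [← le_div_iff₀ h3]
      linarith
  · intro h
    have h01 := cantorSet_subset_unitInterval h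
    have h2 := leftEnd_add_mem σ h
    rw [leftEnd_add_blockCoord] at h2
    refine ⟨⟨?_, ?_⟩, h2⟩
    · have := h01.1
      unfold blockCoord at this
      nlinarith [nonneg_of_mul_nonneg_left this h3]
    · have := h01.2
      unfold blockCoord at this
      rw [← le_div_iff₀ h3] at this
      unfold rightEnd
      linarith

theorem leftEnd_mem_cantorBlock {n : ℕ} (σ : Fin n → Bool) : leftEnd σ ∈ cantorBlock σ :=
  ⟨⟨le_rfl, (leftEnd_lt_rightEnd σ).le⟩, leftEnd_mem σ⟩

theorem rightEnd_mem_cantorBlock {n : ℕ} (σ : Fin n → Bool) : rightEnd σ ∈ cantorBlock σ :=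
  ⟨⟨(leftEnd_lt_rightEnd σ).le, le_rfl⟩, rightEnd_mem σ⟩

theorem cantorBlock_subset {n : ℕ} (σ : Fin n → Bool) : cantorBlock σ ⊆ cantorSet :=
  inter_subset_right

theorem isClosed_cantorBlock {n : ℕ} (σ : Fin n → Bool) : IsClosed (cantorBlock σ) :=
  isClosed_Icc.inter isClosed_cantorSet

theorem mem_cantorBlock_succ {n : ℕ} {σ : Fin (n + 1) → Bool} {x : ℝ} (hx : x ∈ cantorBlock σ) :
    (σ 0 = false ∧ x ≤ 1 / 3 ∧ 3 * x ∈ cantorBlock fun i => σ i.succ) ∨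
      (σ 0 = true ∧ 2 / 3 ≤ x ∧ 3 * x - 2 ∈ cantorBlock fun i => σ i.succ) := by
  rw [mem_cantorBlock_iff] at hx
  have h := leftEnd_add_mem (fun i => σ i.succ) hx
  have h1 := cantorSet_subset_unitInterval h
  have key : leftEnd (fun i => σ i.succ) + blockCoord σ x / 3 ^ n =
      3 * x - 2 * (if σ 0 then 1 else 0) := by
    have := leftEnd_add_blockCoord σ x
    rw [leftEnd_succ, pow_succ, ← div_div] at this
    linarith
  have hm : leftEnd (fun i => σ i.succ) + blockCoord σ x / 3 ^ n ∈
      cantorBlock fun i => σ i.succ := by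
    rw [mem_cantorBlock_iff, blockCoord_add]; exact hx
  rw [key] at hm h1
  cases hσ : σ 0 <;> simp only [hσ, if_true, if_false, Bool.false_eq_true] at hm h1
  · left
    refine ⟨rfl, by linarith [h1.2], by simpa using hm⟩
  · right
    refine ⟨rfl, by linarith [h1.1], by simpa using hm⟩

/-- The first digit is decided by the gap between 1/3 and 2/3, the others by rescaling. -/
theorem word_eq_of_mem_cantorBlock {n : ℕ} {σ τ : Fin n → Bool} {x : ℝ}
    (h : x ∈ cantorBlock σ) (h' : x ∈ cantorBlock τ) : σ = τ := by
  induction n generalizing x with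
  | zero => exact Subsingleton.elim _ _
  | succ n ih =>
    have aux : σ 0 = τ 0 ∧ (fun i : Fin n => σ i.succ) = fun i => τ i.succ := by
      rcases mem_cantorBlock_succ h with ⟨h1, h2, h3⟩ | ⟨h1, h2, h3⟩ <;>
        rcases mem_cantorBlock_succ h' with ⟨h1', h2', h3'⟩ | ⟨h1', h2', h3'⟩
      · exact ⟨h1.trans h1'.symm, ih h3 h3'⟩
      · linarith
      · linarith
      · exact ⟨h1.trans h1'.symm, ih h3 h3'⟩
    funext i
    refine Fin.cases aux.1 (fun j => congrFun aux.2 j) i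

/-- The word of length `n` at the beginning of a binary sequence. -/
def initialWord (s : ℕ → Bool) (n : ℕ) : Fin n → Bool := fun i => s i

theorem exists_initialWord {n : ℕ} (σ : Fin n → Bool) : ∃ s, initialWord s n = σ := by
  refine ⟨fun i => if h : i < n then σ ⟨i, h⟩ else false, ?_⟩
  funext i
  simp [initialWord]

theorem leftEnd_initialWord (s : ℕ → Bool) (n : ℕ) :
    leftEnd (initialWord s n) =
      ∑ i ∈ Finset.range n, 2 * (if s i then 1 else 0) / (3 : ℝ) ^ (i + 1) := by
  unfold leftEnd initialWord
  exact Fin.sum_univ_eq_sum_range (fun i => 2 * (if s i then 1 else 0) / (3 : ℝ) ^ (i + 1)) n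

theorem leftEnd_initialWord_add (s : ℕ → Bool) (k m : ℕ) :
    leftEnd (initialWord s (k + m)) = leftEnd (initialWord s k) +
      leftEnd (initialWord (fun i => s (k + i)) m) / 3 ^ k := by
  rw [leftEnd_initialWord, leftEnd_initialWord, leftEnd_initialWord, Finset.sum_range_add,
    Finset.sum_div]
  congr 1
  refine Finset.sum_congr rfl fun i _ => ?_
  rw [div_div, ← pow_add]
  congr 2
  ring

theorem rightEnd_initialWord_add (s : ℕ → Bool) (k m : ℕ) :
    rightEnd (initialWord s (k + m)) = leftEnd (initialWord s k) +
      rightEnd (initialWord (fun i => s (k + i)) m) / 3 ^ k := by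
  unfold rightEnd
  rw [leftEnd_initialWord_add, add_div, div_div, ← pow_add, add_comm m k, add_assoc]

theorem blockCoord_leftEnd (s : ℕ → Bool) (k m : ℕ) :
    blockCoord (initialWord s k) (leftEnd (initialWord s (k + m))) =
      leftEnd (initialWord (fun i => s (k + i)) m) := by
  rw [leftEnd_initialWord_add, blockCoord_add]

theorem blockCoord_rightEnd (s : ℕ → Bool) (k m : ℕ) :
    blockCoord (initialWord s k) (rightEnd (initialWord s (k + m))) =
      rightEnd (initialWord (fun i => s (k + i)) m) := by
  rw [rightEnd_initialWord_add, blockCoord_add]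

theorem cantorBlock_antitone (s : ℕ → Bool) {k n : ℕ} (h : k ≤ n) :
    cantorBlock (initialWord s n) ⊆ cantorBlock (initialWord s k) := by
  obtain ⟨m, rfl⟩ := Nat.exists_eq_add_of_le h
  intro x hx
  rw [mem_cantorBlock_iff] at hx ⊢
  have : blockCoord (initialWord s k) x =
      leftEnd (initialWord (fun i => s (k + i)) m) + blockCoord (initialWord s (k + m)) x / 3 ^ m := by
    conv_lhs => rw [← leftEnd_add_blockCoord (initialWord s (k + m)) x, leftEnd_initialWord_add,
      pow_add, add_assoc, mul_comm, ← div_div, ← add_div, blockCoord_add]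
  rw [this]
  exact leftEnd_add_mem _ hx

theorem eq_initialWord {s : ℕ → Bool} {k n : ℕ} (h : k ≤ n) {σ : Fin k → Bool} {x : ℝ}
    (hx : x ∈ cantorBlock (initialWord s n)) (hx' : x ∈ cantorBlock σ) : σ = initialWord s k :=
  word_eq_of_mem_cantorBlock hx' (cantorBlock_antitone s h hx)

/-- The ternary digits (halved) of a point of the Cantor set. -/
noncomputable def address (x : ℝ) : ℕ → Bool := (cantorToBinary x).get

theorem mem_cantorBlock_address {x : ℝ} (hx : x ∈ cantorSet) (n : ℕ) :
    x ∈ cantorBlock (initialWord (address x) n) := by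
  have key : leftEnd (initialWord (address x) n) =
      ∑ i ∈ Finset.range n, Real.ofDigitsTerm (cantorToTernary x) i := by
    rw [leftEnd_initialWord]
    refine Finset.sum_congr rfl fun i _ => ?_
    unfold Real.ofDigitsTerm cantorToTernary address
    change _ = ((cond ((cantorToBinary x).get i) (2 : Fin 3) 0 : Fin 3) : ℝ) * _
    cases (cantorToBinary x).get i <;> simp [div_eq_mul_inv]
  refine ⟨⟨?_, ?_⟩, hx⟩
  · rw [key]; exact ofDigits_cantorToTernary_sum_le hx
  · have := le_ofDigits_cantorToTernary_sum hx (n := n)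
    unfold rightEnd
    rw [key, one_div, ← inv_pow]
    linarith

theorem exists_mem_cantorBlock {x : ℝ} (hx : x ∈ cantorSet) (n : ℕ) :
    ∃ σ : Fin n → Bool, x ∈ cantorBlock σ := ⟨_, mem_cantorBlock_address hx n⟩

theorem dist_le_of_mem_cantorBlock {n : ℕ} {σ : Fin n → Bool} {x y : ℝ}
    (hx : x ∈ cantorBlock σ) (hy : y ∈ cantorBlock σ) : |x - y| ≤ 1 / 3 ^ n := by
  obtain ⟨⟨a, b⟩, -⟩ := hx
  obtain ⟨⟨c, e⟩, -⟩ := hy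
  unfold rightEnd at b e
  rw [abs_le]
  constructor <;> linarith

theorem isClosed_cantorSet_diff_block {n : ℕ} (σ : Fin n → Bool) :
    IsClosed (cantorSet \ cantorBlock σ) := by
  have : cantorSet \ cantorBlock σ = ⋃ τ ∈ {τ : Fin n → Bool | τ ≠ σ}, cantorBlock τ := by
    ext x
    simp only [mem_sdiff, mem_iUnion, mem_ofPred_eq, exists_prop]
    constructor
    · rintro ⟨h1, h2⟩
      obtain ⟨τ, hτ⟩ := exists_mem_cantorBlock h1 n
      exact ⟨τ, fun h => h2 (h ▸ hτ), hτ⟩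
    · rintro ⟨τ, h1, h2⟩
      exact ⟨h2.2, fun h => h1 (word_eq_of_mem_cantorBlock h2 h)⟩
  rw [this]
  exact (toFinite _).isClosed_biUnion fun τ _ => isClosed_cantorBlock τ

theorem cantorBlock_mem_nhdsWithin {n : ℕ} {σ : Fin n → Bool} {x : ℝ} (hx : x ∈ cantorBlock σ) :
    cantorBlock σ ∈ 𝓝[cantorSet] x := by
  have h : (cantorSet \ cantorBlock σ)ᶜ ∈ 𝓝 x :=
    (isClosed_cantorSet_diff_block σ).isOpen_compl.mem_nhds fun h => h.2 hx
  filter_upwards [mem_nhdsWithin_of_mem_nhds h, self_mem_nhdsWithin] with y hy hy'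
  by_contra h'
  exact hy ⟨hy', h'⟩

theorem exists_one_div_three_pow_lt {ε : ℝ} (hε : 0 < ε) : ∃ n : ℕ, 1 / (3 : ℝ) ^ n < ε := by
  obtain ⟨n, hn⟩ := exists_pow_lt_of_lt_one hε (by norm_num : (1 / 3 : ℝ) < 1)
  exact ⟨n, by simpa using hn⟩

theorem exists_block_subset {x ε : ℝ} (hx : x ∈ cantorSet) (hε : 0 < ε) :
    ∃ n, ∀ y ∈ cantorBlock (initialWord (address x) n), |y - x| < ε := by
  obtain ⟨n, hn⟩ := exists_one_div_three_pow_lt hε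
  exact ⟨n, fun y hy => (dist_le_of_mem_cantorBlock hy (mem_cantorBlock_address hx n)).trans_lt hn⟩

/-- A locally constant selection on a subset of the Cantor set. -/
theorem exists_locallyConstant_selection {β : Type*} [Nonempty β] {S : Set ℝ}
    (hS : S ⊆ cantorSet) (good : ℝ → β → Prop)
    (h : ∀ x ∈ S, ∃ b, ∀ᶠ y in 𝓝[cantorSet] x, y ∈ S ∧ good y b) :
    ∃ r : ℝ → β, ∀ x ∈ S, good x (r x) ∧ ∀ᶠ y in 𝓝[cantorSet] x, y ∈ S ∧ r y = r x := by
  classical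
  let blk : ℝ → ℕ → Set ℝ := fun x n => cantorBlock (initialWord (address x) n)
  let Q : Set ℝ → Prop := fun B => ∃ b, ∀ y ∈ B, y ∈ S ∧ good y b
  have hblk : ∀ {x y n}, x ∈ cantorSet → y ∈ blk x n → blk y n = blk x n := by
    intro x y n hx hy
    have := word_eq_of_mem_cantorBlock hy (mem_cantorBlock_address hy.2 n)
    simp only [blk, this]
  have hex : ∀ x ∈ S, ∃ n, Q (blk x n) := by
    intro x hx
    obtain ⟨b, hb⟩ := h x hx
    obtain ⟨ε, hε, hε'⟩ := Metric.mem_nhdsWithin_iff.1 hb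
    obtain ⟨n, hn⟩ := exists_block_subset (hS hx) hε
    exact ⟨n, b, fun y hy => hε' ⟨by simpa [Real.dist_eq] using hn y hy, hy.2⟩⟩
  -- `N x` is the least level at which the block of `x` has one common good value. All points of
  -- that block have the same least level and the same block there, and the chosen value depends on
  -- the block only.
  let N : ℝ → ℕ := fun x => if hx : ∃ n, Q (blk x n) then Nat.find hx else 0
  have hN : ∀ x ∈ S, Q (blk x (N x)) := by
    intro x hx
    simp only [N, dif_pos (hex x hx)]
    exact Nat.find_spec (hex x hx)
  let r : ℝ → β := fun x => if hx : Q (blk x (N x)) then hx.choose else Classical.arbitrary β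
  have hr : ∀ x ∈ S, ∀ y ∈ blk x (N x), y ∈ S ∧ good y (r x) := by
    intro x hx
    simp only [r, dif_pos (hN x hx)]
    exact (hN x hx).choose_spec
  refine ⟨r, fun x hx => ⟨(hr x hx x (mem_cantorBlock_address (hS hx) _)).2, ?_⟩⟩
  filter_upwards [cantorBlock_mem_nhdsWithin (mem_cantorBlock_address (hS hx) (N x))] with y hy
  have hyS := (hr x hx y hy).1
  refine ⟨hyS, ?_⟩
  have hle : ∀ m ≤ N x, blk y m = blk x m := fun m hm =>
    hblk (hS hx) (cantorBlock_antitone _ hm hy)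
  have hNy : N y = N x := by
    apply le_antisymm
    · have : Q (blk y (N x)) := by rw [hle _ le_rfl]; exact hN x hx
      simp only [N, dif_pos (hex y hyS)]
      exact Nat.find_le this
    · by_contra hlt
      push Not at hlt
      have h1 := hN y hyS
      rw [hle _ hlt.le] at h1
      have h2 : N x ≤ N y := by
        conv_lhs => simp only [N, dif_pos (hex x hx)]
        exact Nat.find_le h1
      omega
  simp only [r, hNy, hle _ le_rfl]

theorem isTotallyDisconnected_cantorSet : IsTotallyDisconnected cantorSet := by
  have : TotallyDisconnectedSpace cantorSet := by
    exact cantorSetHomeomorphNatToBool.symm.totallyDisconnectedSpace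
  exact totallyDisconnectedSpace_subtype_iff.1 this

/-- The endpoints of the Cantor set. -/
def cantorEndpoints : Set ℝ :=
  {x | ∃ (k : ℕ) (σ : Fin k → Bool), x = leftEnd σ ∨ x = rightEnd σ}

theorem cantorEndpoints_subset : cantorEndpoints ⊆ cantorSet := by
  rintro x ⟨k, σ, rfl | rfl⟩
  · exact leftEnd_mem σ
  · exact rightEnd_mem σ

theorem exists_endpoint_lt {x ε : ℝ} (hx : x ∈ cantorSet) (hx' : x ∉ cantorEndpoints)
    (hε : 0 < ε) : ∃ y ∈ cantorEndpoints, x - ε < y ∧ y < x := by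
  obtain ⟨n, hn⟩ := exists_block_subset hx hε
  have h := mem_cantorBlock_address hx n
  have h1 := hn _ (leftEnd_mem_cantorBlock _)
  refine ⟨_, ⟨n, _, Or.inl rfl⟩, by linarith [(abs_lt.1 h1).1], lt_of_le_of_ne h.1.1 ?_⟩
  exact fun h => hx' ⟨_, _, Or.inl h.symm⟩

theorem exists_endpoint_gt {x ε : ℝ} (hx : x ∈ cantorSet) (hx' : x ∉ cantorEndpoints)
    (hε : 0 < ε) : ∃ y ∈ cantorEndpoints, x < y ∧ y < x + ε := by
  obtain ⟨n, hn⟩ := exists_block_subset hx hε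
  have h := mem_cantorBlock_address hx n
  have h1 := hn _ (rightEnd_mem_cantorBlock _)
  refine ⟨_, ⟨n, _, Or.inr rfl⟩, lt_of_le_of_ne h.1.2 ?_, by linarith [(abs_lt.1 h1).2]⟩
  exact fun h => hx' ⟨_, _, Or.inr h⟩

theorem exists_endpoint_near {x ε : ℝ} (hx : x ∈ cantorSet) (hε : 0 < ε) :
    ∃ y ∈ cantorEndpoints, |y - x| < ε := by
  obtain ⟨n, hn⟩ := exists_block_subset hx hε
  exact ⟨_, ⟨n, _, Or.inl rfl⟩, hn _ (leftEnd_mem_cantorBlock _)⟩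

theorem exists_cantorSet_between_one {x : ℝ} (hx : x < 1) : ∃ y ∈ cantorSet, x < y ∧ y < 1 := by
  obtain ⟨n, hn⟩ := exists_one_div_three_pow_lt (sub_pos.2 hx)
  have h1 : ∀ n : ℕ, 1 - 1 / (3 : ℝ) ^ n ∈ cantorSet := by
    intro n
    induction n with
    | zero => simpa using zero_mem_cantorSet
    | succ n ih =>
      convert two_add_div_three_mem_cantorSet ih using 1
      rw [pow_succ, ← div_div]; ring
  exact ⟨_, h1 n, by linarith, by linarith [show (0 : ℝ) < 1 / 3 ^ n by positivity]⟩

theorem exists_cantorSet_between_zero {x : ℝ} (hx : 0 < x) : ∃ y ∈ cantorSet, 0 < y ∧ y < x := by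
  obtain ⟨n, hn⟩ := exists_one_div_three_pow_lt hx
  have h1 : ∀ n : ℕ, 1 / (3 : ℝ) ^ n ∈ cantorSet := by
    intro n
    induction n with
    | zero => simpa using one_mem_cantorSet
    | succ n ih =>
      convert div_three_mem_cantorSet ih using 1
      rw [pow_succ, ← div_div]
  exact ⟨_, h1 n, by positivity, hn⟩

/-- The copy of 1/4 in each block gives a dense set. Endpoints are integers over powers of 3, while
these points need a denominator divisible by 4. -/
theorem exists_debskiSequence : ∃ d : ℕ → ℝ, IsDebskiSequence d := by
  let T : Set ℝ := range fun p : Σ n : ℕ, (Fin n → Bool) => leftEnd p.2 + 1 / 4 / 3 ^ p.1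
  have hTC : T ⊆ cantorSet := by
    rintro _ ⟨p, rfl⟩
    exact leftEnd_add_mem _ quarter_mem_cantorSet
  have hint : ∀ {n : ℕ} (σ : Fin n → Bool), ∃ a : ℤ, leftEnd σ = a / 3 ^ n := by
    intro n
    induction n with
    | zero => exact fun σ => ⟨0, by simp [leftEnd]⟩
    | succ n ih =>
      intro σ
      obtain ⟨a, ha⟩ := ih fun i => σ i.succ
      refine ⟨2 * (if σ 0 then 1 else 0) * 3 ^ n + a, ?_⟩
      rw [leftEnd_succ, ha]
      cases σ 0 <;> simp [pow_succ] <;> field_simp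
  have hend : ∀ x ∈ cantorEndpoints, ∃ (n : ℕ) (a : ℤ), x = a / 3 ^ n := by
    rintro x ⟨k, σ, rfl | rfl⟩ <;> obtain ⟨a, ha⟩ := hint σ
    · exact ⟨k, a, ha⟩
    · exact ⟨k, a + 1, by unfold rightEnd; rw [ha]; push_cast; ring⟩
  have hTend : ∀ x ∈ T, x ∉ cantorEndpoints := by
    rintro _ ⟨⟨n, σ⟩, rfl⟩ h
    obtain ⟨m, b, hb⟩ := hend _ h
    obtain ⟨a, ha⟩ := hint σ
    simp only [ha] at hb
    field_simp at hb
    -- After clearing denominators, the left side is odd and the right side even.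
    have hb' : (3 : ℤ) ^ m * (a * 4 + 1) = 2 * (2 * (3 ^ n * b)) := by
      have : (((3 : ℤ) ^ m * (a * 4 + 1) : ℤ) : ℝ) = ((2 * (2 * (3 ^ n * b)) : ℤ) : ℝ) := by
        push_cast; linarith
      exact_mod_cast this
    have hodd : Odd ((3 : ℤ) ^ m * (a * 4 + 1)) :=
      (Odd.pow (by decide)).mul ⟨2 * a, by ring⟩
    rw [hb'] at hodd
    exact (Int.not_odd_iff_even.2 (even_two_mul _)) hodd
  have hdense : cantorSet ⊆ closure T := by
    intro x hx
    rw [Metric.mem_closure_iff]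
    intro ε hε
    obtain ⟨n, hn⟩ := exists_block_subset hx hε
    refine ⟨_, ⟨⟨n, initialWord (address x) n⟩, rfl⟩, ?_⟩
    rw [dist_comm, Real.dist_eq]
    refine hn _ ?_
    rw [mem_cantorBlock_iff, blockCoord_add]
    exact quarter_mem_cantorSet
  have hinf : T.Infinite := by
    intro hfin
    have h0 := hdense zero_mem_cantorSet
    rw [hfin.isClosed.closure_eq] at h0
    exact hTend _ h0 ⟨0, ![], Or.inl (by simp [leftEnd])⟩
  have hcount : T.Countable := countable_range _
  obtain ⟨e⟩ := (countable_infinite_iff_nonempty_denumerable.1 ⟨hcount, hinf⟩)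
  let g : ℕ ≃ T := (Denumerable.eqv T).symm
  refine ⟨fun n => (g n : ℝ), fun a b h => g.injective (Subtype.ext h), fun n => hTC (g n).2,
    fun n k σ => ?_, ?_⟩
  · exact ⟨fun h => hTend _ (g n).2 ⟨k, σ, Or.inl h⟩, fun h => hTend _ (g n).2 ⟨k, σ, Or.inr h⟩⟩
  · have : range (fun n => (g n : ℝ)) = T := by
      rw [range_comp' Subtype.val g, g.range_eq_univ, image_univ, Subtype.range_coe]
    rw [this]
    exact hdense

/-! ### The jump function and its right-continuous version -/

/-- The right-continuous version of the jump function. -/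
noncomputable def debskiUp (d : ℕ → ℝ) (c : ℝ) : ℝ :=
  ∑' n : ℕ, if d n ≤ c then (1 / 2 : ℝ) ^ (n + 1) else 0

section Debski

variable {d : ℕ → ℝ}

theorem hasSum_half_pow : HasSum (fun n : ℕ => (1 / 2 : ℝ) ^ (n + 1)) 1 := by
  have := hasSum_geometric_two.mul_right (1 / 2 : ℝ)
  simpa [pow_succ] using this

theorem summable_ite_half_pow (p : ℕ → Prop) [DecidablePred p] :
    Summable fun n : ℕ => if p n then (1 / 2 : ℝ) ^ (n + 1) else 0 :=
  hasSum_half_pow.summable.of_nonneg_of_le (fun n => by split_ifs <;> positivity)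
    (fun n => by split_ifs <;> [exact le_rfl; positivity])

theorem tsum_ite_half_pow_le (p q : ℕ → Prop) [DecidablePred p] [DecidablePred q]
    (h : ∀ n, p n → q n) :
    (∑' n : ℕ, if p n then (1 / 2 : ℝ) ^ (n + 1) else 0) ≤
      ∑' n : ℕ, if q n then (1 / 2 : ℝ) ^ (n + 1) else 0 := by
  refine (summable_ite_half_pow p).tsum_le_tsum (fun n => ?_) (summable_ite_half_pow q)
  by_cases hp : p n
  · simp [hp, h n hp]
  · simp only [hp, if_false]; split_ifs <;> positivity

theorem debskiUp_mono : Monotone (debskiUp d) := fun _ _ h =>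
  tsum_ite_half_pow_le _ _ fun _ h' => h'.trans h

theorem debski_le_debskiUp (c : ℝ) : debski d c ≤ debskiUp d c :=
  tsum_ite_half_pow_le _ _ fun _ h => h.le

theorem debskiUp_le_debski {a b : ℝ} (h : a < b) : debskiUp d a ≤ debski d b :=
  tsum_ite_half_pow_le _ _ fun _ h' => h'.trans_lt h

theorem debski_nonneg (c : ℝ) : 0 ≤ debski d c :=
  tsum_nonneg fun n => by split_ifs <;> positivity

theorem debskiUp_le_one (c : ℝ) : debskiUp d c ≤ 1 := by
  have := tsum_ite_half_pow_le (fun n => d n ≤ c) (fun _ => True) fun _ _ => trivial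
  simp only [if_true, hasSum_half_pow.tsum_eq] at this
  exact this

theorem debskiUp_eq_of_notMem {c : ℝ} (h : c ∉ range d) : debskiUp d c = debski d c := by
  refine tsum_congr fun n => ?_
  have : d n ≠ c := fun h' => h ⟨n, h'⟩
  simp [le_iff_lt_or_eq, this]

theorem debskiUp_apply (hd : Function.Injective d) (k : ℕ) :
    debskiUp d (d k) = debski d (d k) + (1 / 2) ^ (k + 1) := by
  have h : ∀ n, (if d n ≤ d k then (1 / 2 : ℝ) ^ (n + 1) else 0) =
      (if d n < d k then (1 / 2 : ℝ) ^ (n + 1) else 0) + if n = k then (1 / 2 : ℝ) ^ (k + 1) else 0 := by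
    intro n
    by_cases hn : n = k
    · subst hn; simp
    · have : d n ≠ d k := fun h => hn (hd h)
      simp [hn, le_iff_lt_or_eq, this]
  unfold debskiUp debski
  rw [tsum_congr h, (summable_ite_half_pow _).tsum_add (summable_of_hasFiniteSupport
    ((finite_singleton k).subset fun n hn => by by_contra h'; simp_all)), tsum_ite_eq]

theorem debski_lt_debskiUp (hd : Function.Injective d) (k : ℕ) :
    debski d (d k) < debskiUp d (d k) := by
  rw [debskiUp_apply hd]
  have : (0 : ℝ) < (1 / 2) ^ (k + 1) := by positivity
  linarith

theorem debskiUp_eq_debski {a b : ℝ} (h : a < b) (h' : ∀ n, d n ∉ Ioo a b) :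
    debskiUp d a = debski d b := by
  refine tsum_congr fun n => ?_
  have : d n ≤ a ↔ d n < b := ⟨fun h1 => h1.trans_lt h, fun h1 => by
    by_contra h2; exact h' n ⟨not_le.1 h2, h1⟩⟩
  simp [this]

/-- Finitely many terms already push the sum above `y`, and openness keeps each of them switched on
nearby. -/
theorem lowerSemicontinuous_tsum_ite {X : Type*} [TopologicalSpace X] (U : ℕ → Set X)
    (hU : ∀ n, IsOpen (U n)) [∀ x, DecidablePred fun n => x ∈ U n] :
    LowerSemicontinuous fun x => ∑' n : ℕ, if x ∈ U n then (1 / 2 : ℝ) ^ (n + 1) else 0 := by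
  intro x y hy
  have hs := (summable_ite_half_pow fun n => x ∈ U n).hasSum
  obtain ⟨s, hs⟩ := (hs.eventually (lt_mem_nhds hy)).exists
  have : ∀ᶠ x' in 𝓝 x, ∀ n ∈ s, x ∈ U n → x' ∈ U n := by
    rw [Filter.eventually_all_finset]
    intro n _
    by_cases hn : x ∈ U n
    · filter_upwards [(hU n).mem_nhds hn] with x' hx' _ using hx'
    · exact Filter.Eventually.of_forall fun _ h => absurd h hn
  filter_upwards [this] with x' hx'
  refine hs.trans_le (le_trans (Finset.sum_le_sum fun n hn => ?_)
    ((summable_ite_half_pow fun n => x' ∈ U n).sum_le_tsum s fun n _ => by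
      split_ifs <;> positivity))
  by_cases h : x ∈ U n
  · simp [h, hx' n hn h]
  · simp only [h, if_false]; split_ifs <;> positivity

theorem lowerSemicontinuous_debski : LowerSemicontinuous (debski d) :=
  lowerSemicontinuous_tsum_ite (fun n => Ioi (d n)) fun _ => isOpen_Ioi

/-- The total mass is 1, so the complementary sum runs over open conditions. This reduces upper
semicontinuity to lower semicontinuity. -/
theorem debskiUp_eq_one_sub (c : ℝ) :
    debskiUp d c = 1 - ∑' n : ℕ, if c < d n then (1 / 2 : ℝ) ^ (n + 1) else 0 := by
  rw [eq_sub_iff_add_eq, debskiUp, ← (summable_ite_half_pow _).tsum_add (summable_ite_half_pow _)]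
  refine (tsum_congr fun n => ?_).trans hasSum_half_pow.tsum_eq
  by_cases h : d n ≤ c
  · simp [h]
  · simp [h, not_le.1 h]

theorem upperSemicontinuous_debskiUp : UpperSemicontinuous (debskiUp d) := by
  intro x y hy
  have h := lowerSemicontinuous_tsum_ite (fun n => Iio (d n)) (fun _ => isOpen_Iio) x
    (1 - y) (by have := debskiUp_eq_one_sub (d := d) x; simp only [mem_Iio]; linarith)
  filter_upwards [h] with x' hx'
  rw [debskiUp_eq_one_sub]
  simp only [mem_Iio] at hx'
  linarith

theorem exists_mem_Ioo (hd : IsDebskiSequence d) {a b x : ℝ} (hx : x ∈ cantorSet)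
    (hab : x ∈ Ioo a b) : ∃ n, d n ∈ Ioo a b := by
  obtain ⟨_, h, n, rfl⟩ := mem_closure_iff.1 (hd.dense hx) _ isOpen_Ioo hab
  exact ⟨n, h⟩

theorem debskiUp_lt_debski (hd : IsDebskiSequence d) {a b x : ℝ} (hx : x ∈ cantorSet)
    (hab : x ∈ Ioo a b) : debskiUp d a < debski d b := by
  obtain ⟨n, h1, h2⟩ := exists_mem_Ioo hd hx hab
  exact (debskiUp_le_debski h1).trans_lt
    ((debski_lt_debskiUp hd.injective n).trans_le (debskiUp_le_debski h2))

theorem IsDebskiSequence.notMem_endpoints (hd : IsDebskiSequence d) (n : ℕ) :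
    d n ∉ cantorEndpoints := by
  rintro ⟨k, σ, h | h⟩
  · exact (hd.not_endpoint n k σ).1 h
  · exact (hd.not_endpoint n k σ).2 h

theorem debskiUp_eq_of_endpoint (hd : IsDebskiSequence d) {c : ℝ} (hc : c ∈ cantorEndpoints) :
    debskiUp d c = debski d c :=
  debskiUp_eq_of_notMem (by rintro ⟨n, rfl⟩; exact hd.notMem_endpoints n hc)

theorem zero_mem_cantorEndpoints : (0 : ℝ) ∈ cantorEndpoints :=
  ⟨0, ![], Or.inl (by simp [leftEnd])⟩

theorem one_mem_cantorEndpoints : (1 : ℝ) ∈ cantorEndpoints :=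
  ⟨0, ![], Or.inr (by simp [leftEnd, rightEnd])⟩

theorem debski_zero (hd : IsDebskiSequence d) : debski d 0 = 0 := by
  have : ∀ n, ¬ d n < 0 := fun n => not_lt.2 (cantorSet_subset_unitInterval (hd.mem n)).1
  simp [debski, this]

theorem debski_one (hd : IsDebskiSequence d) : debski d 1 = 1 := by
  have : ∀ n, d n < 1 := fun n => lt_of_le_of_ne (cantorSet_subset_unitInterval (hd.mem n)).2
    fun h => hd.notMem_endpoints n (h ▸ one_mem_cantorEndpoints)
  simp only [debski, this, if_true, hasSum_half_pow.tsum_eq]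

theorem debskiUp_lt_one (hd : IsDebskiSequence d) {c : ℝ} (hc : c < 1) : debskiUp d c < 1 := by
  obtain ⟨y, hy, h1, h2⟩ := exists_cantorSet_between_one hc
  exact (debskiUp_lt_debski hd hy ⟨h1, h2⟩).trans_eq (debski_one hd)

theorem debski_pos (hd : IsDebskiSequence d) {c : ℝ} (hc : 0 < c) : 0 < debski d c := by
  obtain ⟨y, hy, h1, h2⟩ := exists_cantorSet_between_zero hc
  have := debskiUp_lt_debski hd hy ⟨h1, h2⟩
  rwa [debskiUp_eq_of_endpoint hd zero_mem_cantorEndpoints, debski_zero hd] at this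

/-- An intermediate value theorem: filling the jumps compensates for them, and gaps of the Cantor
set carry no mass. If no point worked, let `u` be the last point with `f u ≤ y` and `v` the first
one where the upper value reaches `y`; both exist by semicontinuity and compactness. No `d n` lies
between them, so the upper value at `u` equals the lower one at `v`, although `y` separates the two.
-/
theorem exists_debski_le_le (hd : IsDebskiSequence d) {a b y : ℝ} (ha : a ∈ cantorSet)
    (hb : b ∈ cantorSet) (hab : a ≤ b) (h1 : debski d a ≤ y) (h2 : y ≤ debskiUp d b) :
    ∃ c ∈ cantorSet, c ∈ Icc a b ∧ debski d c ≤ y ∧ y ≤ debskiUp d c := by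
  by_contra! hcon
  have hC : IsCompact (cantorSet ∩ Icc a b) := isCompact_cantorSet.inter_right isClosed_Icc
  have hA : IsCompact ((cantorSet ∩ Icc a b) ∩ {c | debski d c ≤ y}) :=
    hC.inter_right (lowerSemicontinuous_debski.isClosed_preimage y)
  have hB : IsCompact ((cantorSet ∩ Icc a b) ∩ {c | y ≤ debskiUp d c}) :=
    hC.inter_right (upperSemicontinuous_debskiUp.isClosed_preimage y)
  obtain ⟨u, ⟨⟨huC, hu⟩, hu'⟩, humax⟩ := hA.exists_isGreatest ⟨a, ⟨ha, le_rfl, hab⟩, h1⟩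
  obtain ⟨v, ⟨⟨hvC, hv⟩, hv'⟩, hvmin⟩ := hB.exists_isLeast ⟨b, ⟨hb, hab, le_rfl⟩, h2⟩
  have huy := hcon u huC hu hu'
  have huv : u < v := by
    by_contra h
    exact absurd (hv'.trans (debskiUp_mono (not_lt.1 h))) (not_le.2 huy)
  have hvy : y < debski d v := by
    by_contra h
    exact absurd (hcon v hvC hv (not_lt.1 h)) (not_lt.2 hv')
  have hgap : ∀ n, d n ∉ Ioo u v := by
    intro n hn
    have hm : d n ∈ cantorSet ∩ Icc a b := ⟨hd.mem n, hu.1.trans hn.1.le, hn.2.le.trans hv.2⟩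
    rcases le_or_gt (debski d (d n)) y with h | h
    · exact absurd (humax ⟨hm, h⟩) (not_le.2 hn.1)
    · exact absurd (hvmin ⟨hm, h.le.trans (debski_le_debskiUp _)⟩) (not_le.2 hn.2)
  have := debskiUp_eq_debski huv hgap
  linarith

/-- From here on the curve is the region between a lower and an upper semicontinuous function, which
agree except at the `d n`. -/
theorem mem_debskiCurve (hd : IsDebskiSequence d) (p : ℝ × ℝ) :
    p ∈ debskiCurve d ↔
      p.1 ∈ cantorSet ∧ debski d p.1 ≤ p.2 ∧ p.2 ≤ debskiUp d p.1 := by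
  constructor
  · rintro (⟨h1, h2⟩ | h)
    · exact ⟨h1, h2.ge, h2.le.trans (debski_le_debskiUp _)⟩
    · obtain ⟨n, h1, h2, h3⟩ := mem_iUnion.1 h
      rw [mem_singleton_iff] at h1
      rw [h1, debskiUp_apply hd.injective]
      exact ⟨hd.mem n, h2, h3⟩
  · rintro ⟨h1, h2, h3⟩
    by_cases h : p.1 ∈ range d
    · obtain ⟨n, hn⟩ := h
      refine Or.inr (mem_iUnion.2 ⟨n, hn.symm, ?_, ?_⟩)
      · rwa [hn]
      · rwa [← debskiUp_apply hd.injective, hn]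
    · rw [debskiUp_eq_of_notMem h] at h3
      exact Or.inl ⟨h1, le_antisymm h3 h2⟩

theorem mem_debskiMidpoints (hd : IsDebskiSequence d) (p : ℝ × ℝ) :
    p ∈ debskiMidpoints d ↔ debski d p.1 < debskiUp d p.1 ∧
      p.2 = (debski d p.1 + debskiUp d p.1) / 2 := by
  constructor
  · rintro ⟨n, rfl⟩
    refine ⟨debski_lt_debskiUp hd.injective n, ?_⟩
    simp only [debskiUp_apply hd.injective]
    ring
  · rintro ⟨h1, h2⟩
    have h : p.1 ∈ range d := by
      by_contra h
      exact h1.ne (debskiUp_eq_of_notMem h).symm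
    obtain ⟨n, hn⟩ := h
    refine ⟨n, Prod.ext hn ?_⟩
    rw [h2, ← hn, debskiUp_apply hd.injective]
    ring

/-- The jump at `d n` is the n-th power in a summable sequence, and there are no other jumps. -/
theorem finite_jump_ge (hd : Function.Injective d) {η : ℝ} (hη : 0 < η) :
    {c | η ≤ debskiUp d c - debski d c}.Finite := by
  obtain ⟨N, hN⟩ := exists_pow_lt_of_lt_one hη (by norm_num : (1 / 2 : ℝ) < 1)
  refine ((finite_Iio N).image d).subset fun c hc => ?_
  simp only [mem_ofPred_eq] at hc
  by_cases h : c ∈ range d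
  · obtain ⟨n, rfl⟩ := h
    refine ⟨n, ?_, rfl⟩
    rw [debskiUp_apply hd] at hc
    by_contra hn
    have hn' : N ≤ n + 1 := (not_lt.1 hn).trans (Nat.le_succ n)
    have := pow_le_pow_of_le_one (by norm_num : (0 : ℝ) ≤ 1 / 2) (by norm_num) hn'
    linarith
  · rw [debskiUp_eq_of_notMem h] at hc
    linarith

end Debski

/-! ### The curve of a box as the region between two monotone functions -/

namespace Box

variable {d : ℕ → ℝ} {n k : ℕ}

/-- The lower boundary of the curve of a box. -/
noncomputable def lo (d : ℕ → ℝ) (ρ : Box n) (x : ℝ) : ℝ :=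
  ρ.bot + debski d (blockCoord ρ.word x) * (ρ.top - ρ.bot)

/-- The upper boundary of the curve of a box. -/
noncomputable def hi (d : ℕ → ℝ) (ρ : Box n) (x : ℝ) : ℝ :=
  ρ.bot + debskiUp d (blockCoord ρ.word x) * (ρ.top - ρ.bot)

theorem lo_le_hi {ρ : Box n} (h : ρ.bot < ρ.top) (x : ℝ) : ρ.lo d x ≤ ρ.hi d x := by
  have := debski_le_debskiUp (d := d) (blockCoord ρ.word x)
  have h' := sub_pos.2 h
  unfold lo hi
  gcongr

theorem bot_le_lo {ρ : Box n} (h : ρ.bot < ρ.top) (x : ℝ) : ρ.bot ≤ ρ.lo d x := by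
  have := debski_nonneg (d := d) (blockCoord ρ.word x)
  have h' := sub_pos.2 h
  unfold lo
  nlinarith

theorem hi_le_top {ρ : Box n} (h : ρ.bot < ρ.top) (x : ℝ) : ρ.hi d x ≤ ρ.top := by
  have := debskiUp_le_one (d := d) (blockCoord ρ.word x)
  have h' := sub_pos.2 h
  unfold hi
  nlinarith

theorem hi_le_lo {ρ : Box n} (h : ρ.bot < ρ.top) {x y : ℝ} (hxy : x < y) :
    ρ.hi d x ≤ ρ.lo d y := by
  have := debskiUp_le_debski (d := d) (blockCoord_strictMono ρ.word hxy)
  have h' := sub_pos.2 h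
  unfold lo hi
  gcongr

theorem hi_lt_lo (hd : IsDebskiSequence d) {ρ : Box n} (h : ρ.bot < ρ.top) {x y z : ℝ}
    (hz : z ∈ cantorBlock ρ.word) (hxy : z ∈ Ioo x y) : ρ.hi d x < ρ.lo d y := by
  have := debskiUp_lt_debski hd ((mem_cantorBlock_iff _ _).1 hz)
    ⟨blockCoord_strictMono ρ.word hxy.1, blockCoord_strictMono ρ.word hxy.2⟩
  have h' := sub_pos.2 h
  unfold lo hi
  gcongr

theorem map_eq_iff {ρ : Box n} (h : ρ.bot < ρ.top) (p q : ℝ × ℝ) :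
    ρ.map q = p ↔ q = (blockCoord ρ.word p.1, (p.2 - ρ.bot) / (ρ.top - ρ.bot)) := by
  have h' := (sub_pos.2 h).ne'
  have h3 : (3 : ℝ) ^ n ≠ 0 := by positivity
  simp only [map, Prod.ext_iff, blockCoord]
  constructor
  · rintro ⟨h1, h2⟩
    rw [← h1, ← h2]
    constructor <;> field_simp <;> ring
  · rintro ⟨h1, h2⟩
    rw [h1, h2]
    constructor <;> field_simp <;> ring

theorem mem_map_image {ρ : Box n} (h : ρ.bot < ρ.top) (p : ℝ × ℝ) (A : Set (ℝ × ℝ)) :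
    p ∈ ρ.map '' A ↔ (blockCoord ρ.word p.1, (p.2 - ρ.bot) / (ρ.top - ρ.bot)) ∈ A := by
  simp [mem_image, map_eq_iff h]

theorem lo_le_iff {ρ : Box n} (h : ρ.bot < ρ.top) (x y : ℝ) :
    debski d (blockCoord ρ.word x) ≤ (y - ρ.bot) / (ρ.top - ρ.bot) ↔ ρ.lo d x ≤ y := by
  rw [le_div_iff₀ (sub_pos.2 h), le_sub_iff_add_le, add_comm]
  rfl

theorem le_hi_iff {ρ : Box n} (h : ρ.bot < ρ.top) (x y : ℝ) :
    (y - ρ.bot) / (ρ.top - ρ.bot) ≤ debskiUp d (blockCoord ρ.word x) ↔ y ≤ ρ.hi d x := by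
  rw [div_le_iff₀ (sub_pos.2 h), sub_le_iff_le_add, add_comm]
  rfl

theorem mem_curve (hd : IsDebskiSequence d) {ρ : Box n} (h : ρ.bot < ρ.top) (p : ℝ × ℝ) :
    p ∈ ρ.curve d ↔ p.1 ∈ cantorBlock ρ.word ∧ ρ.lo d p.1 ≤ p.2 ∧ p.2 ≤ ρ.hi d p.1 := by
  rw [curve, mem_map_image h, mem_debskiCurve hd, mem_cantorBlock_iff, lo_le_iff h, le_hi_iff h]

theorem mem_map_diff (hd : IsDebskiSequence d) {ρ : Box n} (h : ρ.bot < ρ.top) (p : ℝ × ℝ) :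
    p ∈ ρ.map '' (debskiCurve d \ debskiMidpoints d) ↔
      (p.1 ∈ cantorBlock ρ.word ∧ ρ.lo d p.1 ≤ p.2 ∧ p.2 ≤ ρ.hi d p.1) ∧
        ¬ (ρ.lo d p.1 < ρ.hi d p.1 ∧ p.2 = (ρ.lo d p.1 + ρ.hi d p.1) / 2) := by
  have h' := sub_pos.2 h
  have h1 : ρ.lo d p.1 < ρ.hi d p.1 ↔
      debski d (blockCoord ρ.word p.1) < debskiUp d (blockCoord ρ.word p.1) := by
    simp only [lo, hi, add_lt_add_iff_left, mul_lt_mul_iff_left₀ h']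
  have h2 : p.2 = (ρ.lo d p.1 + ρ.hi d p.1) / 2 ↔ (p.2 - ρ.bot) / (ρ.top - ρ.bot) =
      (debski d (blockCoord ρ.word p.1) + debskiUp d (blockCoord ρ.word p.1)) / 2 := by
    rw [div_eq_iff h'.ne']
    unfold lo hi
    constructor <;> intro h <;> linarith
  rw [mem_map_image h, mem_sdiff, mem_debskiCurve hd, mem_debskiMidpoints hd,
    mem_cantorBlock_iff, lo_le_iff h, le_hi_iff h, h1, h2]

theorem isClosed_lo_le {ρ : Box n} (h : ρ.bot < ρ.top) :
    IsClosed {p : ℝ × ℝ | p.1 ∈ cantorBlock ρ.word ∧ ρ.lo d p.1 ≤ p.2} := by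
  refine ((isClosed_cantorBlock _).preimage continuous_fst).inter ?_
  have h1 : IsClosed {p : ℝ × ℝ | debski d p.1 ≤ p.2} :=
    lowerSemicontinuous_debski.isClosed_epigraph
  have h2 : Continuous fun p : ℝ × ℝ =>
      (blockCoord ρ.word p.1, (p.2 - ρ.bot) / (ρ.top - ρ.bot)) :=
    ((continuous_blockCoord _).comp continuous_fst).prodMk (by fun_prop)
  have h3 := h1.preimage h2
  simp only [preimage_ofPred_eq, lo_le_iff h] at h3
  exact h3

theorem isClosed_le_hi {ρ : Box n} (h : ρ.bot < ρ.top) :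
    IsClosed {p : ℝ × ℝ | p.1 ∈ cantorBlock ρ.word ∧ p.2 ≤ ρ.hi d p.1} := by
  refine ((isClosed_cantorBlock _).preimage continuous_fst).inter ?_
  have h1 : IsClosed {p : ℝ × ℝ | p.2 ≤ debskiUp d p.1} :=
    upperSemicontinuous_iff_IsClosed_hypograph.1 upperSemicontinuous_debskiUp
  have h2 : Continuous fun p : ℝ × ℝ =>
      (blockCoord ρ.word p.1, (p.2 - ρ.bot) / (ρ.top - ρ.bot)) :=
    ((continuous_blockCoord _).comp continuous_fst).prodMk (by fun_prop)
  have h3 := h1.preimage h2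
  simp only [preimage_ofPred_eq, le_hi_iff h] at h3
  exact h3

theorem isClosed_curve (hd : IsDebskiSequence d) {ρ : Box n} (h : ρ.bot < ρ.top) :
    IsClosed (ρ.curve d) := by
  convert (isClosed_lo_le (d := d) h).inter (isClosed_le_hi (d := d) h) using 1
  ext p
  rw [mem_curve hd h]
  simp only [mem_inter_iff, mem_ofPred_eq]
  tauto

theorem lo_leftEnd_self (hd : IsDebskiSequence d) (ρ : Box n) :
    ρ.lo d (leftEnd ρ.word) = ρ.bot := by
  have : blockCoord ρ.word (leftEnd ρ.word) = 0 := by simp [blockCoord]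
  simp [lo, this, debski_zero hd]

theorem lo_rightEnd_self (hd : IsDebskiSequence d) (ρ : Box n) :
    ρ.lo d (rightEnd ρ.word) = ρ.top := by
  have : blockCoord ρ.word (rightEnd ρ.word) = 1 := by simp [blockCoord, rightEnd]
  simp [lo, this, debski_one hd]

variable {s : ℕ → Bool} {ρ : Box k}

theorem hi_eq_lo_of_endpoint (hd : IsDebskiSequence d) (ρ : Box k) {x : ℝ}
    (hx : blockCoord ρ.word x ∈ cantorEndpoints) : ρ.hi d x = ρ.lo d x := by
  rw [lo, hi, debskiUp_eq_of_endpoint hd hx]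

/-- Rescaling sends ends of subblocks to endpoints of the Cantor set, and no `d n` is an endpoint,
so the curve has no jump there. -/
theorem hi_leftEnd (hd : IsDebskiSequence d) (hw : ρ.word = initialWord s k) (hk : k ≤ n) :
    ρ.hi d (leftEnd (initialWord s n)) = ρ.lo d (leftEnd (initialWord s n)) := by
  obtain ⟨m, rfl⟩ := Nat.exists_eq_add_of_le hk
  refine hi_eq_lo_of_endpoint hd ρ ?_
  rw [hw, blockCoord_leftEnd]
  exact ⟨_, _, Or.inl rfl⟩

theorem hi_rightEnd (hd : IsDebskiSequence d) (hw : ρ.word = initialWord s k) (hk : k ≤ n) :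
    ρ.hi d (rightEnd (initialWord s n)) = ρ.lo d (rightEnd (initialWord s n)) := by
  obtain ⟨m, rfl⟩ := Nat.exists_eq_add_of_le hk
  refine hi_eq_lo_of_endpoint hd ρ ?_
  rw [hw, blockCoord_rightEnd]
  exact ⟨_, _, Or.inr rfl⟩

end Box

theorem exists_between_left {n : ℕ} {σ : Fin n → Bool} {x : ℝ} (hx : leftEnd σ < x) :
    ∃ z ∈ cantorBlock σ, z ∈ Ioo (leftEnd σ) x := by
  have h3 : (0 : ℝ) < 3 ^ n := by positivity
  obtain ⟨y, hy, h1, h2⟩ := exists_cantorSet_between_zero (mul_pos (sub_pos.2 hx) h3)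
  refine ⟨leftEnd σ + y / 3 ^ n, ?_, ?_, ?_⟩
  · rw [mem_cantorBlock_iff, blockCoord_add]; exact hy
  · have := div_pos h1 h3; linarith
  · rw [← div_lt_iff₀ h3] at h2; linarith

theorem exists_between_right {n : ℕ} {σ : Fin n → Bool} {x : ℝ} (hx : x < rightEnd σ) :
    ∃ z ∈ cantorBlock σ, z ∈ Ioo x (rightEnd σ) := by
  have h3 : (0 : ℝ) < 3 ^ n := by positivity
  have hx' : (x - leftEnd σ) * 3 ^ n < 1 := by
    rw [← lt_div_iff₀ h3]; unfold rightEnd at hx; linarith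
  obtain ⟨y, hy, h1, h2⟩ := exists_cantorSet_between_one hx'
  refine ⟨leftEnd σ + y / 3 ^ n, ?_, ?_, ?_⟩
  · rw [mem_cantorBlock_iff, blockCoord_add]; exact hy
  · rw [← lt_div_iff₀ h3] at h1; linarith
  · have : y / 3 ^ n < 1 / 3 ^ n := by gcongr
    unfold rightEnd; linarith

namespace Box

variable {d : ℕ → ℝ} {n k : ℕ} {s : ℕ → Bool} {ρ : Box k}

/-- The height of the curve of a box over the left end of a subblock. -/
noncomputable def startHeight (d : ℕ → ℝ) (ρ : Box k) (s : ℕ → Bool) (n : ℕ) : ℝ :=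
  ρ.lo d (leftEnd (initialWord s n))

/-- The height of the curve of a box over the right end of a subblock. -/
noncomputable def endHeight (d : ℕ → ℝ) (ρ : Box k) (s : ℕ → Bool) (n : ℕ) : ℝ :=
  ρ.lo d (rightEnd (initialWord s n))

theorem startHeight_lt_lo (hd : IsDebskiSequence d) (h : ρ.bot < ρ.top)
    (hw : ρ.word = initialWord s k) (hk : k ≤ n) {x : ℝ} (hx : leftEnd (initialWord s n) < x) :
    ρ.startHeight d s n < ρ.lo d x := by
  obtain ⟨z, hz, hz'⟩ := exists_between_left hx
  unfold startHeight
  rw [← hi_leftEnd hd hw hk]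
  exact hi_lt_lo hd h (hw ▸ cantorBlock_antitone s hk hz) hz'

theorem hi_lt_endHeight (hd : IsDebskiSequence d) (h : ρ.bot < ρ.top)
    (hw : ρ.word = initialWord s k) (hk : k ≤ n) {x : ℝ} (hx : x < rightEnd (initialWord s n)) :
    ρ.hi d x < ρ.endHeight d s n := by
  obtain ⟨z, hz, hz'⟩ := exists_between_right hx
  exact hi_lt_lo hd h (hw ▸ cantorBlock_antitone s hk hz) hz'

theorem startHeight_lt_endHeight (hd : IsDebskiSequence d) (h : ρ.bot < ρ.top)
    (hw : ρ.word = initialWord s k) (hk : k ≤ n) : ρ.startHeight d s n < ρ.endHeight d s n :=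
  startHeight_lt_lo hd h hw hk (leftEnd_lt_rightEnd _)

theorem startHeight_le_lo (hd : IsDebskiSequence d) (h : ρ.bot < ρ.top)
    (hw : ρ.word = initialWord s k) (hk : k ≤ n) {x : ℝ} (hx : x ∈ cantorBlock (initialWord s n)) :
    ρ.startHeight d s n ≤ ρ.lo d x := by
  rcases eq_or_lt_of_le hx.1.1 with h' | h'
  · rw [startHeight, h']
  · exact (startHeight_lt_lo hd h hw hk h').le

theorem hi_le_endHeight (hd : IsDebskiSequence d) (h : ρ.bot < ρ.top)
    (hw : ρ.word = initialWord s k) (hk : k ≤ n) {x : ℝ} (hx : x ∈ cantorBlock (initialWord s n)) :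
    ρ.hi d x ≤ ρ.endHeight d s n := by
  rcases eq_or_lt_of_le hx.1.2 with h' | h'
  · rw [h', endHeight, hi_rightEnd hd hw hk]
  · exact (hi_lt_endHeight hd h hw hk h').le

/-- The intermediate value theorem `exists_debski_le_le`, transported to a subblock. -/
theorem exists_mem_curve (hd : IsDebskiSequence d) (h : ρ.bot < ρ.top)
    (hw : ρ.word = initialWord s k) (hk : k ≤ n) {y : ℝ}
    (hy : y ∈ Icc (ρ.startHeight d s n) (ρ.endHeight d s n)) :
    ∃ x ∈ cantorBlock (initialWord s n), (x, y) ∈ ρ.curve d := by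
  have hb := cantorBlock_antitone s hk (leftEnd_mem_cantorBlock (initialWord s n))
  have hb' := cantorBlock_antitone s hk (rightEnd_mem_cantorBlock (initialWord s n))
  rw [← hw, mem_cantorBlock_iff] at hb hb'
  obtain ⟨c, hc, hc', h1, h2⟩ := exists_debski_le_le hd hb hb'
    ((blockCoord_strictMono ρ.word).monotone (leftEnd_lt_rightEnd _).le)
    ((lo_le_iff h _ y).2 hy.1) ((le_hi_iff h _ y).2 (hi_rightEnd hd hw hk ▸ hy.2))
  · have hbc := blockCoord_add ρ.word c
    have hx : leftEnd ρ.word + c / 3 ^ k ∈ cantorBlock ρ.word := by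
      rw [mem_cantorBlock_iff, hbc]; exact hc
    refine ⟨leftEnd ρ.word + c / 3 ^ k, ⟨⟨?_, ?_⟩, hx.2⟩, ?_⟩
    · rw [← hbc] at hc'; exact (blockCoord_strictMono ρ.word).le_iff_le.1 hc'.1
    · rw [← hbc] at hc'; exact (blockCoord_strictMono ρ.word).le_iff_le.1 hc'.2
    · rw [mem_curve hd h]
      refine ⟨hx, (lo_le_iff h _ _).1 ?_, (le_hi_iff h _ _).1 ?_⟩
      · simpa only [hbc] using h1
      · simpa only [hbc] using h2

theorem startHeight_mono (hd : IsDebskiSequence d) (h : ρ.bot < ρ.top)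
    (hw : ρ.word = initialWord s k) (hk : k ≤ n) {m : ℕ} (hm : n ≤ m) :
    ρ.startHeight d s n ≤ ρ.startHeight d s m :=
  startHeight_le_lo hd h hw hk (cantorBlock_antitone s hm (leftEnd_mem_cantorBlock _))

theorem endHeight_anti (hd : IsDebskiSequence d) (h : ρ.bot < ρ.top)
    (hw : ρ.word = initialWord s k) (hk : k ≤ n) {m : ℕ} (hm : n ≤ m) :
    ρ.endHeight d s m ≤ ρ.endHeight d s n := by
  have := hi_le_endHeight hd h hw hk (cantorBlock_antitone s hm (rightEnd_mem_cantorBlock _))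
  exact (lo_le_hi h _).trans this

/-- A longer word gives a shorter block, so the two blocks cannot share both ends. This is the
source of all strict gaps between curves. -/
theorem leftEnd_lt_or_rightEnd_lt {m : ℕ} (hm : n < m) :
    leftEnd (initialWord s n) < leftEnd (initialWord s m) ∨
      rightEnd (initialWord s m) < rightEnd (initialWord s n) := by
  by_contra! hcon
  have h1 := cantorBlock_antitone s hm.le (leftEnd_mem_cantorBlock _)
  have h2 := cantorBlock_antitone s hm.le (rightEnd_mem_cantorBlock _)
  have h3 : (1 : ℝ) / 3 ^ m < 1 / 3 ^ n := by
    apply one_div_lt_one_div_of_lt (by positivity)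
    exact pow_lt_pow_right₀ (by norm_num) hm
  have := hcon.1; have := hcon.2
  unfold rightEnd at *
  linarith


theorem startHeight_self (hd : IsDebskiSequence d) (hw : ρ.word = initialWord s k) :
    ρ.startHeight d s k = ρ.bot := by
  rw [startHeight, ← hw, lo_leftEnd_self hd]

theorem endHeight_self (hd : IsDebskiSequence d) (hw : ρ.word = initialWord s k) :
    ρ.endHeight d s k = ρ.top := by
  rw [endHeight, ← hw, lo_rightEnd_self hd]

end Box

/-! ### Finite enumerations and subdivisions -/

theorem StrictMonoOn.eqOn_Iic_of_image_eq {m : ℕ} {f g : ℕ → ℝ} (hf : StrictMonoOn f (Iic m))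
    (hg : StrictMonoOn g (Iic m)) (h : f '' Iic m = g '' Iic m) : EqOn f g (Iic m) := by
  have aux : ∀ {f g : ℕ → ℝ}, StrictMonoOn f (Iic m) → StrictMonoOn g (Iic m) →
      f '' Iic m = g '' Iic m → ∀ j ≤ m, (∀ i < j, f i = g i) → f j ≤ g j := by
    intro f g hf hg h j hj ih
    obtain ⟨l, hl, hl'⟩ : g j ∈ f '' Iic m := h ▸ mem_image_of_mem g hj
    rw [← hl']
    refine hf.monotoneOn hj hl ?_
    by_contra hlj
    push Not at hlj
    rw [ih l hlj] at hl'
    exact (hg hl hj hlj).ne hl'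
  intro j
  induction j using Nat.strong_induction_on with
  | _ j ih =>
    intro hj
    have hj' : j ≤ m := hj
    exact le_antisymm (aux hf hg h j hj fun i hi => ih i hi (hi.le.trans hj'))
      (aux hg hf h.symm j hj fun i hi => (ih i hi (hi.le.trans hj')).symm)

theorem exists_strictMonoOn_image_eq {A : Set ℝ} (hA : A.Finite) {m : ℕ} (hm : A.ncard = m + 1) :
    ∃ x : ℕ → ℝ, StrictMonoOn x (Iic m) ∧ x '' Iic m = A := by
  have hcard : hA.toFinset.card = m + 1 := by rw [← ncard_eq_toFinset_card A hA, hm]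
  let e := hA.toFinset.orderEmbOfFin hcard
  refine ⟨fun i => e (Fin.ofNat (m + 1) i), fun i hi j hj hij => ?_, ?_⟩
  · refine e.strictMono ?_
    simp only [mem_Iic] at hi hj
    rw [Fin.lt_def, Fin.val_ofNat, Fin.val_ofNat, Nat.mod_eq_of_lt (by omega),
      Nat.mod_eq_of_lt (by omega)]
    exact hij
  · have hr : range e = A := by
      have := Finset.range_orderEmbOfFin hA.toFinset hcard
      rwa [hA.coe_toFinset] at this
    ext y
    rw [← hr]
    constructor
    · rintro ⟨i, -, rfl⟩; exact mem_range_self _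
    · rintro ⟨i, rfl⟩
      refine ⟨i, Nat.lt_succ_iff.1 i.2, ?_⟩
      simp

/-- Disjoint intervals are ordered in the same way by their left ends as by their right ends, so the
j-th left end and the j-th right end belong to the same interval. -/
theorem exists_common_enumeration {α : Type*} {P : Set α} {x y : α → ℝ}
    (hxy : ∀ p ∈ P, x p < y p) (hord : ∀ p ∈ P, ∀ q ∈ P, p ≠ q → y p < x q ∨ y q < x p)
    {m : ℕ} {u v : ℕ → ℝ} (hu : StrictMonoOn u (Iic m)) (hv : StrictMonoOn v (Iic m))
    (hu' : u '' Iic m = x '' P) (hv' : v '' Iic m = y '' P) :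
    ∃ φ : ℕ → α, (∀ j ≤ m, φ j ∈ P ∧ u j = x (φ j) ∧ v j = y (φ j)) ∧
      ∀ p ∈ P, ∃ j ≤ m, φ j = p := by
  have h1 : ∀ j : ℕ, ∃ p, j ≤ m → p ∈ P ∧ x p = u j := by
    intro j
    by_cases hj : j ≤ m
    · obtain ⟨p, hp, hp'⟩ : u j ∈ x '' P := hu' ▸ mem_image_of_mem u hj
      exact ⟨p, fun _ => ⟨hp, hp'⟩⟩
    · obtain ⟨p, -⟩ : u 0 ∈ x '' P := hu' ▸ mem_image_of_mem u (Nat.zero_le m)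
      exact ⟨p, fun h => absurd h hj⟩
  choose φ hφ using h1
  have hsurj : ∀ p ∈ P, ∃ j ≤ m, φ j = p := by
    intro p hp
    obtain ⟨j, hj, hj'⟩ : x p ∈ u '' Iic m := hu' ▸ mem_image_of_mem x hp
    refine ⟨j, hj, ?_⟩
    by_contra hne
    have h2 := hφ j hj
    have := hxy _ h2.1
    have := hxy p hp
    rcases hord _ h2.1 p hp hne with h | h <;> linarith
  have hmono : StrictMonoOn (fun j => y (φ j)) (Iic m) := by
    intro i hi j hj hij
    have h2 := hφ i hi
    have h3 := hφ j hj
    have h4 := hu hi hj hij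
    have h5 := hxy _ h2.1
    have h6 := hxy _ h3.1
    have hne : φ i ≠ φ j := by
      intro h
      rw [h] at h2
      linarith
    simp only
    rcases hord _ h2.1 _ h3.1 hne with h | h <;> linarith
  have himg : (fun j => y (φ j)) '' Iic m = v '' Iic m := by
    rw [hv']
    ext z
    constructor
    · rintro ⟨j, hj, rfl⟩; exact mem_image_of_mem y (hφ j hj).1
    · rintro ⟨p, hp, rfl⟩
      obtain ⟨j, hj, rfl⟩ := hsurj p hp
      exact ⟨j, hj, rfl⟩
  have heq := hmono.eqOn_Iic_of_image_eq hv himg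
  exact ⟨φ, fun j hj => ⟨(hφ j hj).1, (hφ j hj).2.symm, (heq hj).symm⟩, hsurj⟩

theorem exists_isSubdivision {ε u v : ℝ} (hε : 0 < ε) (h : u < v) : ∃ S, IsSubdivision ε u v S := by
  obtain ⟨p, hp⟩ := exists_nat_gt ((v - u) / ε)
  have hp0 : (0 : ℝ) < p := (div_pos (sub_pos.2 h) hε).trans hp
  have hvu := sub_pos.2 h
  refine ⟨_, p, fun i => u + i * ((v - u) / p), by simp, ?_, fun i _ => ⟨?_, ?_⟩, rfl⟩
  · field_simp; ring
  · push_cast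
    have := div_pos hvu hp0
    linarith
  · push_cast
    have : (v - u) / p ≤ ε := by
      rw [div_lt_iff₀ hε] at hp
      rw [div_le_iff₀ hp0]; linarith
    linarith

theorem monotone_of_lt_succ {p : ℕ} {t : ℕ → ℝ}
    (ht : ∀ i < p, t i < t (i + 1)) {i j : ℕ} (hij : i ≤ j) (hj : j ≤ p) : t i ≤ t j := by
  induction j, hij using Nat.le_induction with
  | base => exact le_rfl
  | succ j _ ih => exact (ih (by omega)).trans (ht j (by omega)).le

theorem IsSubdivision.bounds {ε u v : ℝ} {S : Set (ℝ × ℝ)} (h : IsSubdivision ε u v S)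
    {q : ℝ × ℝ} (hq : q ∈ S) : u ≤ q.1 ∧ q.1 < q.2 ∧ q.2 ≤ v ∧ q.2 - q.1 ≤ ε := by
  obtain ⟨p, t, h0, hp, ht, rfl⟩ := h
  obtain ⟨i, hi, rfl⟩ := hq
  have hm := fun {i j : ℕ} => monotone_of_lt_succ (i := i) (j := j) fun i hi => (ht i hi).1
  exact ⟨h0 ▸ hm (Nat.zero_le i) hi.le, (ht i hi).1, hp ▸ hm hi le_rfl, (ht i hi).2⟩

theorem IsSubdivision.ordered {ε u v : ℝ} {S : Set (ℝ × ℝ)} (h : IsSubdivision ε u v S)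
    {q r : ℝ × ℝ} (hq : q ∈ S) (hr : r ∈ S) (hqr : q ≠ r) : q.2 ≤ r.1 ∨ r.2 ≤ q.1 := by
  obtain ⟨p, t, h0, hp, ht, rfl⟩ := h
  obtain ⟨i, hi, rfl⟩ := hq
  obtain ⟨j, hj, rfl⟩ := hr
  have hm := fun {i j : ℕ} => monotone_of_lt_succ (i := i) (j := j) fun i hi => (ht i hi).1
  rcases lt_trichotomy i j with h | h | h
  · exact Or.inl (hm h hj.le)
  · exact absurd (by rw [h]) hqr
  · exact Or.inr (hm h hi.le)

theorem IsSubdivision.finite {ε u v : ℝ} {S : Set (ℝ × ℝ)} (h : IsSubdivision ε u v S) :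
    S.Finite := by
  obtain ⟨p, t, h0, hp, ht, rfl⟩ := h
  refine ((finite_Iio p).image fun i => (t i, t (i + 1))).subset ?_
  rintro q ⟨i, hi, rfl⟩
  exact ⟨i, hi, rfl⟩

theorem IsSubdivision.exists_mem {ε u v : ℝ} {S : Set (ℝ × ℝ)} (h : IsSubdivision ε u v S)
    (huv : u < v) {z : ℝ} (hz : z ∈ Icc u v) : ∃ q ∈ S, z ∈ Icc q.1 q.2 := by
  classical
  obtain ⟨p, t, h0, hp, ht, rfl⟩ := h
  have hex : ∃ i, z ≤ t (i + 1) := by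
    cases p with
    | zero => rw [h0] at hp; exact absurd hp huv.ne
    | succ p => exact ⟨p, hp ▸ hz.2⟩
  have hi := Nat.find_spec hex
  have hip : Nat.find hex < p := by
    cases p with
    | zero => rw [h0] at hp; exact absurd hp huv.ne
    | succ p => exact Nat.lt_succ_of_le (Nat.find_le (hp ▸ hz.2))
  refine ⟨_, ⟨Nat.find hex, hip, rfl⟩, ?_, hi⟩
  rcases Nat.eq_zero_or_pos (Nat.find hex) with h | h
  · simp only [h, h0]; exact hz.1
  · obtain ⟨j, hj⟩ := Nat.exists_eq_add_of_lt h
    have := Nat.find_min hex (m := j) (by omega)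
    have hj' : Nat.find hex = j + 1 := by omega
    simp only [hj']
    exact (not_le.1 this).le

/-! ### The pieces of the curves over a block -/

/-- The boxes of the stages up to `n` whose curves pass over the block of `initialWord s n`. -/
def pieces (R : ∀ n, Set (Box n)) (s : ℕ → Bool) (n : ℕ) : Set (Σ k, Box k) :=
  {p | p.1 ≤ n ∧ p.2 ∈ R p.1 ∧ p.2.word = initialWord s p.1}

/-- Over the block of `initialWord s n`, the curves of the stages up to `n` are stacked on top of
each other and fill all heights in `[-n, n+1]`. -/
structure IsStacked (d : ℕ → ℝ) (R : ∀ n, Set (Box n)) (s : ℕ → Bool) (n : ℕ) : Prop where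
  pos : ∀ p ∈ pieces R s n, p.2.bot < p.2.top
  ordered : ∀ p ∈ pieces R s n, ∀ q ∈ pieces R s n, p ≠ q →
    p.2.endHeight d s n ≤ q.2.startHeight d s n ∨ q.2.endHeight d s n ≤ p.2.startHeight d s n
  bounds : ∀ p ∈ pieces R s n, -(n : ℝ) ≤ p.2.startHeight d s n ∧ p.2.endHeight d s n ≤ n + 1
  cover : ∀ y ∈ Icc (-(n : ℝ)) (n + 1), ∃ p ∈ pieces R s n,
    y ∈ Icc (p.2.startHeight d s n) (p.2.endHeight d s n)
  finite : (pieces R s n).Finite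

/-! ### Passing to a subblock and the inductive step of the stacking invariant -/

section Stacked

variable {d : ℕ → ℝ} {R : ∀ n, Set (Box n)} {s : ℕ → Bool} {n : ℕ}

/-- At least one end of the block moves inwards. If it is the left end, the upper curve starts
strictly higher; if it is the right end, the lower curve stops strictly lower. Touching intervals
therefore come apart. -/
theorem IsStacked.ordered_succ (hd : IsDebskiSequence d) (h : IsStacked d R s n)
    {p q : Σ k, Box k} (hp : p ∈ pieces R s n) (hq : q ∈ pieces R s n) (hpq : p ≠ q) :
    p.2.endHeight d s (n + 1) < q.2.startHeight d s (n + 1) ∨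
      q.2.endHeight d s (n + 1) < p.2.startHeight d s (n + 1) := by
  have key : ∀ {p q : Σ k, Box k}, p ∈ pieces R s n → q ∈ pieces R s n →
      p.2.endHeight d s n ≤ q.2.startHeight d s n →
      p.2.endHeight d s (n + 1) < q.2.startHeight d s (n + 1) := by
    intro p q hp hq hle
    have hpp := h.pos p hp
    have hqp := h.pos q hq
    rcases Box.leftEnd_lt_or_rightEnd_lt (s := s) (Nat.lt_succ_self n) with hl | hr
    · have h1 := Box.startHeight_lt_lo hd hqp hq.2.2 hq.1 hl
      have h2 := Box.endHeight_anti hd hpp hp.2.2 hp.1 (Nat.le_succ n)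
      change _ < q.2.startHeight d s (n + 1) at h1
      exact h2.trans_lt (hle.trans_lt h1)
    · have h1 := Box.hi_lt_endHeight hd hpp hp.2.2 hp.1 hr
      have h2 := Box.startHeight_mono hd hqp hq.2.2 hq.1 (Nat.le_succ n)
      have h3 := (Box.lo_le_hi (d := d) hpp (rightEnd (initialWord s (n + 1)))).trans_lt h1
      exact (h3.trans_le hle).trans_le h2
  rcases h.ordered p hp q hq hpq with h' | h'
  · exact Or.inl (key hp hq h')
  · exact Or.inr (key hq hp h')

theorem IsStacked.start_lt_end (hd : IsDebskiSequence d) (h : IsStacked d R s n)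
    {p : Σ k, Box k} (hp : p ∈ pieces R s n) {m : ℕ} (hm : n ≤ m) :
    p.2.startHeight d s m < p.2.endHeight d s m :=
  Box.startHeight_lt_endHeight hd (h.pos p hp) hp.2.2 (hp.1.trans hm)

/-- Over an end of the subblock a curve has a single height, since it has no jump there. -/
theorem IsStacked.heightsAt_leftEnd (hd : IsDebskiSequence d)
    (hpos : ∀ k ≤ n, ∀ ρ ∈ R k, ρ.bot < ρ.top) :
    heightsAt d R (n + 1) (leftEnd (initialWord s (n + 1))) =
      (fun p : Σ k, Box k => p.2.startHeight d s (n + 1)) '' pieces R s n := by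
  ext y
  constructor
  · rintro ⟨k, hk, ρ, hρ, hy⟩
    rw [Box.mem_curve hd (hpos k (by omega) ρ hρ)] at hy
    have hw := eq_initialWord hk.le (leftEnd_mem_cantorBlock _) hy.1
    refine ⟨⟨k, ρ⟩, ⟨by simp only; omega, hρ, hw⟩, ?_⟩
    have h2 := hy.2.2
    rw [Box.hi_leftEnd hd hw hk.le] at h2
    exact le_antisymm hy.2.1 h2
  · rintro ⟨⟨k, ρ⟩, ⟨hk, hρ, hw⟩, rfl⟩
    refine ⟨k, Nat.lt_succ_of_le hk, ρ, hρ, ?_⟩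
    rw [Box.mem_curve hd (hpos k hk ρ hρ)]
    simp only at hk hw
    refine ⟨hw ▸ cantorBlock_antitone s (by omega) (leftEnd_mem_cantorBlock _), le_rfl, ?_⟩
    rw [Box.hi_leftEnd hd hw (by omega)]
    exact le_rfl

theorem IsStacked.heightsAt_rightEnd (hd : IsDebskiSequence d)
    (hpos : ∀ k ≤ n, ∀ ρ ∈ R k, ρ.bot < ρ.top) :
    heightsAt d R (n + 1) (rightEnd (initialWord s (n + 1))) =
      (fun p : Σ k, Box k => p.2.endHeight d s (n + 1)) '' pieces R s n := by
  ext y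
  constructor
  · rintro ⟨k, hk, ρ, hρ, hy⟩
    rw [Box.mem_curve hd (hpos k (by omega) ρ hρ)] at hy
    have hw := eq_initialWord hk.le (rightEnd_mem_cantorBlock _) hy.1
    refine ⟨⟨k, ρ⟩, ⟨by simp only; omega, hρ, hw⟩, ?_⟩
    have h2 := hy.2.2
    rw [Box.hi_rightEnd hd hw hk.le] at h2
    exact le_antisymm hy.2.1 h2
  · rintro ⟨⟨k, ρ⟩, ⟨hk, hρ, hw⟩, rfl⟩
    refine ⟨k, Nat.lt_succ_of_le hk, ρ, hρ, ?_⟩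
    rw [Box.mem_curve hd (hpos k hk ρ hρ)]
    simp only at hk hw
    refine ⟨hw ▸ cantorBlock_antitone s (by omega) (rightEnd_mem_cantorBlock _), le_rfl, ?_⟩
    rw [Box.hi_rightEnd hd hw (by omega)]
    exact le_rfl

/-- The sorted heights at both ends of a subblock belong to the same pieces. -/
theorem IsStacked.exists_enumeration (hd : IsDebskiSequence d) (h : IsStacked d R s n)
    (hpos : ∀ k ≤ n, ∀ ρ ∈ R k, ρ.bot < ρ.top) {m : ℕ} {x y : ℕ → ℝ}
    (he : EnumeratesHeights d R (initialWord s (n + 1)) m x y) :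
    ∃ φ : ℕ → Σ k, Box k, (∀ j ≤ m, φ j ∈ pieces R s n ∧
      x j = (φ j).2.startHeight d s (n + 1) ∧ y j = (φ j).2.endHeight d s (n + 1)) ∧
      ∀ p ∈ pieces R s n, ∃ j ≤ m, φ j = p := by
  obtain ⟨hx, hy, hx', hy'⟩ := he
  rw [heightsAt_leftEnd hd hpos] at hx'
  rw [heightsAt_rightEnd hd hpos] at hy'
  exact exists_common_enumeration (fun p hp => h.start_lt_end hd hp (Nat.le_succ n))
    (fun p hp q hq hpq => h.ordered_succ hd hp hq hpq) hx hy hx' hy'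

theorem IsStacked.interlaced (hd : IsDebskiSequence d) (h : IsStacked d R s n)
    (hpos : ∀ k ≤ n, ∀ ρ ∈ R k, ρ.bot < ρ.top) {m : ℕ} {x y : ℕ → ℝ}
    (he : EnumeratesHeights d R (initialWord s (n + 1)) m x y) :
    -(n : ℝ) ≤ x 0 ∧ (∀ j ≤ m, x j < y j) ∧ (∀ j < m, y j < x (j + 1)) ∧ y m ≤ n + 1 ∧
      ∀ j ≤ m, ∃ k < n + 1, ∃ ρ ∈ R k, (leftEnd (initialWord s (n + 1)), x j) ∈ ρ.curve d ∧
        (rightEnd (initialWord s (n + 1)), y j) ∈ ρ.curve d := by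
  obtain ⟨φ, hφ, -⟩ := h.exists_enumeration hd hpos he
  have hlt : ∀ j ≤ m, x j < y j := by
    intro j hj
    obtain ⟨h1, h2, h3⟩ := hφ j hj
    rw [h2, h3]
    exact h.start_lt_end hd h1 (Nat.le_succ n)
  refine ⟨?_, hlt, ?_, ?_, ?_⟩
  · obtain ⟨h1, h2, h3⟩ := hφ 0 (Nat.zero_le m)
    rw [h2]
    exact (h.bounds _ h1).1.trans
      (Box.startHeight_mono hd (h.pos _ h1) h1.2.2 h1.1 (Nat.le_succ n))
  · intro j hj
    have hj' : x j < x (j + 1) := he.1 (mem_Iic.2 hj.le) (mem_Iic.2 hj) (Nat.lt_succ_self j)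
    have hl1 := hlt j hj.le
    have hl2 := hlt (j + 1) hj
    obtain ⟨h1, h2, h3⟩ := hφ j hj.le
    obtain ⟨h1', h2', h3'⟩ := hφ (j + 1) hj
    have hne : φ j ≠ φ (j + 1) := by
      intro h
      rw [h2, h2', h] at hj'
      exact lt_irrefl _ hj'
    rcases h.ordered_succ hd h1 h1' hne with h' | h'
    · rwa [h3, h2']
    · rw [← h3', ← h2] at h'
      linarith
  · obtain ⟨h1, h2, h3⟩ := hφ m le_rfl
    rw [h3]
    exact (Box.endHeight_anti hd (h.pos _ h1) h1.2.2 h1.1 (Nat.le_succ n)).trans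
      (h.bounds _ h1).2
  · intro j hj
    obtain ⟨⟨hk, hρ, hw⟩, h2, h3⟩ := hφ j hj
    have hk' : (φ j).1 ≤ n + 1 := by omega
    refine ⟨_, Nat.lt_succ_of_le hk, _, hρ, ?_, ?_⟩
    · rw [Box.mem_curve hd (hpos _ hk _ hρ), h2]
      refine ⟨hw ▸ cantorBlock_antitone s hk' (leftEnd_mem_cantorBlock _), le_rfl, ?_⟩
      rw [Box.hi_leftEnd hd hw hk']; exact le_rfl
    · rw [Box.mem_curve hd (hpos _ hk _ hρ), h3]
      refine ⟨hw ▸ cantorBlock_antitone s hk' (rightEnd_mem_cantorBlock _), le_rfl, ?_⟩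
      rw [Box.hi_rightEnd hd hw hk']; exact le_rfl

/-- The shrunken old intervals alternate with the gaps, and the new rectangles subdivide the gaps
together with the two outer strips, which extend the range by at least one at each end. -/
theorem isStacked_succ (hd : IsDebskiSequence d) (h : IsStacked d R s n)
    (hpos : ∀ k ≤ n, ∀ ρ ∈ R k, ρ.bot < ρ.top)
    (ht : TilesStrips d R (initialWord s (n + 1))) : IsStacked d R s (n + 1) := by
  obtain ⟨m, x, y, he, S₀, S₁, S, hS₀, hS₁, hS, hR⟩ := ht
  obtain ⟨hx0, hxy, hyx, hym, -⟩ := h.interlaced hd hpos he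
  obtain ⟨φ, hφ, hφ'⟩ := h.exists_enumeration hd hpos he
  -- A uniform index for the three kinds of strips: strip `j` is `[l j, u j]` for `j ≤ m + 1`,
  -- subdivided by `T j`, and the old piece `φ j` occupies `[u j, l (j + 1)]` for `j ≤ m`.
  let l : ℕ → ℝ := fun j => if j = 0 then -((n + 1 : ℕ) : ℝ) else y (j - 1)
  let u : ℕ → ℝ := fun j => if j ≤ m then x j else ((n + 1 : ℕ) : ℝ) + 1
  let T : ℕ → Set (ℝ × ℝ) := fun j => if j = 0 then S₀ else if j ≤ m then S (j - 1) else S₁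
  have hT : ∀ j ≤ m + 1, IsSubdivision (1 / (((n + 1 : ℕ) : ℝ) + 1)) (l j) (u j) (T j) := by
    intro j hj
    rcases Nat.eq_zero_or_pos j with rfl | hj0
    · simpa [l, u, T] using hS₀
    · obtain ⟨i, rfl⟩ : ∃ i, j = i + 1 := ⟨j - 1, by omega⟩
      by_cases hi : i + 1 ≤ m
      · simpa [l, u, T, hi] using hS i hi
      · obtain rfl : i = m := by omega
        simpa [l, u, T] using hS₁
  have hRT : ∀ a b : ℝ, (⟨initialWord s (n + 1), a, b⟩ : Box (n + 1)) ∈ R (n + 1) ↔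
      ∃ j ≤ m + 1, (a, b) ∈ T j := by
    intro a b
    have h1 := Set.ext_iff.1 hR (a, b)
    simp only [mem_ofPred_eq, mem_union, mem_iUnion] at h1
    rw [h1]
    constructor
    · rintro ((h | h) | ⟨j, hj, h⟩)
      · exact ⟨0, by omega, by simpa [T] using h⟩
      · exact ⟨m + 1, le_rfl, by simpa [T] using h⟩
      · exact ⟨j + 1, by omega, by simpa [T, Nat.succ_le_of_lt hj] using h⟩
    · rintro ⟨j, hj, h⟩
      rcases Nat.eq_zero_or_pos j with rfl | hj0
      · exact Or.inl (Or.inl (by simpa [T] using h))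
      · obtain ⟨i, rfl⟩ : ∃ i, j = i + 1 := ⟨j - 1, by omega⟩
        by_cases hi : i + 1 ≤ m
        · exact Or.inr ⟨i, hi, by simpa [T, hi] using h⟩
        · exact Or.inl (Or.inr (by simpa [T, hi] using h))
  have hlu : ∀ j ≤ m + 1, l j < u j := by
    intro j hj
    rcases Nat.eq_zero_or_pos j with rfl | hj0
    · simp only [l, u, if_true, Nat.zero_le]; push_cast; linarith
    · obtain ⟨i, rfl⟩ : ∃ i, j = i + 1 := ⟨j - 1, by omega⟩
      by_cases hi : i + 1 ≤ m
      · simpa [l, u, hi] using hyx i hi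
      · obtain rfl : i = m := by omega
        simp only [l, u, Nat.add_sub_cancel, hi, if_false, Nat.succ_ne_zero]
        push_cast; linarith
  have hul : ∀ j ≤ m, u j < l (j + 1) := by
    intro j hj
    simpa [l, u, hj] using hxy j hj
  have hulmono : ∀ i j, i < j → j ≤ m + 1 → u i ≤ l j := by
    intro i j hij
    induction j, hij using Nat.le_induction with
    | base => exact fun h => (hul i (by omega)).le
    | succ j hij ih =>
      intro h
      exact (ih (by omega)).trans ((hlu j (by omega)).le.trans (hul j (by omega)).le)
  have hold : ∀ p ∈ pieces R s n, ∃ j ≤ m, p.2.startHeight d s (n + 1) = u j ∧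
      p.2.endHeight d s (n + 1) = l (j + 1) := by
    intro p hp
    obtain ⟨j, hj, rfl⟩ := hφ' p hp
    refine ⟨j, hj, ?_, ?_⟩
    · simp [u, hj, (hφ j hj).2.1]
    · simp [l, (hφ j hj).2.2]
  have hcases : ∀ p ∈ pieces R s (n + 1), p ∈ pieces R s n ∨
      ∃ j ≤ m + 1, (p.2.startHeight d s (n + 1), p.2.endHeight d s (n + 1)) ∈ T j ∧
        p = ⟨n + 1, initialWord s (n + 1), p.2.startHeight d s (n + 1),
          p.2.endHeight d s (n + 1)⟩ ∧ p.2.bot < p.2.top := by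
    rintro ⟨k, ρ⟩ ⟨hk, hρ, hw⟩
    rcases Nat.lt_or_ge n k with hk' | hk'
    · right
      simp only at hk hk' hρ hw
      obtain rfl : k = n + 1 := by omega
      have hρ' : ρ = ⟨initialWord s (n + 1), ρ.bot, ρ.top⟩ := by ext1 <;> simp [hw]
      have h1 := hρ
      rw [hρ', hRT] at h1
      obtain ⟨j, hj, hjT⟩ := h1
      simp only [Box.startHeight_self hd hw, Box.endHeight_self hd hw]
      exact ⟨j, hj, hjT, by rw [← hρ'], ((hT j hj).bounds hjT).2.1⟩
    · exact Or.inl ⟨hk', hρ, hw⟩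
  have hnew : ∀ j ≤ m + 1, ∀ q ∈ T j, ∃ p ∈ pieces R s (n + 1),
      p.2.startHeight d s (n + 1) = q.1 ∧ p.2.endHeight d s (n + 1) = q.2 := by
    intro j hj q hq
    refine ⟨⟨n + 1, initialWord s (n + 1), q.1, q.2⟩, ⟨le_rfl, (hRT _ _).2 ⟨j, hj, hq⟩, rfl⟩, ?_, ?_⟩
    · exact Box.startHeight_self hd rfl
    · exact Box.endHeight_self hd rfl
  have hsub : pieces R s n ⊆ pieces R s (n + 1) := fun p hp => ⟨hp.1.trans (Nat.le_succ n), hp.2⟩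
  refine ⟨?_, ?_, ?_, ?_, ?_⟩
  · intro p hp
    rcases hcases p hp with hp' | ⟨j, hj, -, -, hlt⟩
    · exact h.pos p hp'
    · exact hlt
  · have mixed : ∀ p ∈ pieces R s n, ∀ q : ℝ × ℝ, ∀ j ≤ m + 1, q ∈ T j →
        p.2.endHeight d s (n + 1) ≤ q.1 ∨ q.2 ≤ p.2.startHeight d s (n + 1) := by
      intro p hp q j hj hq
      obtain ⟨i, hi, h1, h2⟩ := hold p hp
      have hb := (hT j hj).bounds hq
      rw [h1, h2]
      rcases Nat.lt_or_ge i j with hij | hij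
      · left
        refine le_trans ?_ hb.1
        rcases Nat.eq_or_lt_of_le (Nat.succ_le_of_lt hij) with h' | h'
        · exact (congrArg l h').le
        · exact (hlu (i + 1) (by omega)).le.trans (hulmono _ _ h' hj)
      · right
        refine hb.2.2.1.trans ?_
        rcases Nat.eq_or_lt_of_le hij with h' | h'
        · exact (congrArg u h').le
        · exact (hulmono _ _ h' (by omega)).trans (hlu i (by omega)).le
    intro p hp q hq hpq
    rcases hcases p hp with hp' | ⟨i, hi, hpi, hpe, -⟩ <;>
      rcases hcases q hq with hq' | ⟨j, hj, hqj, hqe, -⟩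
    · exact (h.ordered_succ hd hp' hq' hpq).imp le_of_lt le_of_lt
    · exact mixed p hp' _ j hj hqj
    · exact (mixed q hq' _ i hi hpi).symm
    · rcases lt_trichotomy i j with hij | rfl | hij
      · exact Or.inl (((hT i hi).bounds hpi).2.2.1.trans
          ((hulmono i j hij hj).trans ((hT j hj).bounds hqj).1))
      · refine (hT i hi).ordered hpi hqj fun heq => hpq ?_
        rw [hpe, hqe]
        simp only [Prod.mk.injEq] at heq
        rw [heq.1, heq.2]
      · exact Or.inr (((hT j hj).bounds hqj).2.2.1.trans
          ((hulmono j i hij hi).trans ((hT i hi).bounds hpi).1))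
  · have hl0 : ∀ j ≤ m + 1, -((n + 1 : ℕ) : ℝ) ≤ l j := by
      intro j hj
      rcases Nat.eq_zero_or_pos j with rfl | hj0
      · simp [l]
      · have h1 := hulmono 0 j hj0 hj
        have h2 := hlu 0 (by omega)
        simp only [l, if_true] at h2 ⊢
        exact h2.le.trans h1
    have hum : ∀ j ≤ m + 1, u j ≤ ((n + 1 : ℕ) : ℝ) + 1 := by
      intro j hj
      rcases Nat.eq_or_lt_of_le hj with rfl | hj0
      · simp [u]
      · have h1 := hulmono j (m + 1) hj0 le_rfl
        have h2 := hlu (m + 1) le_rfl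
        have h3 : u (m + 1) = ((n + 1 : ℕ) : ℝ) + 1 := by simp [u]
        linarith
    intro p hp
    rcases hcases p hp with hp' | ⟨j, hj, hpj, -⟩
    · obtain ⟨i, hi, h1, h2⟩ := hold p hp'
      rw [h1, h2]
      exact ⟨(hl0 i (by omega)).trans (hlu i (by omega)).le,
        (hlu (i + 1) (by omega)).le.trans (hum (i + 1) (by omega))⟩
    · have hb := (hT j hj).bounds hpj
      exact ⟨(hl0 j hj).trans hb.1, hb.2.2.1.trans (hum j hj)⟩
  · intro z hz
    classical
    -- For the first such `j`, the height is in strip `j` or, if it is below that strip, in the old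
    -- piece `j - 1`.
    have hex : ∃ j, z ≤ u j := ⟨m + 1, by simpa [u] using hz.2⟩
    have hj := Nat.find_spec hex
    have hjm : Nat.find hex ≤ m + 1 := Nat.find_le (by simpa [u] using hz.2)
    have hmin : ∀ i, i < Nat.find hex → u i < z := fun i hi => not_le.1 (Nat.find_min hex hi)
    generalize Nat.find hex = j at hj hjm hmin
    have hstrip : l j ≤ z → ∃ p ∈ pieces R s (n + 1),
        z ∈ Icc (p.2.startHeight d s (n + 1)) (p.2.endHeight d s (n + 1)) := by
      intro hlz
      obtain ⟨q, hq, hzq⟩ := (hT j hjm).exists_mem (hlu j hjm) ⟨hlz, hj⟩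
      obtain ⟨p, hp, h1, h2⟩ := hnew j hjm q hq
      exact ⟨p, hp, by rwa [h1, h2]⟩
    rcases Nat.eq_zero_or_pos j with rfl | hj0
    · exact hstrip (by simpa [l] using hz.1)
    · obtain ⟨i, rfl⟩ : ∃ i, j = i + 1 := ⟨j - 1, by omega⟩
      rcases le_or_gt (l (i + 1)) z with hlz | hlz
      · exact hstrip hlz
      · have hi : i ≤ m := by omega
        have hui := hmin i (Nat.lt_succ_self i)
        refine ⟨φ i, hsub (hφ i hi).1, ?_, ?_⟩
        · rw [← (hφ i hi).2.1]; simpa [u, hi] using hui.le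
        · rw [← (hφ i hi).2.2]; simpa [l] using hlz.le
  · refine (h.finite.union (((finite_Iic (m + 1)).biUnion fun j hj =>
      ((hT j hj).finite)).image fun q => (⟨n + 1, initialWord s (n + 1), q.1, q.2⟩ :
        Σ k, Box k))).subset fun p hp => ?_
    rcases hcases p hp with hp' | ⟨j, hj, hpj, hpe, -⟩
    · exact Or.inl hp'
    · exact Or.inr ⟨_, mem_biUnion (mem_Iic.2 hj) hpj, hpe.symm⟩

end Stacked

/-! ### The invariant holds for every tiling sequence -/

section Tiling

variable {d : ℕ → ℝ} {R : ∀ n, Set (Box n)}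

theorem pieces_zero (h0 : R 0 = {⟨![], 0, 1⟩}) (s : ℕ → Bool) :
    pieces R s 0 = {⟨0, ⟨![], 0, 1⟩⟩} := by
  ext ⟨k, ρ⟩
  constructor
  · rintro ⟨hk, hρ, -⟩
    simp only at hk hρ
    obtain rfl : k = 0 := by omega
    rw [h0] at hρ
    rw [mem_singleton_iff.1 hρ]
    rfl
  · rintro h
    rw [mem_singleton_iff.1 h]
    exact ⟨le_rfl, by simp [h0], Subsingleton.elim _ _⟩

theorem isStacked_zero (hd : IsDebskiSequence d) (h0 : R 0 = {⟨![], 0, 1⟩}) (s : ℕ → Bool) :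
    IsStacked d R s 0 := by
  have h1 : (⟨![], 0, 1⟩ : Box 0).startHeight d s 0 = 0 :=
    Box.startHeight_self hd (Subsingleton.elim _ _)
  have h2 : (⟨![], 0, 1⟩ : Box 0).endHeight d s 0 = 1 :=
    Box.endHeight_self hd (Subsingleton.elim _ _)
  have hp := pieces_zero h0 s
  refine ⟨?_, ?_, ?_, ?_, ?_⟩ <;> rw [hp]
  · simp
  · simp
  · simp [h1, h2]
  · intro y hy
    exact ⟨_, rfl, by simpa [h1, h2] using hy⟩
  · exact finite_singleton _

/-- The explicit first stage is an instance of the general step with `m = 0`: the only earlier curve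
has heights 0 and f(1/3) at the ends of the left block, and f(2/3) and 1 at those of the right
block. The induction can thus start from stage 0. -/
theorem tilesStrips_one (hd : IsDebskiSequence d) (hR0 : R 0 = {⟨![], 0, 1⟩})
    (hR1 : R 1 = {⟨![false], (debski d (1 / 3) + 1) / 2, 1⟩,
     ⟨![false], debski d (1 / 3), (debski d (1 / 3) + 1) / 2⟩,
     ⟨![true], debski d (2 / 3) / 2, debski d (2 / 3)⟩,
     ⟨![true], 0, debski d (2 / 3) / 2⟩} ∪
    {ρ | ∃ a ∈ ({-1, -1 / 2, 1, 3 / 2} : Set ℝ), ρ.bot = a ∧ ρ.top = a + 1 / 2})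
    (σ : Fin 1 → Bool) :
    TilesStrips d R σ := by
  obtain ⟨s, rfl⟩ := exists_initialWord σ
  have h0 : ∀ k ≤ 0, ∀ ρ ∈ R k, ρ.bot < ρ.top := by
    intro k hk ρ hρ
    obtain rfl : k = 0 := by omega
    rw [hR0] at hρ
    rw [mem_singleton_iff.1 hρ]
    norm_num
  have hl := IsStacked.heightsAt_leftEnd (s := s) (n := 0) hd h0
  have hr := IsStacked.heightsAt_rightEnd (s := s) (n := 0) hd h0
  rw [pieces_zero hR0, image_singleton] at hl hr
  simp only [Box.startHeight, Box.endHeight, Box.lo, blockCoord] at hl hr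
  have hlw : leftEnd (![] : Fin 0 → Bool) = 0 := by simp [leftEnd]
  simp only [hlw, pow_zero, mul_one, sub_zero, zero_add] at hl hr
  have hLe : leftEnd (initialWord s 1) = if s 0 then 2 / 3 else 0 := by
    simp [leftEnd, initialWord]
    cases s 0 <;> simp
  have hRe : rightEnd (initialWord s 1) = if s 0 then 1 else 1 / 3 := by
    rw [rightEnd, hLe]
    cases s 0 <;> norm_num
  have hf : 0 < debski d (1 / 3) := debski_pos hd (by norm_num)
  have hf' : debski d (1 / 3) < 1 :=
    (debski_le_debskiUp _).trans_lt (debskiUp_lt_one hd (by norm_num))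
  have hg : 0 < debski d (2 / 3) := debski_pos hd (by norm_num)
  have hg' : debski d (2 / 3) < 1 :=
    (debski_le_debskiUp _).trans_lt (debskiUp_lt_one hd (by norm_num))
  have hword : ∀ w : Fin 1 → Bool, initialWord s 1 = w ↔ s 0 = w 0 := by
    intro w
    constructor
    · intro h; rw [← h]; rfl
    · intro h; funext i; fin_cases i; exact h
  refine ⟨0, fun _ => debski d (leftEnd (initialWord s 1)),
    fun _ => debski d (rightEnd (initialWord s 1)), ⟨?_, ?_, ?_, ?_⟩, ?_⟩
  · intro i hi j hj hij
    simp only [mem_Iic] at hi hj; omega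
  · intro i hi j hj hij
    simp only [mem_Iic] at hi hj; omega
  · rw [hl]; ext; simp
  · rw [hr]; ext; simp
  · simp only [not_lt_zero, iUnion_of_empty, iUnion_empty, union_empty, IsEmpty.forall_iff,
      implies_true, true_and]
    cases hs : s 0
    · rw [hLe, hRe]
      simp only [hs, if_false, Bool.false_eq_true, debski_zero hd]
      -- Above the curve the cuts are f(1/3), the midpoint up to 1, then 1, 3/2 and 2; below it they
      -- are -1, -1/2 and 0.
      let t : ℕ → ℝ := fun i => if i = 0 then debski d (1 / 3) else if i = 1 then
        (debski d (1 / 3) + 1) / 2 else (i : ℝ) / 2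
      let u : ℕ → ℝ := fun i => -1 + (i : ℝ) / 2
      refine ⟨{q | ∃ i < 2, q = (u i, u (i + 1))}, {q | ∃ i < 4, q = (t i, t (i + 1))},
        fun _ => ∅, ⟨2, u, by norm_num [u], by norm_num [u], ?_, rfl⟩,
        ⟨4, t, by norm_num [t], by norm_num [t], ?_, rfl⟩, ?_⟩
      · intro i hi
        simp only [u]
        push_cast
        constructor <;> linarith
      · intro i hi
        interval_cases i <;> norm_num [t] <;> constructor <;> linarith
      · ext ⟨a, b⟩
        simp only [hR1, mem_ofPred_eq, mem_union, mem_insert_iff, mem_singleton_iff,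
          Box.ext_iff, hword, hs]
        constructor
        · rintro ((⟨-, rfl, rfl⟩ | ⟨-, rfl, rfl⟩ | ⟨h, -, -⟩ | ⟨h, -, -⟩) |
            ⟨_, rfl | rfl | rfl | rfl, rfl, rfl⟩)
          · exact Or.inr ⟨1, by norm_num, by norm_num [t, u]⟩
          · exact Or.inr ⟨0, by norm_num, by norm_num [t, u]⟩
          · simp at h
          · simp at h
          · exact Or.inl ⟨0, by norm_num, by norm_num [t, u]⟩
          · exact Or.inl ⟨1, by norm_num, by norm_num [t, u]⟩
          · exact Or.inr ⟨2, by norm_num, by norm_num [t, u]⟩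
          · exact Or.inr ⟨3, by norm_num, by norm_num [t, u]⟩
        · rintro (⟨i, hi, h⟩ | ⟨i, hi, h⟩) <;> interval_cases i <;> norm_num [t, u] at h <;>
            obtain ⟨rfl, rfl⟩ := h
          · exact Or.inr ⟨_, Or.inl rfl, rfl, by norm_num⟩
          · exact Or.inr ⟨_, Or.inr (Or.inl rfl), by norm_num, by norm_num [t, u]⟩
          · exact Or.inl (Or.inr (Or.inl (by norm_num)))
          · exact Or.inl (Or.inl (by norm_num))
          · exact Or.inr ⟨_, Or.inr (Or.inr (Or.inl rfl)), rfl, by norm_num⟩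
          · exact Or.inr ⟨_, Or.inr (Or.inr (Or.inr rfl)), rfl, by norm_num⟩
    · rw [hLe, hRe]
      simp only [hs, if_true, debski_one hd]
      -- Below the curve the cuts are -1, -1/2, 0, then half of f(2/3) and f(2/3); above it they are
      -- 1, 3/2 and 2.
      let t : ℕ → ℝ := fun i => if i = 4 then debski d (2 / 3) else if i = 3 then
        debski d (2 / 3) / 2 else -1 + (i : ℝ) / 2
      let u : ℕ → ℝ := fun i => 1 + (i : ℝ) / 2
      refine ⟨{q | ∃ i < 4, q = (t i, t (i + 1))}, {q | ∃ i < 2, q = (u i, u (i + 1))},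
        fun _ => ∅, ⟨4, t, by norm_num [t], by norm_num [t], ?_, rfl⟩,
        ⟨2, u, by norm_num [u], by norm_num [u], ?_, rfl⟩, ?_⟩
      · intro i hi
        interval_cases i <;> norm_num [t] <;> constructor <;> linarith
      · intro i hi
        simp only [u]
        push_cast
        constructor <;> linarith
      · ext ⟨a, b⟩
        simp only [hR1, mem_ofPred_eq, mem_union, mem_insert_iff, mem_singleton_iff,
          Box.ext_iff, hword, hs]
        constructor
        · rintro ((⟨h, -, -⟩ | ⟨h, -, -⟩ | ⟨-, rfl, rfl⟩ | ⟨-, rfl, rfl⟩) |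
            ⟨_, rfl | rfl | rfl | rfl, rfl, rfl⟩)
          · simp at h
          · simp at h
          · exact Or.inl ⟨3, by norm_num, by norm_num [t, u]⟩
          · exact Or.inl ⟨2, by norm_num, by norm_num [t, u]⟩
          · exact Or.inl ⟨0, by norm_num, by norm_num [t, u]⟩
          · exact Or.inl ⟨1, by norm_num, by norm_num [t, u]⟩
          · exact Or.inr ⟨0, by norm_num, by norm_num [t, u]⟩
          · exact Or.inr ⟨1, by norm_num, by norm_num [t, u]⟩
        · rintro (⟨i, hi, h⟩ | ⟨i, hi, h⟩) <;> interval_cases i <;> norm_num [t, u] at h <;>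
            obtain ⟨rfl, rfl⟩ := h
          · exact Or.inr ⟨_, Or.inl rfl, rfl, by norm_num⟩
          · exact Or.inr ⟨_, Or.inr (Or.inl rfl), by norm_num, by norm_num [t, u]⟩
          · exact Or.inl (Or.inr (Or.inr (Or.inr (by norm_num))))
          · exact Or.inl (Or.inr (Or.inr (Or.inl (by norm_num))))
          · exact Or.inr ⟨_, Or.inr (Or.inr (Or.inl rfl)), rfl, by norm_num⟩
          · exact Or.inr ⟨_, Or.inr (Or.inr (Or.inr rfl)), by norm_num, by norm_num [t, u]⟩

theorem IsTilingSequence.tilesStrips (hd : IsDebskiSequence d) (hR : IsTilingSequence d R) {n : ℕ}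
    (hn : 1 ≤ n) (σ : Fin n → Bool) : TilesStrips d R σ := by
  rcases Nat.eq_or_lt_of_le hn with rfl | hn
  · exact tilesStrips_one hd hR.zero hR.one σ
  · exact hR.step n hn σ

theorem bot_lt_top_of_isStacked {n : ℕ} (h : ∀ s, IsStacked d R s n) :
    ∀ k ≤ n, ∀ ρ ∈ R k, ρ.bot < ρ.top := by
  intro k hk ρ hρ
  obtain ⟨s, hs⟩ := exists_initialWord ρ.word
  exact (h s).pos ⟨k, ρ⟩ ⟨hk, hρ, hs.symm⟩

theorem IsTilingSequence.isStacked (hd : IsDebskiSequence d) (hR : IsTilingSequence d R) (n : ℕ) :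
    ∀ s, IsStacked d R s n := by
  induction n with
  | zero => exact fun s => isStacked_zero hd hR.zero s
  | succ n ih =>
    exact fun s => isStacked_succ hd (ih s) (bot_lt_top_of_isStacked ih)
      (hR.tilesStrips hd (Nat.succ_pos n) _)

/-! ### Existence of the tilings -/

/-- `T` is a set of heights of rectangles over the block of `σ` that are allowed at stage `n`. -/
def IsStripTiling (d : ℕ → ℝ) (R : ∀ n, Set (Box n)) {n : ℕ} (σ : Fin n → Bool)
    (T : Set (ℝ × ℝ)) : Prop :=
  ∃ (m : ℕ) (x y : ℕ → ℝ), EnumeratesHeights d R σ m x y ∧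
    ∃ (S₀ S₁ : Set (ℝ × ℝ)) (S : ℕ → Set (ℝ × ℝ)),
      IsSubdivision (1 / (n + 1)) (-n) (x 0) S₀ ∧
      IsSubdivision (1 / (n + 1)) (y m) (n + 1) S₁ ∧
      (∀ j < m, IsSubdivision (1 / (n + 1)) (y j) (x (j + 1)) (S j)) ∧
      T = S₀ ∪ S₁ ∪ ⋃ j < m, S j

/-- Distinct pieces have distinct heights at either end of the subblock, so both lists of heights
have as many members as there are pieces, and the strict interlacing makes every strip
nondegenerate. -/
theorem IsStacked.exists_isStripTiling (hd : IsDebskiSequence d) {s : ℕ → Bool} {n : ℕ}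
    (h : IsStacked d R s n) (hpos : ∀ k ≤ n, ∀ ρ ∈ R k, ρ.bot < ρ.top) :
    ∃ T, IsStripTiling d R (initialWord s (n + 1)) T := by
  have hne : (pieces R s n).Nonempty := by
    obtain ⟨p, hp, -⟩ := h.cover (-n) ⟨le_rfl, by
      have : (0 : ℝ) ≤ n := Nat.cast_nonneg n
      linarith⟩
    exact ⟨p, hp⟩
  obtain ⟨m, hm⟩ : ∃ m, (pieces R s n).ncard = m + 1 :=
    Nat.exists_eq_succ_of_ne_zero ((Set.ncard_pos h.finite).2 hne).ne'
  have hinj : ∀ p ∈ pieces R s n, ∀ q ∈ pieces R s n,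
      (p.2.startHeight d s (n + 1) = q.2.startHeight d s (n + 1) ∨
      p.2.endHeight d s (n + 1) = q.2.endHeight d s (n + 1)) → p = q := by
    intro p hp q hq heq
    by_contra hpq
    have h1 := h.start_lt_end hd hp (Nat.le_succ n)
    have h2 := h.start_lt_end hd hq (Nat.le_succ n)
    rcases h.ordered_succ hd hp hq hpq with h' | h' <;> rcases heq with heq | heq <;> linarith
  obtain ⟨x, hx, hx'⟩ := exists_strictMonoOn_image_eq (m := m)
    (h.finite.image fun p => p.2.startHeight d s (n + 1))
    (by rw [InjOn.ncard_image fun p hp q hq h => hinj p hp q hq (Or.inl h), hm])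
  obtain ⟨y, hy, hy'⟩ := exists_strictMonoOn_image_eq (m := m)
    (h.finite.image fun p => p.2.endHeight d s (n + 1))
    (by rw [InjOn.ncard_image fun p hp q hq h => hinj p hp q hq (Or.inr h), hm])
  have he : EnumeratesHeights d R (initialWord s (n + 1)) m x y := by
    refine ⟨hx, hy, ?_, ?_⟩
    · rw [hx', IsStacked.heightsAt_leftEnd hd hpos]
    · rw [hy', IsStacked.heightsAt_rightEnd hd hpos]
  obtain ⟨h0, -, h2, h3, -⟩ := h.interlaced hd hpos he
  have hε : (0 : ℝ) < 1 / ((n + 1 : ℕ) + 1) := by positivity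
  obtain ⟨S₀, hS₀⟩ := exists_isSubdivision hε
    (show -((n + 1 : ℕ) : ℝ) < x 0 by push_cast; linarith)
  obtain ⟨S₁, hS₁⟩ := exists_isSubdivision hε
    (show y m < ((n + 1 : ℕ) : ℝ) + 1 by push_cast; linarith)
  have hS : ∀ j, ∃ S, j < m → IsSubdivision (1 / ((n + 1 : ℕ) + 1)) (y j) (x (j + 1)) S := by
    intro j
    by_cases hj : j < m
    · obtain ⟨S, hS⟩ := exists_isSubdivision hε (h2 j hj)
      exact ⟨S, fun _ => hS⟩
    · exact ⟨∅, fun h => absurd h hj⟩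
  choose S hS using hS
  exact ⟨_, m, x, y, he, S₀, S₁, S, hS₀, hS₁, hS, rfl⟩

theorem heightsAt_congr {R' : ∀ n, Set (Box n)} {n : ℕ} (h : ∀ k < n, R k = R' k) (c : ℝ) :
    heightsAt d R n c = heightsAt d R' n c := by
  ext y
  constructor
  · rintro ⟨k, hk, ρ, hρ, hy⟩; exact ⟨k, hk, ρ, h k hk ▸ hρ, hy⟩
  · rintro ⟨k, hk, ρ, hρ, hy⟩; exact ⟨k, hk, ρ, (h k hk).symm ▸ hρ, hy⟩

theorem IsStripTiling.congr {R' : ∀ n, Set (Box n)} {n : ℕ} (h : ∀ k < n, R k = R' k)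
    {σ : Fin n → Bool} {T : Set (ℝ × ℝ)} (hT : IsStripTiling d R σ T) :
    IsStripTiling d R' σ T := by
  obtain ⟨m, x, y, ⟨h1, h2, h3, h4⟩, h5⟩ := hT
  exact ⟨m, x, y, ⟨h1, h2, heightsAt_congr h _ ▸ h3, heightsAt_congr h _ ▸ h4⟩, h5⟩

open Classical in
/-- A choice of the next stage of the tilings. -/
noncomputable def nextStage (d : ℕ → ℝ) (R : ∀ n, Set (Box n)) (n : ℕ) : Set (Box n) :=
  {ρ | ∃ h : ∃ T, IsStripTiling d R ρ.word T, (ρ.bot, ρ.top) ∈ h.choose}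

/-- A sequence of tilings. -/
noncomputable def chosenTiling (d : ℕ → ℝ) : ∀ n, Set (Box n)
  | 0 => {⟨![], 0, 1⟩}
  | 1 => {⟨![false], (debski d (1 / 3) + 1) / 2, 1⟩,
     ⟨![false], debski d (1 / 3), (debski d (1 / 3) + 1) / 2⟩,
     ⟨![true], debski d (2 / 3) / 2, debski d (2 / 3)⟩,
     ⟨![true], 0, debski d (2 / 3) / 2⟩} ∪
    {ρ | ∃ a ∈ ({-1, -1 / 2, 1, 3 / 2} : Set ℝ), ρ.bot = a ∧ ρ.top = a + 1 / 2}
  | n + 2 => nextStage d (fun k => {ρ | ∃ _ : k < n + 2, ρ ∈ chosenTiling d k}) (n + 2)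
termination_by n => n

/-- The recursion feeds `nextStage` with the family truncated below the current stage, which is
harmless because the heights involve earlier stages only. Stackedness is proved along the way, since
it is what guarantees that a next stage exists. -/
theorem exists_isTilingSequence (hd : IsDebskiSequence d) : ∃ R, IsTilingSequence d R := by
  let R := chosenTiling d
  have hR0 : R 0 = {⟨![], 0, 1⟩} := by
    simp only [R]
    rw [chosenTiling]
  have hR1 : R 1 = {⟨![false], (debski d (1 / 3) + 1) / 2, 1⟩,
     ⟨![false], debski d (1 / 3), (debski d (1 / 3) + 1) / 2⟩,
     ⟨![true], debski d (2 / 3) / 2, debski d (2 / 3)⟩,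
     ⟨![true], 0, debski d (2 / 3) / 2⟩} ∪
    {ρ | ∃ a ∈ ({-1, -1 / 2, 1, 3 / 2} : Set ℝ), ρ.bot = a ∧ ρ.top = a + 1 / 2} := by
    simp only [R]
    rw [chosenTiling]
  have hprev : ∀ n, ∀ k < n + 2,
      ({ρ | ∃ _ : k < n + 2, ρ ∈ chosenTiling d k} : Set (Box k)) = R k := by
    intro n k hk
    ext ρ
    simp [R, hk]
  have key : ∀ n (σ : Fin (n + 2) → Bool), (∃ T, IsStripTiling d R σ T) → TilesStrips d R σ := by
    rintro n σ ⟨T, hT⟩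
    have hex : ∃ T, IsStripTiling d (fun k => {ρ | ∃ _ : k < n + 2, ρ ∈ chosenTiling d k}) σ T :=
      ⟨T, hT.congr fun k hk => (hprev n k hk).symm⟩
    have h1 := (hex.choose_spec).congr (hprev n)
    have h2 : {q : ℝ × ℝ | (⟨σ, q.1, q.2⟩ : Box (n + 2)) ∈ R (n + 2)} = hex.choose := by
      ext q
      simp only [R]
      rw [chosenTiling]
      simp only [nextStage, mem_ofPred_eq]
      exact ⟨fun ⟨_, h⟩ => h, fun h => ⟨hex, h⟩⟩
    rw [← h2] at h1
    exact h1
  have hst : ∀ n s, IsStacked d R s n := by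
    intro n
    induction n with
    | zero => exact isStacked_zero hd hR0
    | succ n ih =>
      intro s
      have hpos := bot_lt_top_of_isStacked ih
      refine isStacked_succ hd (ih s) hpos ?_
      rcases n with _ | n
      · exact tilesStrips_one hd hR0 hR1 _
      · exact key n _ ((ih s).exists_isStripTiling hd hpos)
  refine ⟨R, hR0, hR1, fun n hn σ => ?_⟩
  obtain ⟨n, rfl⟩ : ∃ m, n = m + 2 := ⟨n - 2, by omega⟩
  obtain ⟨s, rfl⟩ := exists_initialWord σ
  exact key n _ ((hst (n + 1) s).exists_isStripTiling hd (bot_lt_top_of_isStacked (hst (n + 1))))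

end Tiling

/-! ### The required properties of the tilings -/

section Conditions

variable {d : ℕ → ℝ} {R : ∀ n, Set (Box n)} {s : ℕ → Bool} {n : ℕ}

/-- If two height intervals touch, the lower curve reaches the common height only at the right end
of the block and the upper one only at the left end. No point is both. -/
theorem IsStacked.hi_lt_lo_or (hd : IsDebskiSequence d) (h : IsStacked d R s n)
    {p q : Σ k, Box k} (hp : p ∈ pieces R s n) (hq : q ∈ pieces R s n) (hpq : p ≠ q) :
    (∀ c ∈ cantorBlock (initialWord s n), p.2.hi d c < q.2.lo d c) ∨
      ∀ c ∈ cantorBlock (initialWord s n), q.2.hi d c < p.2.lo d c := by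
  have key : ∀ {p q : Σ k, Box k}, p ∈ pieces R s n → q ∈ pieces R s n →
      p.2.endHeight d s n ≤ q.2.startHeight d s n →
      ∀ c ∈ cantorBlock (initialWord s n), p.2.hi d c < q.2.lo d c := by
    intro p q hp hq hle c hc
    rcases eq_or_lt_of_le hc.1.1 with h1 | h1
    · have h2 : c < rightEnd (initialWord s n) := h1 ▸ leftEnd_lt_rightEnd _
      exact (Box.hi_lt_endHeight hd (h.pos p hp) hp.2.2 hp.1 h2).trans_le
        (hle.trans (Box.startHeight_le_lo hd (h.pos q hq) hq.2.2 hq.1 hc))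
    · exact (Box.hi_le_endHeight hd (h.pos p hp) hp.2.2 hp.1 hc).trans_lt
        (hle.trans_lt (Box.startHeight_lt_lo hd (h.pos q hq) hq.2.2 hq.1 h1))
  exact (h.ordered p hp q hq hpq).imp (key hp hq) (key hq hp)

/-- Two pieces of earlier stages were already stacked over the previous block, so a gap has opened
between them. -/
theorem IsStacked.stage_eq_of_touch (hd : IsDebskiSequence d) (hst : ∀ n s, IsStacked d R s n)
    {p q : Σ k, Box k} (hp : p ∈ pieces R s n) (hq : q ∈ pieces R s n) (hpq : p ≠ q)
    (h : p.2.endHeight d s n = q.2.startHeight d s n) : p.1 = n ∨ q.1 = n := by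
  by_contra! hcon
  have hp1 := hp.1
  have hq1 := hq.1
  obtain ⟨m, rfl⟩ : ∃ m, n = m + 1 := ⟨n - 1, by omega⟩
  have hp' : p ∈ pieces R s m := ⟨by omega, hp.2⟩
  have hq' : q ∈ pieces R s m := ⟨by omega, hq.2⟩
  have h1 := (hst m s).start_lt_end hd hp' (Nat.le_succ m)
  have h2 := (hst m s).start_lt_end hd hq' (Nat.le_succ m)
  rcases (hst m s).ordered_succ hd hp' hq' hpq with h' | h' <;> linarith

/-- The height -n lies below the range of all earlier stages, so a piece that covers it belongs to
stage n. -/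
theorem IsStacked.exists_stage_eq (hd : IsDebskiSequence d) (hst : ∀ n s, IsStacked d R s n)
    (s : ℕ → Bool) (n : ℕ) : ∃ p ∈ pieces R s n, p.1 = n := by
  have h0 : (0 : ℝ) ≤ n := Nat.cast_nonneg n
  obtain ⟨p, hp, hp'⟩ := (hst n s).cover (-n) ⟨le_rfl, by linarith⟩
  refine ⟨p, hp, ?_⟩
  by_contra hne
  have hp1 := hp.1
  obtain ⟨m, rfl⟩ : ∃ m, n = m + 1 := ⟨n - 1, by omega⟩
  have hq : p ∈ pieces R s m := ⟨by omega, hp.2⟩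
  have h1 := ((hst m s).bounds p hq).1
  have h2 := Box.startHeight_mono hd ((hst m s).pos p hq) hq.2.2 hq.1 (Nat.le_succ m)
  have h3 := hp'.1
  push_cast at h3
  linarith

/-- There are finitely many pieces. If none began where `p` ends, all pieces that reach higher would
begin above some height `z` just over that end, and nothing would cover `z`. -/
theorem IsStacked.exists_next (h : IsStacked d R s n) {p : Σ k, Box k} (hp : p ∈ pieces R s n)
    (hlt : p.2.startHeight d s n < p.2.endHeight d s n) (htop : p.2.endHeight d s n < n + 1) :
    ∃ q ∈ pieces R s n, p ≠ q ∧ p.2.endHeight d s n = q.2.startHeight d s n := by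
  by_contra! hcon
  set e := p.2.endHeight d s n with he
  have hgt : ∀ q ∈ pieces R s n, e < q.2.endHeight d s n → e < q.2.startHeight d s n := by
    intro q hq hq'
    have hpq : p ≠ q := by rintro rfl; exact lt_irrefl _ hq'
    rcases h.ordered p hp q hq hpq with h' | h'
    · exact lt_of_le_of_ne h' (hcon q hq hpq)
    · linarith
  have hfin := h.finite
  obtain ⟨z, hz1, hz2⟩ : ∃ z, e < z ∧ z < n + 1 ∧ ∀ q ∈ pieces R s n,
      e < q.2.endHeight d s n → z < q.2.startHeight d s n := by
    have hev : ∀ᶠ z in 𝓝[>] e, ∀ q ∈ pieces R s n,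
        e < q.2.endHeight d s n → z < q.2.startHeight d s n := by
      rw [Filter.eventually_all_finite hfin]
      intro q hq
      by_cases hq' : e < q.2.endHeight d s n
      · filter_upwards [nhdsWithin_le_nhds (Iio_mem_nhds (hgt q hq hq'))] with z hz _ using hz
      · exact Filter.Eventually.of_forall fun _ h => absurd h hq'
    obtain ⟨z, ⟨h1, h2⟩, h3⟩ := ((hev.and (nhdsWithin_le_nhds (Iio_mem_nhds htop))).and
      self_mem_nhdsWithin).exists
    exact ⟨z, h3, h2, h1⟩
  have hb := (h.bounds p hp).1
  obtain ⟨q, hq, hzq⟩ := h.cover z ⟨by linarith, hz2.1.le⟩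
  have := hz2.2 q hq (hz1.trans_le hzq.2)
  linarith [hzq.1]

theorem sameWord_of_mem {k : ℕ} (hk : k ≤ n) {ρ : Box n} {τ : Box k} {c : ℝ}
    (h1 : c ∈ cantorBlock ρ.word) (h2 : c ∈ cantorBlock τ.word) :
    ∃ s, ρ.word = initialWord s n ∧ τ.word = initialWord s k := by
  obtain ⟨s, hs⟩ := exists_initialWord ρ.word
  exact ⟨s, hs.symm, eq_initialWord hk (hs ▸ h1) h2⟩

theorem disjoint_curves (hd : IsDebskiSequence d) (hst : ∀ n s, IsStacked d R s n) {k : ℕ}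
    (hk : k ≤ n) {ρ : Box n} {τ : Box k} (hρ : ρ ∈ R n) (hτ : τ ∈ R k)
    (hne : (⟨n, ρ⟩ : Σ k, Box k) ≠ ⟨k, τ⟩) : Disjoint (ρ.curve d) (τ.curve d) := by
  rw [Set.disjoint_left]
  rintro p hp1 hp2
  rw [Box.mem_curve hd (bot_lt_top_of_isStacked (hst n) n le_rfl ρ hρ)] at hp1
  rw [Box.mem_curve hd (bot_lt_top_of_isStacked (hst k) k le_rfl τ hτ)] at hp2
  obtain ⟨s, h1, h2⟩ := sameWord_of_mem hk hp1.1 hp2.1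
  rcases (hst n s).hi_lt_lo_or hd (p := ⟨n, ρ⟩) (q := ⟨k, τ⟩) ⟨le_rfl, hρ, h1⟩ ⟨hk, hτ, h2⟩ hne with
    h | h
  · have := h p.1 (h1 ▸ hp1.1)
    simp only at this
    linarith [hp1.2.2, hp2.2.1]
  · have := h p.1 (h1 ▸ hp1.1)
    simp only at this
    linarith [hp2.2.2, hp1.2.1]

theorem tiling_finite (hst : ∀ n s, IsStacked d R s n) (n : ℕ) : (R n).Finite := by
  have : R n = ⋃ σ : Fin n → Bool, (Sigma.mk n) ⁻¹' (pieces R (exists_initialWord σ).choose n) ∩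
      {ρ | ρ.word = σ} := by
    ext ρ
    simp only [mem_iUnion, mem_inter_iff, mem_preimage, mem_ofPred_eq]
    constructor
    · intro hρ
      exact ⟨ρ.word, ⟨le_rfl, hρ, (exists_initialWord ρ.word).choose_spec.symm⟩, rfl⟩
    · rintro ⟨σ, ⟨-, hρ, -⟩, -⟩
      exact hρ
  rw [this]
  refine finite_iUnion fun σ => Finite.inter_of_left ?_ _
  exact (hst n _).finite.preimage sigma_mk_injective.injOn

theorem planeDist_lt {x y : ℝ} {p q : ℝ × ℝ} (ha : |p.1 - q.1| ≤ x) (hb : |p.2 - q.2| ≤ y)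
    (hx : 0 < x) (hy : 0 < y) : planeDist p q < y + x := by
  unfold planeDist
  rw [Real.sqrt_lt' (by positivity)]
  have h1 : (p.1 - q.1) ^ 2 ≤ x ^ 2 := sq_le_sq' (by linarith [(abs_le.1 ha).1]) (abs_le.1 ha).2
  have h2 : (p.2 - q.2) ^ 2 ≤ y ^ 2 := sq_le_sq' (by linarith [(abs_le.1 hb).1]) (abs_le.1 hb).2
  nlinarith [mul_pos hx hy]

/-- The first projection is constant by total disconnectedness; the second image is compact and
connected. -/
theorem IsArc.eq_prod {I : Set (ℝ × ℝ)} (hI : IsArc I) (hC : ∀ p ∈ I, p.1 ∈ cantorSet) :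
    ∃ c ∈ cantorSet, ∃ u v : ℝ, u ≤ v ∧ I = {c} ×ˢ Icc u v := by
  obtain ⟨γ, hγ, rfl⟩ := hI
  have hconn : IsConnected (range γ) := isConnected_range hγ.continuous
  have hcomp : IsCompact (range γ) := isCompact_range hγ.continuous
  have h1 : (Prod.fst '' range γ).Subsingleton :=
    isTotallyDisconnected_cantorSet _ (by rintro _ ⟨p, hp, rfl⟩; exact hC p hp)
      (hconn.isPreconnected.image _ continuous_fst.continuousOn)
  have h2 := eq_Icc_of_connected_compact (hconn.image _ continuous_snd.continuousOn)
    (hcomp.image continuous_snd)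
  obtain ⟨p, hp⟩ := hconn.nonempty
  have h3 : p.2 ∈ Prod.snd '' range γ := mem_image_of_mem _ hp
  refine ⟨p.1, hC p hp, sInf (Prod.snd '' range γ), sSup (Prod.snd '' range γ), ?_, ?_⟩
  rotate_left 1
  · ext q
    rw [mem_prod, ← h2, mem_singleton_iff]
    constructor
    · intro hq
      exact ⟨h1 (mem_image_of_mem _ hq) (mem_image_of_mem _ hp), mem_image_of_mem _ hq⟩
    · rintro ⟨hq1, r, hr, hr2⟩
      have : r.1 = p.1 := h1 (mem_image_of_mem _ hr) (mem_image_of_mem _ hp)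
      have : q = r := Prod.ext (hq1.trans this.symm) hr2.symm
      rwa [this]
  · have h4 : p.2 ∈ Icc _ _ := h2.subset h3
    exact h4.1.trans h4.2

theorem heights_eq_Icc (hd : IsDebskiSequence d) (hst : ∀ n s, IsStacked d R s n) (n : ℕ)
    (σ : Fin n → Bool) :
    Prod.snd '' ((cantorBlock σ ×ˢ univ) ∩ ⋃ k ≤ n, ⋃ ρ ∈ R k, ρ.curve d) =
      Icc (-(n : ℝ)) (n + 1) := by
  obtain ⟨s, rfl⟩ := exists_initialWord σ
  have hpos := bot_lt_top_of_isStacked (hst n)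
  ext y
  constructor
  · rintro ⟨p, ⟨hp1, hp2⟩, rfl⟩
    simp only [mem_iUnion] at hp2
    obtain ⟨k, hk, ρ, hρ, hp2⟩ := hp2
    rw [Box.mem_curve hd (hpos k hk ρ hρ)] at hp2
    have hw := eq_initialWord hk hp1.1 hp2.1
    have hb := (hst n s).bounds ⟨k, ρ⟩ ⟨hk, hρ, hw⟩
    exact ⟨hb.1.trans ((Box.startHeight_le_lo hd (hpos k hk ρ hρ) hw hk hp1.1).trans hp2.2.1),
      (hp2.2.2.trans (Box.hi_le_endHeight hd (hpos k hk ρ hρ) hw hk hp1.1)).trans hb.2⟩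
  · intro hy
    obtain ⟨⟨k, ρ⟩, ⟨hk, hρ, hw⟩, hy'⟩ := (hst n s).cover y hy
    obtain ⟨x, hx, hx'⟩ := Box.exists_mem_curve hd (hpos k hk ρ hρ) hw hk hy'
    refine ⟨(x, y), ⟨⟨hx, trivial⟩, ?_⟩, rfl⟩
    simp only [mem_iUnion]
    exact ⟨k, hk, ρ, hρ, hx'⟩

/-- Every curve over `c` passes entirely above or below the segment. Starting in the interval of a
piece, the segment can leave it only upwards, beyond its curve; in the next piece it must then stay
below that piece's curve. So at most two touching pieces are involved, one of them of stage `n`. A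
curve attains each height of its interval somewhere over the block, which bounds the distance. -/
theorem exists_boxes_of_arc (hd : IsDebskiSequence d) (hst : ∀ n s, IsStacked d R s n) (n : ℕ)
    {c u v : ℝ} (hc : c ∈ cantorSet) (huv : u ≤ v)
    (hI : {c} ×ˢ Icc u v ⊆
      (cantorSet ×ˢ Icc (-(n : ℝ)) (n + 1)) \ ⋃ k ≤ n, ⋃ ρ ∈ R k, ρ.curve d) :
    ∃ ρ ∈ R n, ∃ k ≤ n, ∃ τ ∈ R k, {c} ×ˢ Icc u v ⊆ ρ.region ∪ τ.region ∧
      ∃ p ∈ ({c} ×ˢ Icc u v : Set (ℝ × ℝ)), ∃ q ∈ τ.curve d,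
        planeDist p q < 1 / (n + 1) + 1 / 3 ^ n := by
  have hpos := bot_lt_top_of_isStacked (hst n)
  have hcb := mem_cantorBlock_address hc n
  set s := address c
  have hn1 : (0 : ℝ) < 1 / (n + 1) := by positivity
  have hn3 : (0 : ℝ) < 1 / 3 ^ n := by positivity
  have hu : u ∈ Icc (-(n : ℝ)) (n + 1) := (hI (show ((c, u) : ℝ × ℝ) ∈ ({c} : Set ℝ) ×ˢ Icc u v from
    ⟨rfl, le_rfl, huv⟩)).1.2
  have hv : v ∈ Icc (-(n : ℝ)) (n + 1) := (hI (show ((c, v) : ℝ × ℝ) ∈ ({c} : Set ℝ) ×ˢ Icc u v from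
    ⟨rfl, huv, le_rfl⟩)).1.2
  have hside : ∀ p ∈ pieces R s n, p.2.hi d c < u ∨ v < p.2.lo d c := by
    rintro ⟨k, ρ⟩ ⟨hk, hρ, hw⟩
    simp only at hk hρ hw ⊢
    by_contra! hcon
    have hm : max u (ρ.lo d c) ∈ Icc u v := ⟨le_max_left _ _, max_le huv hcon.2⟩
    refine (hI (show ((c, max u (ρ.lo d c)) : ℝ × ℝ) ∈ ({c} : Set ℝ) ×ˢ Icc u v from ⟨rfl, hm⟩)).2 ?_
    simp only [mem_iUnion]
    refine ⟨k, hk, ρ, hρ, (Box.mem_curve hd (hpos k hk ρ hρ) _).2 ⟨?_, le_max_right _ _,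
      max_le hcon.1 (Box.lo_le_hi (hpos k hk ρ hρ) c)⟩⟩
    rw [hw]
    exact cantorBlock_antitone s hk hcb
  have hin : ∀ p ∈ pieces R s n, ∀ y ∈ Icc (p.2.startHeight d s n) (p.2.endHeight d s n),
      (c, y) ∈ p.2.region := by
    rintro ⟨k, ρ⟩ ⟨hk, hρ, hw⟩ y hy
    refine ⟨hw ▸ cantorBlock_antitone s hk hcb, ?_, ?_⟩
    · exact (Box.bot_le_lo (hpos k hk ρ hρ) _).trans hy.1
    · exact hy.2.trans ((Box.lo_le_hi (hpos k hk ρ hρ) _).trans (Box.hi_le_top (hpos k hk ρ hρ) _))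
  have hclose : ∀ p ∈ pieces R s n, ∀ y ∈ Icc (p.2.startHeight d s n) (p.2.endHeight d s n),
      ∃ q ∈ p.2.curve d, planeDist (c, y) q < 1 / (n + 1) + 1 / 3 ^ n := by
    rintro ⟨k, ρ⟩ ⟨hk, hρ, hw⟩ y hy
    obtain ⟨x, hx, hx'⟩ := Box.exists_mem_curve hd (hpos k hk ρ hρ) hw hk hy
    exact ⟨_, hx', planeDist_lt (dist_le_of_mem_cantorBlock hcb hx)
      (by simpa using hn1.le) hn3 hn1⟩
  -- If one piece contains the whole segment, any rectangle of stage `n` can serve as the other.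
  have hsingle : ∀ p ∈ pieces R s n, p.2.startHeight d s n ≤ u → v ≤ p.2.endHeight d s n →
      ∃ ρ ∈ R n, ∃ k ≤ n, ∃ τ ∈ R k, {c} ×ˢ Icc u v ⊆ ρ.region ∪ τ.region ∧
      ∃ p ∈ ({c} ×ˢ Icc u v : Set (ℝ × ℝ)), ∃ q ∈ τ.curve d,
        planeDist p q < 1 / (n + 1) + 1 / 3 ^ n := by
    rintro ⟨k, τ⟩ hp h1 h2
    obtain ⟨⟨n', ρ⟩, hρ, rfl⟩ := IsStacked.exists_stage_eq hd hst s n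
    obtain ⟨q, hq, hq'⟩ := hclose _ hp u ⟨h1, huv.trans h2⟩
    refine ⟨ρ, hρ.2.1, k, hp.1, τ, hp.2.1, ?_, (c, u), ⟨rfl, le_rfl, huv⟩, q, hq, hq'⟩
    rintro ⟨c', y⟩ ⟨hc', hy⟩
    obtain rfl : c' = c := hc'
    exact Or.inr (hin _ hp y ⟨h1.trans hy.1, hy.2.trans h2⟩)
  obtain ⟨p, hp, hup⟩ := (hst n s).cover u hu
  rcases hside p hp with hlt | hlt
  · rcases le_or_gt v (p.2.endHeight d s n) with hve | hve
    · exact hsingle p hp hup.1 hve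
    · have hlt := (hst n s).start_lt_end hd hp le_rfl
      obtain ⟨q, hq, hpq, heq⟩ := (hst n s).exists_next hp hlt (hve.trans_le hv.2)
      -- The curve of `q` cannot be below the segment: it starts where `p` ends, which is at or
      -- above `u`.
      have hvq : v ≤ q.2.endHeight d s n := by
        have h1 := Box.startHeight_le_lo hd ((hst n s).pos q hq) hq.2.2 hq.1 hcb
        have h2 := Box.hi_le_endHeight hd ((hst n s).pos q hq) hq.2.2 hq.1 hcb
        have h3 := Box.lo_le_hi (d := d) ((hst n s).pos q hq) c
        rcases hside q hq with h' | h'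
        · linarith [hup.2]
        · linarith
      have hmem : ((c, p.2.endHeight d s n) : ℝ × ℝ) ∈ ({c} ×ˢ Icc u v : Set (ℝ × ℝ)) :=
        ⟨rfl, hup.2, hve.le⟩
      have hcov : {c} ×ˢ Icc u v ⊆ p.2.region ∪ q.2.region := by
        rintro ⟨c', y⟩ ⟨hc', hy⟩
        obtain rfl : c' = c := hc'
        rcases le_total y (p.2.endHeight d s n) with hy' | hy'
        · exact Or.inl (hin p hp y ⟨hup.1.trans hy.1, hy'⟩)
        · exact Or.inr (hin q hq y ⟨heq ▸ hy', hy.2.trans hvq⟩)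
      have hp1 := hclose p hp _ ⟨hlt.le, le_rfl⟩
      have hq1 := hclose q hq (p.2.endHeight d s n) ⟨heq.ge, hve.le.trans hvq⟩
      obtain ⟨k, ρ⟩ := p
      obtain ⟨k', τ⟩ := q
      rcases IsStacked.stage_eq_of_touch hd hst hp hq hpq heq with h | h
      · simp only at h
        subst h
        obtain ⟨z, hz, hz'⟩ := hq1
        exact ⟨ρ, hp.2.1, k', hq.1, τ, hq.2.1, hcov, _, hmem, z, hz, hz'⟩
      · simp only at h
        subst h
        obtain ⟨z, hz, hz'⟩ := hp1
        exact ⟨τ, hq.2.1, k, hp.1, ρ, hp.2.1, by rwa [union_comm], _, hmem, z, hz, hz'⟩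
  · have h2 := Box.hi_le_endHeight hd ((hst n s).pos p hp) hp.2.2 hp.1 hcb
    have h3 := Box.lo_le_hi (d := d) ((hst n s).pos p hp) c
    exact hsingle p hp hup.1 (by linarith)

theorem IsTilingSequence.height_le (hd : IsDebskiSequence d) (hR : IsTilingSequence d R) (n : ℕ)
    {ρ : Box n} (hρ : ρ ∈ R n) : ρ.top - ρ.bot ≤ 1 / (n + 1) := by
  rcases Nat.eq_zero_or_pos n with rfl | hn
  · rw [hR.zero] at hρ
    rw [mem_singleton_iff.1 hρ]
    norm_num
  · obtain ⟨m, x, y, -, S₀, S₁, S, h0, h1, h2, h3⟩ := hR.tilesStrips hd hn ρ.word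
    have hm : (ρ.bot, ρ.top) ∈ S₀ ∪ S₁ ∪ ⋃ j < m, S j := h3 ▸ hρ
    rcases hm with (hm | hm) | hm
    · exact (h0.bounds hm).2.2.2
    · exact (h1.bounds hm).2.2.2
    · simp only [mem_iUnion] at hm
      obtain ⟨j, hj, hm⟩ := hm
      exact ((h2 j hj).bounds hm).2.2.2

theorem IsTilingSequence.tilingConditions (hd : IsDebskiSequence d) (hR : IsTilingSequence d R) :
    TilingConditions d R := by
  have hst := hR.isStacked hd
  have hpos := fun n => bot_lt_top_of_isStacked (hst n) n le_rfl
  refine ⟨tiling_finite hst, fun n => ⟨?_, ?_⟩, fun n ρ hρ => ⟨?_, hR.height_le hd n hρ⟩, ?_, ?_,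
    heights_eq_Icc hd hst, ?_, ?_⟩
  · rintro _ ⟨ρ, hρ, rfl⟩
    exact ⟨n, ρ.word, ρ.bot, ρ.top, hpos n ρ hρ, rfl⟩
  · rintro _ ⟨ρ, hρ, rfl⟩ _ ⟨τ, hτ, rfl⟩ hne
    by_cases hw : ρ.word = τ.word
    · obtain ⟨s, hs⟩ := exists_initialWord ρ.word
      have hne' : (⟨n, ρ⟩ : Σ k, Box k) ≠ ⟨n, τ⟩ := by
        intro h
        rw [sigma_mk_injective h] at hne
        exact hne rfl
      have h := (hst n s).ordered ⟨n, ρ⟩ ⟨le_rfl, hρ, hs.symm⟩ ⟨n, τ⟩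
        ⟨le_rfl, hτ, hw ▸ hs.symm⟩ hne'
      simp only [Box.endHeight_self hd hs.symm, Box.startHeight_self hd hs.symm,
        Box.endHeight_self hd (hw ▸ hs.symm : τ.word = _),
        Box.startHeight_self hd (hw ▸ hs.symm : τ.word = _)] at h
      rcases h with h | h
      · refine ⟨n, ρ.word, ρ.top, ?_⟩
        rintro p ⟨⟨h1, h2⟩, ⟨-, h3⟩⟩
        exact ⟨h1, le_antisymm h2.2 (h.trans h3.1)⟩
      · refine ⟨n, ρ.word, ρ.bot, ?_⟩
        rintro p ⟨⟨h1, h2⟩, ⟨-, h3⟩⟩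
        exact ⟨h1, le_antisymm (h3.2.trans h) h2.1⟩
    -- Different words of the same length give disjoint blocks, so the height is immaterial.
    · refine ⟨n, ρ.word, 0, ?_⟩
      rintro p ⟨⟨h1, -⟩, ⟨h2, -⟩⟩
      exact absurd (word_eq_of_mem_cantorBlock h1 h2) hw
  · exact sub_pos.2 (hpos n ρ hρ)
  · intro n ρ hρ τ hτ hne
    exact disjoint_curves hd hst le_rfl hρ hτ fun h => hne (sigma_mk_injective h)
  · intro n k hk ρ hρ τ hτ
    exact disjoint_curves hd hst hk.le hρ hτ fun h => hk.ne (congrArg Sigma.fst h).symm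
  · intro n I hI hsub
    obtain ⟨c, hc, u, v, huv, rfl⟩ := hI.eq_prod fun p hp => (hsub hp).1.1
    exact exists_boxes_of_arc hd hst n hc huv hsub
  · intro n hn σ m x y he
    obtain ⟨k, rfl⟩ : ∃ k, n = k + 1 := ⟨n - 1, by omega⟩
    obtain ⟨s, rfl⟩ := exists_initialWord σ
    obtain ⟨h1, h2, h3, h4, h5⟩ :=
      (hst k s).interlaced hd (bot_lt_top_of_isStacked (hst k)) he
    refine ⟨by push_cast; linarith, h2, h3, by push_cast; linarith, h5⟩

end Conditions

/-! ### Systems of curves -/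

/-- A family of pairwise disjoint increasing curves with vertical jumps over clopen pieces of the
Cantor set, which meets every nondegenerate vertical segment in `C × [0,1]`. Over `c` the `i`-th
curve consists of the heights from `lo i c` to `hi i c`. -/
structure CurveSystem (ι : Type) where
  dom : ι → Set ℝ
  lo : ι → ℝ → ℝ
  hi : ι → ℝ → ℝ
  mid : ι → ℝ → ℝ
  dom_subset : ∀ i, dom i ⊆ cantorSet
  isClosed_diff_dom : ∀ i, IsClosed (cantorSet \ dom i)
  lo_pos : ∀ i, ∀ c ∈ dom i, 0 < lo i c
  hi_lt_one : ∀ i, ∀ c ∈ dom i, hi i c < 1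
  lo_le_hi : ∀ i, ∀ c ∈ dom i, lo i c ≤ hi i c
  lo_lt_mid : ∀ i, ∀ c ∈ dom i, lo i c < hi i c → lo i c < mid i c
  mid_lt_hi : ∀ i, ∀ c ∈ dom i, lo i c < hi i c → mid i c < hi i c
  isClosed_above : ∀ i, IsClosed {p : ℝ × ℝ | p.1 ∈ dom i ∧ lo i p.1 ≤ p.2}
  isClosed_below : ∀ i, IsClosed {p : ℝ × ℝ | p.1 ∈ dom i ∧ p.2 ≤ hi i p.1}
  hi_le_lo : ∀ i, ∀ c ∈ dom i, ∀ c' ∈ dom i, c < c' → hi i c ≤ lo i c'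
  separated : ∀ i j, i ≠ j → ∀ c ∈ dom i, c ∈ dom j → hi i c < lo j c ∨ hi j c < lo i c
  finite_jumps : ∀ η > 0, {c | ∃ i, c ∈ dom i ∧ η ≤ hi i c - lo i c}.Finite
  meets : ∀ c ∈ cantorSet, ∀ u v : ℝ, 0 ≤ u → u < v → v ≤ 1 →
    ∃ i, c ∈ dom i ∧ lo i c < v ∧ u < hi i c
  -- This field and `one_side` are what makes the gluing relation in `isClosed_glued` closed.
  small : ∀ ε > 0, {i | ¬ ∀ c ∈ dom i, ∀ c' ∈ dom i, |c - c'| < ε ∧ hi i c - lo i c' < ε}.Finite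
  one_side : ∀ i, {j | ¬ ((∀ c ∈ dom j, c ∈ dom i ∧ hi i c < lo j c) ∨
    ∀ c ∈ dom j, c ∈ dom i → hi j c < lo i c)}.Finite
  hi_eq_lo : ∀ i, ∀ c ∈ dom i, c ∈ cantorEndpoints → hi i c = lo i c
  exists_jump : ∀ i, ∀ O : Set ℝ, IsOpen O → (O ∩ dom i).Nonempty →
    ∃ c ∈ O ∩ dom i, lo i c < hi i c

namespace CurveSystem

variable {ι : Type} (Γ : CurveSystem ι) {i j : ι} {p : ℝ × ℝ}

/-- The `i`-th curve. -/
def curve (i : ι) : Set (ℝ × ℝ) := {p | p.1 ∈ Γ.dom i ∧ Γ.lo i p.1 ≤ p.2 ∧ p.2 ≤ Γ.hi i p.1}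

/-- The midpoints of the jumps of the `i`-th curve. -/
def mids (i : ι) : Set (ℝ × ℝ) :=
  {p | p.1 ∈ Γ.dom i ∧ Γ.lo i p.1 < Γ.hi i p.1 ∧ p.2 = Γ.mid i p.1}

/-- The part of `C × (0,1)` that avoids the curves except for the midpoints of their jumps. -/
def space : Set (ℝ × ℝ) :=
  {p | p.1 ∈ cantorSet ∧ p.2 ∈ Ioo 0 1 ∧ ∀ i, p ∈ Γ.curve i → p ∈ Γ.mids i}

theorem mids_subset_curve (i : ι) : Γ.mids i ⊆ Γ.curve i := fun _ hp =>
  ⟨hp.1, hp.2.2 ▸ (Γ.lo_lt_mid i _ hp.1 hp.2.1).le, hp.2.2 ▸ (Γ.mid_lt_hi i _ hp.1 hp.2.1).le⟩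

theorem eq_of_mem_curve (hi : p ∈ Γ.curve i) (hj : p ∈ Γ.curve j) : i = j := by
  by_contra hne
  rcases Γ.separated i j hne _ hi.1 hj.1 with h | h
  · linarith [hi.2.2, hj.2.1]
  · linarith [hi.2.1, hj.2.2]

theorem mids_subset_space (i : ι) : Γ.mids i ⊆ Γ.space := by
  intro p hp
  have hc := Γ.mids_subset_curve i hp
  refine ⟨Γ.dom_subset i hp.1, ⟨(Γ.lo_pos i _ hp.1).trans_le hc.2.1,
    hc.2.2.trans_lt (Γ.hi_lt_one i _ hp.1)⟩, fun j hj => ?_⟩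
  rwa [← Γ.eq_of_mem_curve hc hj]

theorem space_subset : Γ.space ⊆ cantorSet ×ˢ Ioo 0 1 := fun _ hp => ⟨hp.1, hp.2.1⟩

theorem isClosed_curve (i : ι) : IsClosed (Γ.curve i) := by
  have : Γ.curve i = {p : ℝ × ℝ | p.1 ∈ Γ.dom i ∧ Γ.lo i p.1 ≤ p.2} ∩
      {p : ℝ × ℝ | p.1 ∈ Γ.dom i ∧ p.2 ≤ Γ.hi i p.1} := by
    ext p
    exact ⟨fun h => ⟨⟨h.1, h.2.1⟩, h.1, h.2.2⟩, fun h => ⟨h.1.1, h.1.2, h.2.2⟩⟩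
  rw [this]
  exact (Γ.isClosed_above i).inter (Γ.isClosed_below i)

/-- A curve meets the height of the interior of a jump only in that jump. -/
theorem fst_eq_of_mem_Ioo {c : ℝ} (hc : c ∈ Γ.dom i) (hp : p ∈ Γ.curve i)
    (h : p.2 ∈ Ioo (Γ.lo i c) (Γ.hi i c)) : p.1 = c := by
  rcases lt_trichotomy p.1 c with h' | h' | h'
  · linarith [Γ.hi_le_lo i _ hp.1 _ hc h', hp.2.2, h.1]
  · exact h'
  · linarith [Γ.hi_le_lo i _ hc _ hp.1 h', hp.2.1, h.2]

/-! #### Hereditary disconnectedness -/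

/-- A connected subset with two heights would contain the whole vertical segment between them, which
meets some curve. The lowest and the highest common point of segment and curve would both have to be
the midpoint of a jump, yet they differ once there is a jump. -/
theorem isTotallyDisconnected_space : IsTotallyDisconnected Γ.space := by
  intro T hT hconn
  have h1 : (Prod.fst '' T).Subsingleton :=
    isTotallyDisconnected_cantorSet _ (by rintro _ ⟨p, hp, rfl⟩; exact (hT hp).1)
      (hconn.image _ continuous_fst.continuousOn)
  have h2 := (hconn.image _ continuous_snd.continuousOn).ordConnected
  have key : ∀ p ∈ T, ∀ q ∈ T, ¬ p.2 < q.2 := by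
    intro p hp q hq hlt
    have hmem : ∀ y ∈ Icc p.2 q.2, (p.1, y) ∈ Γ.space := by
      intro y hy
      obtain ⟨r, hr, hry⟩ := h2.out (mem_image_of_mem _ hp) (mem_image_of_mem _ hq) hy
      have : r.1 = p.1 := h1 (mem_image_of_mem _ hr) (mem_image_of_mem _ hp)
      rw [← this, ← hry]
      exact hT hr
    obtain ⟨i, hi, hlo, hhi⟩ := Γ.meets p.1 (hT hp).1 p.2 q.2 (hT hp).2.1.1.le hlt (hT hq).2.1.2.le
    have hle := Γ.lo_le_hi i _ hi
    have ha : (p.1, max p.2 (Γ.lo i p.1)) ∈ Γ.mids i :=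
      (hmem _ ⟨le_max_left _ _, max_le hlt.le hlo.le⟩).2.2 i
        ⟨hi, le_max_right _ _, max_le hhi.le hle⟩
    have hb : (p.1, min q.2 (Γ.hi i p.1)) ∈ Γ.mids i :=
      (hmem _ ⟨le_min hlt.le hhi.le, min_le_left _ _⟩).2.2 i
        ⟨hi, le_min hlo.le hle, min_le_right _ _⟩
    have hab : max p.2 (Γ.lo i p.1) < min q.2 (Γ.hi i p.1) :=
      max_lt (lt_min hlt hhi) (lt_min hlo ha.2.1)
    exact hab.ne (ha.2.2.trans hb.2.2.symm)
  intro p hp q hq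
  exact Prod.ext (h1 (mem_image_of_mem _ hp) (mem_image_of_mem _ hq))
    (le_antisymm (not_lt.1 (key q hq p hp)) (not_lt.1 (key p hp q hq)))

/-! #### Complete metrizability -/

/-- A point of the curve whose height is interior to a jump lies in that jump. So the midpoints are
cut out of the closed curve by two conditions on the height, one open (`A`) and one closed (`Bᶜ`).
-/
theorem isGδ_mids (i : ι) : IsGδ (Γ.mids i) := by
  set A : Set (ℝ × ℝ) := ⋃ c ∈ Γ.dom i, Prod.snd ⁻¹' Ioo (Γ.lo i c) (Γ.hi i c)
  set B : Set (ℝ × ℝ) := ⋃ c ∈ Γ.dom i, Prod.snd ⁻¹' (Ioo (Γ.lo i c) (Γ.hi i c) \ {Γ.mid i c})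
  have hA : IsOpen A := isOpen_biUnion fun c _ => isOpen_Ioo.preimage continuous_snd
  have hB : IsOpen B := isOpen_biUnion fun c _ =>
    (isOpen_Ioo.sdiff isClosed_singleton).preimage continuous_snd
  have : Γ.mids i = Γ.curve i ∩ A ∩ Bᶜ := by
    ext p
    constructor
    · intro hp
      have hc := Γ.mids_subset_curve i hp
      have hm : p.2 ∈ Ioo (Γ.lo i p.1) (Γ.hi i p.1) :=
        hp.2.2 ▸ ⟨Γ.lo_lt_mid i _ hp.1 hp.2.1, Γ.mid_lt_hi i _ hp.1 hp.2.1⟩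
      refine ⟨⟨hc, mem_biUnion hp.1 hm⟩, fun hpB => ?_⟩
      simp only [B, mem_iUnion] at hpB
      obtain ⟨c, hcd, hpc, hne⟩ := hpB
      rw [← Γ.fst_eq_of_mem_Ioo hcd hc hpc] at hne
      exact hne hp.2.2
    · rintro ⟨⟨hc, hpA⟩, hpB⟩
      simp only [A, mem_iUnion] at hpA
      obtain ⟨c, hcd, hpc⟩ := hpA
      obtain rfl := Γ.fst_eq_of_mem_Ioo hcd hc hpc
      refine ⟨hcd, hpc.1.trans hpc.2, ?_⟩
      by_contra hne
      exact hpB (mem_biUnion hcd ⟨hpc, hne⟩)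
  rw [this]
  exact ((Γ.isClosed_curve i).isGδ.inter hA.isGδ).inter hB.isClosed_compl.isGδ

theorem isGδ_space [Countable ι] : IsGδ Γ.space := by
  have : Γ.space = (cantorSet ×ˢ univ) ∩ (Prod.snd ⁻¹' Ioo 0 1) ∩
      ⋂ i, ((Γ.curve i)ᶜ ∪ Γ.mids i) := by
    ext p
    simp only [space, mem_ofPred_eq, mem_inter_iff, mem_prod, mem_univ, and_true, mem_preimage,
      mem_iInter, mem_union, mem_compl_iff, ← imp_iff_not_or, and_assoc]
  rw [this]
  refine ((isClosed_cantorSet.prod isClosed_univ).isGδ.inter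
    (isOpen_Ioo.preimage continuous_snd).isGδ).inter (.iInter fun i => ?_)
  exact (Γ.isClosed_curve i).isOpen_compl.isGδ.union (Γ.isGδ_mids i)

end CurveSystem

/-- The diagonal embeds the intersection as a closed subset of the product of the open sets. -/
theorem IsGδ.polishSpace {E : Type*} [TopologicalSpace E] [PolishSpace E] {S : Set E}
    (hS : IsGδ S) : PolishSpace S := by
  obtain ⟨O, hO, rfl⟩ := isGδ_iff_eq_iInter_nat.1 hS
  have : ∀ n, PolishSpace (O n) := fun n => (hO n).polishSpace
  let φ : (⋂ n, O n : Set E) → ∀ n, O n := fun x n => ⟨x, mem_iInter.1 x.2 n⟩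
  refine IsClosedEmbedding.polishSpace (f := φ) ⟨?_, ?_⟩
  · have h1 : Continuous φ := by fun_prop
    refine .of_comp h1 (g := fun f : (∀ n, O n) => (f 0 : E)) (by fun_prop) ?_
    exact IsEmbedding.subtypeVal
  · have : range φ = ⋂ n, {f | (f n : E) = f 0} := by
      ext f
      simp only [mem_range, mem_iInter, mem_ofPred_eq]
      constructor
      · rintro ⟨x, rfl⟩ n
        rfl
      · intro h
        exact ⟨⟨f 0, mem_iInter.2 fun n => h n ▸ (f n).2⟩, funext fun n => Subtype.ext (h n).symm⟩
    rw [this]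
    exact isClosed_iInter fun n => isClosed_eq (by fun_prop) (by fun_prop)

/-! ### The fan -/

/-- The inverse of `nabla` away from the bottom edge. -/
noncomputable def unfan (q : ℝ × ℝ) : ℝ × ℝ := (((2 * q.1 - 1) / q.2 + 1) / 2, q.2)

theorem unfan_nabla {p : ℝ × ℝ} (hp : p.2 ≠ 0) : unfan (nabla p) = p := by
  refine Prod.ext ?_ rfl
  simp only [unfan, nabla]
  field_simp
  ring

theorem nabla_unfan {q : ℝ × ℝ} (hq : q.2 ≠ 0) : nabla (unfan q) = q := by
  refine Prod.ext ?_ rfl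
  simp only [unfan, nabla]
  field_simp
  ring

theorem continuousOn_unfan : ContinuousOn unfan {q | q.2 ≠ 0} := by
  unfold unfan
  fun_prop (disch := simp)

theorem continuous_nabla : Continuous nabla := by unfold nabla; fun_prop

theorem fan_eq {X : Set (ℝ × ℝ)} (hX : X ⊆ cantorSet ×ˢ Ioo 0 1) :
    fan X = {q | q.2 ≠ 0} ∩ unfan ⁻¹' X ∪ {(1 / 2, 0)} := by
  unfold fan
  congr 1
  ext q
  constructor
  · rintro ⟨p, hp, rfl⟩
    have : p.2 ≠ 0 := (hX hp).2.1.ne'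
    exact ⟨this, by rwa [mem_preimage, unfan_nabla this]⟩
  · rintro ⟨h1, h2⟩
    exact ⟨_, h2, nabla_unfan h1⟩

theorem isOpen_snd_ne_zero : IsOpen {q : ℝ × ℝ | q.2 ≠ 0} :=
  isOpen_ne_fun continuous_snd continuous_const

theorem isGδ_fan {X : Set (ℝ × ℝ)} (hX : X ⊆ cantorSet ×ˢ Ioo 0 1) (h : IsGδ X) :
    IsGδ (fan X) := by
  rw [fan_eq hX]
  refine IsGδ.union ?_ isClosed_singleton.isGδ
  obtain ⟨O, hO, rfl⟩ := isGδ_iff_eq_iInter_nat.1 h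
  rw [preimage_iInter, inter_iInter]
  exact .iInter fun n => (continuousOn_unfan.isOpen_inter_preimage isOpen_snd_ne_zero (hO n)).isGδ

theorem fan_diff_apex {X : Set (ℝ × ℝ)} (hX : X ⊆ cantorSet ×ˢ Ioo 0 1) :
    fan X \ {(1 / 2, 0)} = nabla '' X := by
  unfold fan
  rw [union_sdiff_right]
  refine sdiff_eq_left.2 (Set.disjoint_left.2 ?_)
  rintro _ ⟨p, hp, rfl⟩ h
  exact (hX hp).2.1.ne' (congrArg Prod.snd h)

theorem isTotallyDisconnected_nabla {X : Set (ℝ × ℝ)} (hX : X ⊆ cantorSet ×ˢ Ioo 0 1)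
    (h : IsTotallyDisconnected X) : IsTotallyDisconnected (nabla '' X) := by
  intro T hT hconn
  have hne : ∀ q ∈ T, q.2 ≠ 0 := by
    intro q hq
    obtain ⟨p, hp, rfl⟩ := hT hq
    exact (hX hp).2.1.ne'
  have hsub : (unfan '' T).Subsingleton := by
    refine h _ ?_ (hconn.image _ (continuousOn_unfan.mono hne))
    rintro _ ⟨q, hq, rfl⟩
    obtain ⟨p, hp, rfl⟩ := hT hq
    rwa [unfan_nabla (hX hp).2.1.ne']
  intro q hq r hr
  rw [← nabla_unfan (hne q hq), ← nabla_unfan (hne r hr),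
    hsub (mem_image_of_mem _ hq) (mem_image_of_mem _ hr)]

theorem isDispersionPoint_fan {X : Set (ℝ × ℝ)} (hX : X ⊆ cantorSet ×ˢ Ioo 0 1)
    (hne : X.Nonempty) (h : IsTotallyDisconnected X) (hconn : IsConnected (fan X)) :
    IsDispersionPoint (fan X) (1 / 2, 0) := by
  refine ⟨hconn, ?_, Or.inr rfl, ?_⟩
  · obtain ⟨p, hp⟩ := hne
    refine ⟨_, Or.inl (mem_image_of_mem _ hp), _, Or.inr rfl, fun h => ?_⟩
    exact (hX hp).2.1.ne' (congrArg Prod.snd h)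
  · rw [fan_diff_apex hX]
    exact isTotallyDisconnected_nabla hX h

/-- Each of the two nondegenerate connected parts would have to contain `x`. -/
theorem IsDispersionPoint.isBiconnected {E : Type*} [TopologicalSpace E] {S : Set E} {x : E}
    (h : IsDispersionPoint S x) : IsBiconnected S := by
  refine ⟨h.1, ?_⟩
  rintro ⟨A, B, rfl, hAB, hA, hA', hB, hB'⟩
  have key : ∀ T ⊆ A ∪ B, IsConnected T → T.Nontrivial → x ∈ T := by
    intro T hT hc hn
    by_contra hx
    exact hn.not_subsingleton
      (h.2.2.2 T (fun y hy => ⟨hT hy, fun hyx => hx (hyx ▸ hy)⟩) hc.isPreconnected)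
  exact Set.disjoint_left.1 hAB (key A subset_union_left hA hA')
    (key B subset_union_right hB hB')

namespace CurveSystem

variable {ι : Type} (Γ : CurveSystem ι) {i : ι} {U V : Set (ℝ × ℝ)}

/-! #### Connectedness -/

/-- The largest open set whose trace on the space lies in `U`. -/
def core (U : Set (ℝ × ℝ)) : Set (ℝ × ℝ) := ⋃₀ {O | IsOpen O ∧ O ∩ Γ.space ⊆ U}

theorem isOpen_core (U : Set (ℝ × ℝ)) : IsOpen (Γ.core U) := isOpen_sUnion fun _ hO => hO.1

theorem mem_of_mem_core {p : ℝ × ℝ} (hp : p ∈ Γ.core U) (hX : p ∈ Γ.space) : p ∈ U := by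
  obtain ⟨O, hO, hpO⟩ := hp
  exact hO.2 ⟨hpO, hX⟩

theorem subset_core {O : Set (ℝ × ℝ)} (hO : IsOpen O) (h : O ∩ Γ.space ⊆ U) : O ⊆ Γ.core U :=
  subset_sUnion_of_mem (show O ∈ {O | IsOpen O ∧ O ∩ Γ.space ⊆ U} from ⟨hO, h⟩)

/-- Points of the space over endpoints are dense. -/
theorem exists_mem_space_endpoint [Countable ι] {O : Set (ℝ × ℝ)} (hO : IsOpen O) {p : ℝ × ℝ}
    (hp : p ∈ O) (hc : p.1 ∈ cantorSet) (hy : p.2 ∈ Ioo 0 1) :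
    ∃ q ∈ O ∩ Γ.space, q.1 ∈ cantorEndpoints ∧ ∀ i, q ∉ Γ.curve i := by
  obtain ⟨ε, hε, hball⟩ := Metric.isOpen_iff.1 hO p hp
  obtain ⟨c, hcE, hcp⟩ := exists_endpoint_near hc hε
  -- Over an endpoint each curve has just one height, so only countably many heights are excluded.
  have hcount : (⋃ i, {y | y = Γ.lo i c}).Countable :=
    countable_iUnion fun i => countable_singleton _
  obtain ⟨y, hyO, hyn⟩ := (hcount.dense_compl ℝ).inter_open_nonempty
    (Ioo 0 1 ∩ Metric.ball p.2 ε) (isOpen_Ioo.inter Metric.isOpen_ball)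
    ⟨p.2, hy, Metric.mem_ball_self hε⟩
  have hn : ∀ i, ((c, y) : ℝ × ℝ) ∉ Γ.curve i := by
    intro i hi
    refine hyn (mem_iUnion.2 ⟨i, le_antisymm ?_ hi.2.1⟩)
    exact (Γ.hi_eq_lo i c hi.1 hcE) ▸ hi.2.2
  refine ⟨(c, y), ⟨hball ?_, cantorEndpoints_subset hcE, hyO.1, fun i hi => absurd hi (hn i)⟩,
    hcE, hn⟩
  rw [Metric.mem_ball, Prod.dist_eq]
  refine max_lt ?_ hyO.2
  rw [Real.dist_eq]
  exact hcp

/-- The space is dense in the product of the Cantor set with (0,1), so overlapping cores would share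
one of its points. -/
theorem core_disjoint [Countable ι] (h : Γ.space ∩ (U ∩ V) = ∅) {p : ℝ × ℝ}
    (hc : p.1 ∈ cantorSet) (hy : p.2 ∈ Ioo 0 1) (hU : p ∈ Γ.core U) (hV : p ∈ Γ.core V) :
    False := by
  obtain ⟨q, ⟨⟨h1, h2⟩, hq⟩, -⟩ := Γ.exists_mem_space_endpoint
    ((Γ.isOpen_core U).inter (Γ.isOpen_core V)) ⟨hU, hV⟩ hc hy
  exact h.subset ⟨hq, Γ.mem_of_mem_core h1 hq, Γ.mem_of_mem_core h2 hq⟩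

/-- Along a connected part of a vertical line the label can change only by leaving both cores. -/
theorem fibre_subset_core [Countable ι] (h : Γ.space ∩ (U ∩ V) = ∅) {c : ℝ}
    (hc : c ∈ cantorSet) {I : Set ℝ} (hI : IsPreconnected I) (hI1 : I ⊆ Ioo 0 1)
    (hIs : ∀ y ∈ I, (c, y) ∈ Γ.core U ∨ (c, y) ∈ Γ.core V) {y₀ : ℝ} (hy₀ : y₀ ∈ I)
    (hU : (c, y₀) ∈ Γ.core U) : ∀ y ∈ I, (c, y) ∈ Γ.core U := by
  have hcont : Continuous fun y : ℝ => (c, y) := by fun_prop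
  have := IsPreconnected.subset_left_of_subset_union
    (u := (fun y => (c, y)) ⁻¹' Γ.core U ∩ Ioo 0 1) (v := (fun y => (c, y)) ⁻¹' Γ.core V ∩ Ioo 0 1)
    (((Γ.isOpen_core U).preimage hcont).inter isOpen_Ioo)
    (((Γ.isOpen_core V).preimage hcont).inter isOpen_Ioo)
    (Set.disjoint_left.2 fun y h1 h2 => Γ.core_disjoint h hc h1.2 h1.1 h2.1)
    (fun y hy => (hIs y hy).imp (fun h => ⟨h, hI1 hy⟩) fun h => ⟨h, hI1 hy⟩)
    ⟨y₀, hy₀, hU, hI1 hy₀⟩ hI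
  exact fun y hy => (this hy).1

theorem eventually_lt_lo (i : ι) {c y : ℝ} (h : c ∈ Γ.dom i → y < Γ.lo i c) :
    ∀ᶠ x in 𝓝 c, x ∈ Γ.dom i → y < Γ.lo i x := by
  have hcont : Continuous fun x : ℝ => (x, y) := by fun_prop
  have := ((Γ.isClosed_above i).isOpen_compl.preimage hcont).mem_nhds
    (show c ∈ _ from fun h' => (h h'.1).not_ge h'.2)
  filter_upwards [this] with x hx hx'
  by_contra hle
  exact hx ⟨hx', not_lt.1 hle⟩

theorem eventually_hi_lt (i : ι) {c y : ℝ} (h : c ∈ Γ.dom i → Γ.hi i c < y) :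
    ∀ᶠ x in 𝓝 c, x ∈ Γ.dom i → Γ.hi i x < y := by
  have hcont : Continuous fun x : ℝ => (x, y) := by fun_prop
  have := ((Γ.isClosed_below i).isOpen_compl.preimage hcont).mem_nhds
    (show c ∈ _ from fun h' => (h h'.1).not_ge h'.2)
  filter_upwards [this] with x hx hx'
  by_contra hle
  exact hx ⟨hx', not_lt.1 hle⟩

theorem eventually_mem_dom (i : ι) {c : ℝ} (h : c ∈ Γ.dom i) :
    ∀ᶠ x in 𝓝 c, x ∈ cantorSet → x ∈ Γ.dom i := by
  have := (Γ.isClosed_diff_dom i).isOpen_compl.mem_nhds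
    (show c ∈ _ from fun h' => h'.2 h)
  filter_upwards [this] with x hx hx'
  by_contra hn
  exact hx ⟨hx', hn⟩

/-- The sides of a curve near an endpoint carry the same label, since the midpoint of a nearby
jump is a limit of points of both sides. -/
theorem not_mixed [Countable ι] (h : Γ.space ∩ (U ∩ V) = ∅) {c y r ε : ℝ} (hr : 0 < r)
    (hc : c ∈ Γ.dom i) (hlo : ∀ x ∈ Γ.dom i, |x - c| < r → y - ε < Γ.lo i x)
    (hhi : ∀ x ∈ Γ.dom i, |x - c| < r → Γ.hi i x < y + ε)
    (hdom : ∀ x ∈ cantorSet, |x - c| < r → x ∈ Γ.dom i)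
    (hup : ∀ x ∈ cantorEndpoints, |x - c| < r → ∀ z, Γ.hi i x < z → z ≤ y + ε → (x, z) ∈ Γ.core U)
    (hdown : ∀ x ∈ cantorEndpoints, |x - c| < r → ∀ z, z < Γ.lo i x → y - ε ≤ z →
      (x, z) ∈ Γ.core V) (hX : Γ.space ⊆ Γ.core U ∪ Γ.core V) : False := by
  obtain ⟨a, ⟨har, ha⟩, hjump⟩ := Γ.exists_jump i (Metric.ball c r) Metric.isOpen_ball
    ⟨c, Metric.mem_ball_self hr, hc⟩
  have hmid : (a, Γ.mid i a) ∈ Γ.mids i := ⟨ha, hjump, rfl⟩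
  have h1 := Γ.lo_lt_mid i a ha hjump
  have h2 := Γ.mid_lt_hi i a ha hjump
  have haC := Γ.dom_subset i ha
  have haE : a ∉ cantorEndpoints := fun haE => hjump.ne' (Γ.hi_eq_lo i a ha haE)
  rw [Metric.mem_ball, Real.dist_eq] at har
  have hm01 : Γ.mid i a ∈ Ioo (0 : ℝ) 1 := (Γ.mids_subset_space i hmid).2.1
  have hcont : Continuous fun x : ℝ => (x, Γ.mid i a) := by fun_prop
  have hev : ∀ᶠ x in 𝓝 a, |x - c| < r :=
    (isOpen_lt (by fun_prop : Continuous fun x : ℝ => |x - c|) continuous_const).mem_nhds har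
  rcases hX (Γ.mids_subset_space i hmid) with hU | hV
  -- Just to the right of `a` the curve has climbed past the top of the jump, so the height of the
  -- midpoint lies below it, on the side labelled `V`.
  · have hev' : ∀ᶠ x in 𝓝 a, (x, Γ.mid i a) ∈ Γ.core U :=
      ((Γ.isOpen_core U).preimage hcont).mem_nhds hU
    obtain ⟨ε', hε', hb⟩ := Metric.eventually_nhds_iff.1 (hev'.and hev)
    obtain ⟨x, hxE, hx1, hx2⟩ := exists_endpoint_gt haC haE hε'
    have hd : dist x a < ε' := by rw [Real.dist_eq, abs_of_pos (by linarith)]; linarith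
    have hxC := cantorEndpoints_subset hxE
    have hxr := (hb hd).2
    have hxdom := hdom x hxC hxr
    have := Γ.hi_le_lo i a ha x hxdom hx1
    exact Γ.core_disjoint h hxC hm01 (hb hd).1
      (hdown x hxE hxr _ (by linarith) (by linarith [hlo a ha har]))
  -- Just to the left of `a` the same height lies above the curve, on the side labelled `U`.
  · have hev' : ∀ᶠ x in 𝓝 a, (x, Γ.mid i a) ∈ Γ.core V :=
      ((Γ.isOpen_core V).preimage hcont).mem_nhds hV
    obtain ⟨ε', hε', hb⟩ := Metric.eventually_nhds_iff.1 (hev'.and hev)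
    obtain ⟨x, hxE, hx1, hx2⟩ := exists_endpoint_lt haC haE hε'
    have hd : dist x a < ε' := by rw [Real.dist_eq, abs_of_neg (by linarith)]; linarith
    have hxC := cantorEndpoints_subset hxE
    have hxr := (hb hd).2
    have hxdom := hdom x hxC hxr
    have := Γ.hi_le_lo i x hxdom a ha hx2
    exact Γ.core_disjoint h hxC hm01
      (hup x hxE hxr _ (by linarith) (by linarith [hhi a ha har])) (hb hd).1

/-- A point of the space in the window with label `V` could be approximated by one over an endpoint
and off all curves. That point is on one of the two sides of the curve and so has label `U`. -/
theorem mem_core_of_sides [Countable ι] (h : Γ.space ∩ (U ∩ V) = ∅) {c y r ε : ℝ} (hr : 0 < r)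
    (hε : 0 < ε) (hup : ∀ x ∈ cantorEndpoints, |x - c| < r → ∀ z, Γ.hi i x < z → z ≤ y + ε →
      (x, z) ∈ Γ.core U)
    (hdown : ∀ x ∈ cantorEndpoints, |x - c| < r → ∀ z, z < Γ.lo i x → y - ε ≤ z →
      (x, z) ∈ Γ.core U)
    (hdom : ∀ x ∈ cantorSet, |x - c| < r → x ∈ Γ.dom i)
    (hX : Γ.space ⊆ U ∪ V) (hV : IsOpen V) : (c, y) ∈ Γ.core U := by
  have hO : IsOpen (Metric.ball c r ×ˢ Ioo (y - ε) (y + ε)) := Metric.isOpen_ball.prod isOpen_Ioo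
  refine Γ.subset_core hO ?_ ⟨Metric.mem_ball_self hr, by constructor <;> simp only <;> linarith⟩
  rintro p ⟨hpO, hp⟩
  refine (hX hp).resolve_right fun hpV => ?_
  obtain ⟨q, ⟨⟨hqO, hqV⟩, hq⟩, hqE, hqn⟩ :=
    Γ.exists_mem_space_endpoint (hO.inter hV) ⟨hpO, hpV⟩ hp.1 hp.2.1
  have hqr : |q.1 - c| < r := hqO.1
  have hqd := hdom q.1 hq.1 hqr
  have hqU : q ∈ Γ.core U := by
    rcases lt_or_ge (Γ.hi i q.1) q.2 with h1 | h1
    · exact hup q.1 hqE hqr q.2 h1 hqO.2.2.le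
    · rcases lt_or_ge q.2 (Γ.lo i q.1) with h2 | h2
      · exact hdown q.1 hqE hqr q.2 h2 hqO.2.1.le
      · exact absurd ⟨hqd, h2, h1⟩ (hqn i)
  exact h.subset ⟨hq, Γ.mem_of_mem_core hqU hq, hqV⟩

/-- Near the point, over endpoints, only the curve itself can be outside both cores. The labels at
heights `y + ε` and `y - ε` therefore spread along vertical intervals over the whole upper and lower
side. -/
theorem mem_core_of_locally_curve [Countable ι] (h : Γ.space ∩ (U ∩ V) = ∅)
    (hX : Γ.space ⊆ U ∪ V) (hU : IsOpen U) (hV : IsOpen V) {c y : ℝ} (hcE : c ∈ cantorEndpoints)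
    (hcy : (c, y) ∈ Γ.curve i) {O : Set (ℝ × ℝ)} (hO : IsOpen O) (hcO : (c, y) ∈ O)
    (hF : ∀ p ∈ O, p.1 ∈ cantorEndpoints → p ∉ Γ.core U → p ∉ Γ.core V → p ∈ Γ.curve i) :
    (c, y) ∈ Γ.core U ∪ Γ.core V := by
  have hXc : Γ.space ⊆ Γ.core U ∪ Γ.core V := fun p hp => (hX hp).imp
    (fun hpU => Γ.subset_core hU inter_subset_left hpU)
    (fun hpV => Γ.subset_core hV inter_subset_left hpV)
  have hd : c ∈ Γ.dom i := hcy.1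
  have heq := Γ.hi_eq_lo i c hd hcE
  have hlo : Γ.lo i c = y := le_antisymm hcy.2.1 (heq ▸ hcy.2.2)
  have hhi : Γ.hi i c = y := heq.trans hlo
  have hy0 : 0 < y := hlo ▸ Γ.lo_pos i c hd
  have hy1 : y < 1 := hhi ▸ Γ.hi_lt_one i c hd
  obtain ⟨η, hη, hball⟩ := Metric.isOpen_iff.1 hO _ hcO
  obtain ⟨ε, hε, hεη, hε0, hε1⟩ : ∃ ε > 0, ε < η ∧ ε < y ∧ ε < 1 - y := by
    obtain ⟨ε, h1, h2⟩ := exists_between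
      (show 0 < min η (min y (1 - y)) from lt_min hη (lt_min hy0 (by linarith)))
    simp only [lt_min_iff] at h2
    exact ⟨ε, h1, h2.1, h2.2.1, h2.2.2⟩
  have hup0 : (c, y + ε) ∈ Γ.core U ∪ Γ.core V := by
    by_contra hn
    rw [mem_union, not_or] at hn
    have := hF (c, y + ε) (hball ?_) hcE hn.1 hn.2
    · have := this.2.2
      simp only at this
      linarith
    · rw [Metric.mem_ball, Prod.dist_eq]
      simp [abs_of_pos hε, hεη, hη]
  have hdown0 : (c, y - ε) ∈ Γ.core U ∪ Γ.core V := by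
    by_contra hn
    rw [mem_union, not_or] at hn
    have := hF (c, y - ε) (hball ?_) hcE hn.1 hn.2
    · have := this.2.1
      simp only at this
      linarith
    · rw [Metric.mem_ball, Prod.dist_eq]
      simp [abs_of_pos hε, hεη, hη]
  have hcu : Continuous fun x : ℝ => (x, y + ε) := by fun_prop
  have hcd : Continuous fun x : ℝ => (x, y - ε) := by fun_prop
  have hev1 := Γ.eventually_lt_lo i (c := c) (y := y - ε) fun _ => by linarith
  have hev2 := Γ.eventually_hi_lt i (c := c) (y := y + ε) fun _ => by linarith
  have hev3 := Γ.eventually_mem_dom i hd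
  obtain ⟨r, hr, hrη, hr1, hr2, hr3⟩ : ∃ r > 0, r ≤ η ∧
      (∀ x ∈ Γ.dom i, |x - c| < r → y - ε < Γ.lo i x) ∧
      (∀ x ∈ Γ.dom i, |x - c| < r → Γ.hi i x < y + ε) ∧
      (∀ x ∈ cantorSet, |x - c| < r → x ∈ Γ.dom i) := by
    obtain ⟨r, hr, hb⟩ := Metric.eventually_nhds_iff.1 (hev1.and (hev2.and hev3))
    refine ⟨min r η, lt_min hr hη, min_le_right _ _, ?_, ?_, ?_⟩ <;> intro x hx hxr <;>
      have := hb (y := x) (hxr.trans_le (min_le_left _ _))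
    · exact this.1 hx
    · exact this.2.1 hx
    · exact this.2.2 hx
  have hwin : ∀ x, |x - c| < r → ∀ z, y - ε ≤ z → z ≤ y + ε → (x, z) ∈ O := by
    intro x hx z h1 h2
    refine hball ?_
    rw [Metric.mem_ball, Prod.dist_eq]
    refine max_lt (hx.trans_le hrη) ?_
    rw [Real.dist_eq]
    exact (abs_le.2 ⟨by linarith, by linarith⟩).trans_lt hεη
  -- labels of the sides
  have hside : ∀ {A B : Set (ℝ × ℝ)}, Γ.space ∩ (A ∩ B) = ∅ →
      (∀ p ∈ O, p.1 ∈ cantorEndpoints → p ∉ Γ.core A → p ∉ Γ.core B → p ∈ Γ.curve i) →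
      ((c, y + ε) ∈ Γ.core A → ∃ r' > 0, ∀ x ∈ cantorEndpoints, |x - c| < r' → r' ≤ r ∧
        ∀ z, Γ.hi i x < z → z ≤ y + ε → (x, z) ∈ Γ.core A) ∧
      ((c, y - ε) ∈ Γ.core A → ∃ r' > 0, ∀ x ∈ cantorEndpoints, |x - c| < r' → r' ≤ r ∧
        ∀ z, z < Γ.lo i x → y - ε ≤ z → (x, z) ∈ Γ.core A) := by
    intro A B hAB hFAB
    constructor
    · intro hA
      obtain ⟨r', hr', hb⟩ := Metric.eventually_nhds_iff.1
        (((Γ.isOpen_core A).preimage hcu).mem_nhds hA : ∀ᶠ x in 𝓝 c, (x, y + ε) ∈ _)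
      refine ⟨min r' r, lt_min hr' hr, fun x hxE hx => ⟨min_le_right _ _, fun z hz1 hz2 => ?_⟩⟩
      have hxr := hx.trans_le (min_le_right _ _)
      have hxC := cantorEndpoints_subset hxE
      have hxd := hr3 x hxC hxr
      have h1 := hr1 x hxd hxr
      have h2 := Γ.lo_le_hi i x hxd
      refine Γ.fibre_subset_core hAB hxC (I := Ioc (Γ.hi i x) (y + ε)) isPreconnected_Ioc
        (fun w hw => ⟨by linarith [hw.1], by linarith [hw.2]⟩) (fun w hw => ?_)
        ⟨hr2 x hxd hxr, le_rfl⟩ (hb (y := x) (hx.trans_le (min_le_left _ _))) z ⟨hz1, hz2⟩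
      by_contra! hn
      exact hw.1.not_ge (hFAB (x, w) (hwin x hxr w (by linarith [hw.1]) hw.2) hxE hn.1 hn.2).2.2
    · intro hA
      obtain ⟨r', hr', hb⟩ := Metric.eventually_nhds_iff.1
        (((Γ.isOpen_core A).preimage hcd).mem_nhds hA : ∀ᶠ x in 𝓝 c, (x, y - ε) ∈ _)
      refine ⟨min r' r, lt_min hr' hr, fun x hxE hx => ⟨min_le_right _ _, fun z hz1 hz2 => ?_⟩⟩
      have hxr := hx.trans_le (min_le_right _ _)
      have hxC := cantorEndpoints_subset hxE
      have hxd := hr3 x hxC hxr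
      have h1 := hr2 x hxd hxr
      have h2 := Γ.lo_le_hi i x hxd
      refine Γ.fibre_subset_core hAB hxC (I := Ico (y - ε) (Γ.lo i x)) isPreconnected_Ico
        (fun w hw => ⟨by linarith [hw.1], by linarith [hw.2]⟩) (fun w hw => ?_)
        ⟨le_rfl, hr1 x hxd hxr⟩ (hb (y := x) (hx.trans_le (min_le_left _ _))) z ⟨hz2, hz1⟩
      by_contra! hn
      exact hw.2.not_ge (hFAB (x, w) (hwin x hxr w hw.1 (by linarith [hw.2])) hxE hn.1 hn.2).2.1
  have h' : Γ.space ∩ (V ∩ U) = ∅ := by rwa [inter_comm V]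
  have hsU := hside h hF
  have hsV := hside h' fun p hp hpE h1 h2 => hF p hp hpE h2 h1
  -- Equal labels put the point into a core; opposite labels contradict `not_mixed`.
  rcases hup0 with hu | hu <;> rcases hdown0 with hl | hl
  · obtain ⟨r₁, hr₁, hb₁⟩ := hsU.1 hu
    obtain ⟨r₂, hr₂, hb₂⟩ := hsU.2 hl
    refine Or.inl (Γ.mem_core_of_sides (i := i) h (r := min r (min r₁ r₂))
      (lt_min hr (lt_min hr₁ hr₂)) hε (fun x hxE hx => (hb₁ x hxE ?_).2)
      (fun x hxE hx => (hb₂ x hxE ?_).2) (fun x hx hxr => hr3 x hx ?_) hX hV)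
    all_goals simp only [lt_min_iff] at *; tauto
  · obtain ⟨r₁, hr₁, hb₁⟩ := hsU.1 hu
    obtain ⟨r₂, hr₂, hb₂⟩ := hsV.2 hl
    exfalso
    refine Γ.not_mixed (i := i) h (r := min r (min r₁ r₂)) (lt_min hr (lt_min hr₁ hr₂)) hd
      (fun x hx hxr => hr1 x hx ?_) (fun x hx hxr => hr2 x hx ?_) (fun x hx hxr => hr3 x hx ?_)
      (fun x hxE hx => (hb₁ x hxE ?_).2) (fun x hxE hx => (hb₂ x hxE ?_).2) hXc
    all_goals simp only [lt_min_iff] at *; tauto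
  · obtain ⟨r₁, hr₁, hb₁⟩ := hsV.1 hu
    obtain ⟨r₂, hr₂, hb₂⟩ := hsU.2 hl
    exfalso
    refine Γ.not_mixed (i := i) h' (r := min r (min r₁ r₂)) (lt_min hr (lt_min hr₁ hr₂)) hd
      (fun x hx hxr => hr1 x hx ?_) (fun x hx hxr => hr2 x hx ?_) (fun x hx hxr => hr3 x hx ?_)
      (fun x hxE hx => (hb₁ x hxE ?_).2) (fun x hxE hx => (hb₂ x hxE ?_).2)
      (by rwa [union_comm])
    all_goals simp only [lt_min_iff] at *; tauto
  · obtain ⟨r₁, hr₁, hb₁⟩ := hsV.1 hu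
    obtain ⟨r₂, hr₂, hb₂⟩ := hsV.2 hl
    refine Or.inr (Γ.mem_core_of_sides (i := i) h' (r := min r (min r₁ r₂))
      (lt_min hr (lt_min hr₁ hr₂)) hε (fun x hxE hx => (hb₁ x hxE ?_).2)
      (fun x hxE hx => (hb₂ x hxE ?_).2) (fun x hx hxr => hr3 x hx ?_) (by rwa [union_comm]) hU)
    all_goals simp only [lt_min_iff] at *; tauto

/-- A Baire category argument on the closure of the set `F` of unlabelled points over endpoints.
Restricting `F` to endpoints lets the labels be followed vertically, while taking the closure makes
Baire available. -/
theorem space_inter_eq_empty [Countable ι] (h : Γ.space ∩ (U ∩ V) = ∅)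
    (hX : Γ.space ⊆ U ∪ V) (hU : IsOpen U) (hV : IsOpen V) {δ : ℝ} (hδ : 0 < δ)
    (hδV : ∀ p ∈ Γ.space, p.2 < δ → p ∈ V) : Γ.space ∩ U = ∅ := by
  by_contra hne
  obtain ⟨p, hp, hpU⟩ := nonempty_iff_ne_empty.2 hne
  have hpδ : δ ≤ p.2 := by
    by_contra hlt
    exact h.subset ⟨hp, hpU, hδV p hp (not_le.1 hlt)⟩
  obtain ⟨η, hη, hball⟩ := Metric.isOpen_iff.1 hU p hpU
  have hp01 := hp.2.1
  have hcU : ∀ c, |c - p.1| < η → (c, p.2) ∈ Γ.core U := fun c hc =>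
    Γ.subset_core hU inter_subset_left (hball (by
      rw [Metric.mem_ball, Prod.dist_eq]
      exact max_lt hc (by rwa [dist_self])))
  have hcV : ∀ c, (c, δ / 2) ∈ Γ.core V := fun c =>
    Γ.subset_core (O := {q | q.2 < δ}) (isOpen_lt continuous_snd continuous_const)
      (fun q hq => hδV q hq.2 hq.1) (by simp only [mem_ofPred_eq]; linarith)
  set F : Set (ℝ × ℝ) := {q | q.1 ∈ cantorEndpoints ∧ |q.1 - p.1| < η / 2 ∧
    q.2 ∈ Icc (δ / 2) p.2 ∧ q ∉ Γ.core U ∧ q ∉ Γ.core V} with hFdef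
  -- Over an endpoint near `p.1` the vertical segment begins in the core of `V` and ends in that of
  -- `U`, so some point of it is in neither.
  have hFne : F.Nonempty := by
    obtain ⟨c, hcE, hc⟩ := exists_endpoint_near hp.1 (half_pos hη)
    by_contra hF
    have hcC := cantorEndpoints_subset hcE
    refine Γ.core_disjoint (U := V) (V := U) (by rwa [inter_comm V]) (p := (c, p.2)) hcC hp01 ?_
      (hcU c (hc.trans (half_lt_self hη)))
    refine Γ.fibre_subset_core (U := V) (V := U) (by rwa [inter_comm V]) hcC
      (I := Icc (δ / 2) p.2) isPreconnected_Icc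
      (fun y hy => ⟨by linarith [hy.1], hy.2.trans_lt hp01.2⟩) (fun y hy => ?_)
      ⟨le_rfl, by linarith⟩ (hcV c) _ ⟨by linarith, le_rfl⟩
    by_contra! hn
    exact hF ⟨(c, y), hcE, hc, hy, hn.2, hn.1⟩
  have hsub : closure F ⊆ {q | q.1 ∈ cantorSet ∧ |q.1 - p.1| ≤ η / 2 ∧
      q.2 ∈ Icc (δ / 2) p.2 ∧ q ∉ Γ.core U ∧ q ∉ Γ.core V} := by
    refine closure_minimal
      (fun q hq => ⟨cantorEndpoints_subset hq.1, hq.2.1.le, hq.2.2⟩) ?_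
    refine (isClosed_cantorSet.preimage continuous_fst).inter (IsClosed.inter ?_
      ((isClosed_Icc.preimage continuous_snd).inter
      ((Γ.isOpen_core U).isClosed_compl.inter (Γ.isOpen_core V).isClosed_compl)))
    exact isClosed_le (f := fun q : ℝ × ℝ => |q.1 - p.1|) (by fun_prop) continuous_const
  have hcurve : ∀ q ∈ closure F, ∃ i, q ∈ Γ.curve i := by
    intro q hq
    obtain ⟨h1, h2, h3, h4, h5⟩ := hsub hq
    by_contra! hn
    rcases hX (show q ∈ Γ.space from ⟨h1, ⟨by linarith [h3.1], h3.2.trans_lt hp01.2⟩,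
      fun i hi => absurd hi (hn i)⟩) with h6 | h6
    · exact h4 (Γ.subset_core hU inter_subset_left h6)
    · exact h5 (Γ.subset_core hV inter_subset_left h6)
  have : Nonempty (closure F) := hFne.closure.to_subtype
  have : CompleteSpace (closure F) := isClosed_closure.completeSpace_coe
  obtain ⟨i, ⟨q, hqF⟩, hq⟩ := nonempty_interior_of_iUnion_of_closed
    (f := fun i => ((↑) : closure F → ℝ × ℝ) ⁻¹' Γ.curve i)
    (fun i => (Γ.isClosed_curve i).preimage continuous_subtype_val)
    (eq_univ_of_forall fun q => mem_iUnion.2 (hcurve q q.2))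
  obtain ⟨O', hO', hO'c, hqO'⟩ := (mem_interior (x := (⟨q, hqF⟩ : closure F))).1 hq
  obtain ⟨O, hO, rfl⟩ := isOpen_induced_iff.1 hO'c
  obtain ⟨⟨c, y⟩, hcO, hcF⟩ := mem_closure_iff.1 hqF O hO hqO'
  -- The two extreme heights are labelled, so the point is interior to the window and `F` contains
  -- all unlabelled points over endpoints in a neighbourhood of it inside `O`.
  have hyU : y ≠ p.2 := by
    rintro rfl
    exact hcF.2.2.2.1 (hcU c (hcF.2.1.trans (half_lt_self hη)))
  have hyV : y ≠ δ / 2 := by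
    rintro rfl
    exact hcF.2.2.2.2 (hcV c)
  have hy := hcF.2.2.1
  have hmem : ∀ q ∈ O, q ∈ F → q ∈ Γ.curve i := fun q hq hqF =>
    hO' (show (⟨q, subset_closure hqF⟩ : closure F) ∈ _ from hq)
  have := Γ.mem_core_of_locally_curve (i := i) h hX hU hV hcF.1 (hmem _ hcO hcF)
    (O := O ∩ (Metric.ball p.1 (η / 2) ×ˢ Ioo (δ / 2) p.2))
    (hO.inter (Metric.isOpen_ball.prod isOpen_Ioo))
    ⟨hcO, hcF.2.1, lt_of_le_of_ne hy.1 hyV.symm, lt_of_le_of_ne hy.2 hyU⟩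
    fun q hq hqE h1 h2 => hmem q hq.1 ⟨hqE, hq.2.1, ⟨hq.2.2.1.le, hq.2.2.2.le⟩, h1, h2⟩
  exact this.elim hcF.2.2.2.1 hcF.2.2.2.2

theorem space_nonempty [Countable ι] : Γ.space.Nonempty := by
  obtain ⟨q, hq, -⟩ := Γ.exists_mem_space_endpoint isOpen_univ (p := (0, 1 / 2)) trivial
    zero_mem_cantorSet (by norm_num)
  exact ⟨q, hq.2⟩

theorem isConnected_fan [Countable ι] : IsConnected (fan Γ.space) := by
  refine ⟨⟨_, Or.inr rfl⟩, ?_⟩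
  have key : ∀ U V : Set (ℝ × ℝ), IsOpen U → IsOpen V → fan Γ.space ⊆ U ∪ V →
      fan Γ.space ∩ (U ∩ V) = ∅ → ((1 / 2, 0) : ℝ × ℝ) ∈ V → fan Γ.space ∩ U = ∅ := by
    intro U V hU hV hsub hdisj hap
    have hX : ∀ p ∈ Γ.space, nabla p ∈ fan Γ.space := fun p hp => Or.inl (mem_image_of_mem _ hp)
    -- The fan narrows towards its vertex, so a neighbourhood of the vertex contains all points of
    -- small height.
    obtain ⟨δ, hδ, hball⟩ := Metric.isOpen_iff.1 hV _ hap
    have h1 := Γ.space_inter_eq_empty (U := nabla ⁻¹' U) (V := nabla ⁻¹' V)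
      (eq_empty_of_forall_notMem fun p hp => hdisj.subset ⟨hX p hp.1, hp.2⟩)
      (fun p hp => hsub (hX p hp)) (hU.preimage continuous_nabla) (hV.preimage continuous_nabla)
      hδ fun p hp hpδ => hball ?_
    · refine eq_empty_of_forall_notMem ?_
      rintro q ⟨⟨p, hp, rfl⟩ | hq, hqU⟩
      · exact h1.subset ⟨hp, hqU⟩
      · rw [mem_singleton_iff.1 hq] at hqU
        exact hdisj.subset ⟨Or.inr rfl, hqU, hap⟩
    · have h01 := cantorSet_subset_unitInterval hp.1
      have hy := hp.2.1.1
      rw [Metric.mem_ball, Prod.dist_eq]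
      refine max_lt ?_ ?_
      · rw [Real.dist_eq]
        refine lt_of_le_of_lt (abs_le.2 ?_) hpδ
        simp only [nabla]
        constructor <;> nlinarith [h01.1, h01.2]
      · rw [Real.dist_eq]
        simpa [nabla, abs_of_pos hy] using hpδ
  rintro U V hU hV hsub hUne hVne
  by_contra hne
  have hdisj := not_nonempty_iff_eq_empty.1 hne
  rcases hsub (Or.inr rfl) with hap | hap
  · refine hVne.ne_empty (key V U hV hU (by rwa [union_comm]) (by rwa [inter_comm V]) hap)
  · exact hUne.ne_empty (key U V hU hV hsub hdisj hap)

end CurveSystem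

namespace CurveSystem

variable {ι : Type} (Γ : CurveSystem ι) {i : ι} {c t : ℝ}

/-! #### Splitting the plane along the curves -/

/-- The points of `C × [0,1]`, where each point of a curve is doubled: the `i`-th coordinate of
the second component tells on which side of the `i`-th curve a point lies. -/
def split : Set ((ℝ × ℝ) × (ι → Bool)) :=
  {z | z.1.1 ∈ cantorSet ∧ z.1.2 ∈ Icc 0 1 ∧
    ∀ i, (z.2 i = true → z.1.1 ∈ Γ.dom i ∧ Γ.lo i z.1.1 ≤ z.1.2) ∧
      (z.2 i = false → z.1.1 ∈ Γ.dom i → z.1.2 ≤ Γ.hi i z.1.1)}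

variable {Γ} in
/-- The projection of the split plane. -/
def base (z : Γ.split) : ℝ × ℝ := z.1.1

variable {Γ} in
/-- The side of the `i`-th curve on which a point of the split plane lies. -/
def side (z : Γ.split) (i : ι) : Bool := z.1.2 i

theorem continuous_base : Continuous (base : Γ.split → ℝ × ℝ) := by
  unfold base
  fun_prop

theorem continuous_side (i : ι) : Continuous fun z : Γ.split => side z i := by
  unfold side
  fun_prop

theorem eventually_side_eq (z : Γ.split) (i : ι) : ∀ᶠ w in 𝓝 z, side w i = side z i :=
  (Γ.continuous_side i).continuousAt.eventually_mem
    (show {side z i} ∈ 𝓝 (side z i) from (isOpen_discrete _).mem_nhds rfl)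

theorem isClosed_split : IsClosed Γ.split := by
  have h : Γ.split = (Prod.fst ⁻¹' (cantorSet ×ˢ Icc 0 1)) ∩
      ⋂ i, (({z : (ℝ × ℝ) × (ι → Bool) | z.2 i = false} ∪
          Prod.fst ⁻¹' {p | p.1 ∈ Γ.dom i ∧ Γ.lo i p.1 ≤ p.2}) ∩
        ({z : (ℝ × ℝ) × (ι → Bool) | z.2 i = true} ∪
          Prod.fst ⁻¹' (Prod.fst ⁻¹' (cantorSet \ Γ.dom i) ∪
          {p | p.1 ∈ Γ.dom i ∧ p.2 ≤ Γ.hi i p.1}))) := by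
    ext z
    simp only [split, mem_ofPred_eq, mem_inter_iff, mem_preimage, mem_prod, mem_iInter,
      mem_union, mem_sdiff]
    constructor
    · rintro ⟨h1, h2, h3⟩
      refine ⟨⟨h1, h2⟩, fun i => ?_⟩
      have := h3 i
      cases h : z.2 i <;> by_cases h' : z.1.1 ∈ Γ.dom i <;> simp_all
    · rintro ⟨⟨h1, h2⟩, h3⟩
      refine ⟨h1, h2, fun i => ?_⟩
      have := h3 i
      cases h : z.2 i <;> by_cases h' : z.1.1 ∈ Γ.dom i <;> simp_all
  have hb : ∀ (i : ι) (b : Bool), IsClosed {z : (ℝ × ℝ) × (ι → Bool) | z.2 i = b} := fun i b =>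
    isClosed_eq (by fun_prop) continuous_const
  rw [h]
  refine ((isClosed_cantorSet.prod isClosed_Icc).preimage continuous_fst).inter
    (isClosed_iInter fun i => ((hb i _).union ((Γ.isClosed_above i).preimage continuous_fst)).inter
      ((hb i _).union (IsClosed.preimage continuous_fst
        (((Γ.isClosed_diff_dom i).preimage continuous_fst).union (Γ.isClosed_below i)))))

instance : CompactSpace Γ.split := by
  refine isCompact_iff_compactSpace.1 (IsCompact.of_isClosed_subset
    (s := (cantorSet ×ˢ Icc 0 1) ×ˢ univ) ?_ Γ.isClosed_split fun z hz => ⟨⟨hz.1, hz.2.1⟩, trivial⟩)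
  exact (isCompact_cantorSet.prod isCompact_Icc).prod isCompact_univ

variable {Γ} in
-- One copy certifies that the point is not below the curve, the other that it is not above.
theorem mem_curve_of_side_ne {z w : Γ.split} (h : base z = base w) (hs : side z i ≠ side w i) :
    base z ∈ Γ.curve i := by
  have key : ∀ z w : Γ.split, base z = base w → side z i = true → side w i = false →
      base z ∈ Γ.curve i := by
    intro z w h h1 h2
    have hz := (z.2.2.2 i).1 h1
    have hw := (w.2.2.2 i).2 h2
    change (base z).1 ∈ _ ∧ _ ≤ (base z).2 at hz
    change (base w).1 ∈ _ → (base w).2 ≤ Γ.hi i (base w).1 at hw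
    rw [← h] at hw
    exact ⟨hz.1, hz.2, hw hz.1⟩
  cases hz : side z i <;> cases hw : side w i
  · exact absurd (hz.trans hw.symm) hs
  · rw [h]
    exact key w z h.symm hw hz
  · exact key z w h hz hw
  · exact absurd (hz.trans hw.symm) hs

variable {Γ} in
theorem split_ext {z w : Γ.split} (h : base z = base w) (hs : ∀ i, side z i = side w i) : z = w :=
  Subtype.ext (Prod.ext h (funext hs))

theorem exists_base_eq {p : ℝ × ℝ} (hc : p.1 ∈ cantorSet) (hy : p.2 ∈ Icc 0 1) :
    ∃ z : Γ.split, base z = p := by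
  classical
  refine ⟨⟨(p, fun i => decide (p.1 ∈ Γ.dom i ∧ Γ.lo i p.1 ≤ p.2)), hc, hy, fun i => ?_⟩, rfl⟩
  simp only [decide_eq_true_eq, decide_eq_false_iff_not, imp_self, true_and]
  intro h1 h2
  exact (not_le.1 fun h => h1 ⟨h2, h⟩).le.trans (Γ.lo_le_hi i _ h2)

/-- A point lies on at most one curve, so at most one coordinate of `side` is free. -/
theorem finite_base_fibre (p : ℝ × ℝ) : {z : Γ.split | base z = p}.Finite := by
  by_cases h : ∃ i, p ∈ Γ.curve i
  · obtain ⟨i, hi⟩ := h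
    refine Finite.of_finite_image (f := fun z => side z i) (toFinite _) ?_
    intro z hz w hw hzw
    refine split_ext (hz.trans hw.symm) fun j => ?_
    by_contra hne
    have hj := mem_curve_of_side_ne (hz.trans hw.symm) hne
    rw [show base z = p from hz] at hj
    rw [Γ.eq_of_mem_curve hj hi] at hne
    exact hne hzw
  · refine Set.Subsingleton.finite fun z hz w hw => split_ext (hz.trans hw.symm) fun j => ?_
    by_contra hne
    have hj := mem_curve_of_side_ne (hz.trans hw.symm) hne
    rw [show base z = p from hz] at hj
    exact h ⟨j, hj⟩

/-! #### Cuts -/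

/-- Over each `x ≠ c` some curve passes within |x - c| of height `t`, and it does almost as well on
a neighbourhood, so the choice can be made locally constant. Jumps of a given size occur over
finitely many points only; hence the selected curves converge to `t` as `x` tends to `c`. -/
theorem exists_selector (hc : c ∈ cantorSet) (ht0 : 0 < t) (ht1 : t < 1) :
    ∃ r : ℝ → ι, (∀ x ∈ cantorSet, x ≠ c → ∀ᶠ y in 𝓝[cantorSet] x, y ≠ c ∧ r y = r x) ∧
      ∀ ε > 0, ∀ᶠ x in 𝓝[cantorSet] c, x ≠ c →
        x ∈ Γ.dom (r x) ∧ t - ε < Γ.lo (r x) x ∧ Γ.hi (r x) x < t + ε := by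
  obtain ⟨i₀, -⟩ := Γ.meets c hc 0 1 le_rfl one_pos le_rfl
  have : Nonempty ι := ⟨i₀⟩
  -- The auxiliary `x` is the point at which the curve was found; the factor 2 keeps it close to `c`
  -- whenever `y` is.
  let good : ℝ → ι → Prop := fun y i => y ∈ Γ.dom i ∧ ∃ x ∈ Γ.dom i, x ≠ c ∧
    |x - c| ≤ 2 * |y - c| ∧ t - 2 * |x - c| - (Γ.hi i x - Γ.lo i x) < Γ.lo i y ∧
      Γ.hi i y < t + 2 * |x - c| + (Γ.hi i x - Γ.lo i x)
  obtain ⟨r, hr⟩ := exists_locallyConstant_selection (S := cantorSet \ {c}) sdiff_subset good (by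
    rintro x ⟨hx, hxc⟩
    have hpos : 0 < |x - c| := abs_pos.2 (sub_ne_zero.2 hxc)
    obtain ⟨i, hi, h1, h2⟩ := Γ.meets x hx (max 0 (t - |x - c|)) (min 1 (t + |x - c|))
      (le_max_left _ _)
      (max_lt (lt_min one_pos (by linarith)) (lt_min (by linarith) (by linarith))) (min_le_left _ _)
    have h1' := h1.trans_le (min_le_right _ _)
    have h2' := (le_max_right _ _).trans_lt h2
    refine ⟨i, ?_⟩
    have e1 := nhdsWithin_le_nhds (s := cantorSet) (Γ.eventually_lt_lo i (c := x)
      (y := t - 2 * |x - c| - (Γ.hi i x - Γ.lo i x)) fun _ => by linarith)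
    have e2 := nhdsWithin_le_nhds (s := cantorSet) (Γ.eventually_hi_lt i (c := x)
      (y := t + 2 * |x - c| + (Γ.hi i x - Γ.lo i x)) fun _ => by linarith)
    have e3 := nhdsWithin_le_nhds (s := cantorSet) (Γ.eventually_mem_dom i hi)
    have e4 : ∀ᶠ y in 𝓝[cantorSet] x, |x - c| < 2 * |y - c| := nhdsWithin_le_nhds
      ((isOpen_lt continuous_const (by fun_prop)).mem_nhds
        (show |x - c| < 2 * |x - c| by linarith))
    filter_upwards [e1, e2, e3, e4, self_mem_nhdsWithin] with y h1 h2 h3 h4 h5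
    have hy := h3 h5
    refine ⟨⟨h5, ?_⟩, hy, x, hi, hxc, h4.le, h1 hy, h2 hy⟩
    rintro rfl
    simp at h4
    linarith)
  refine ⟨r, fun x hx hxc => ?_, fun ε hε => ?_⟩
  · filter_upwards [(hr x ⟨hx, hxc⟩).2] with y hy using ⟨hy.1.2, hy.2⟩
  -- The point `c` itself may carry a large jump, so it is removed; the remaining large jumps keep a
  -- positive distance from `c`.
  · have hfin : ({x | ∃ i, x ∈ Γ.dom i ∧ ε / 2 ≤ Γ.hi i x - Γ.lo i x} \ {c}).Finite :=
      (Γ.finite_jumps (ε / 2) (half_pos hε)).sdiff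
    obtain ⟨δ, hδ, hball⟩ := Metric.isOpen_iff.1 hfin.isClosed.isOpen_compl c (fun h => h.2 rfl)
    have e1 : ∀ᶠ x in 𝓝[cantorSet] c, 2 * |x - c| < min δ (ε / 4) := nhdsWithin_le_nhds
      ((isOpen_lt (by fun_prop) continuous_const).mem_nhds
        (show 2 * |c - c| < min δ (ε / 4) by
          rw [sub_self, abs_zero, mul_zero]
          exact lt_min hδ (by linarith)))
    filter_upwards [e1, self_mem_nhdsWithin] with y h1 h2 hyc
    obtain ⟨hy, x, hx, hxc, h3, h4, h5⟩ := (hr y ⟨h2, hyc⟩).1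
    have h6 : |x - c| < δ := by linarith [min_le_left δ (ε / 4)]
    have h7 : |x - c| < ε / 4 := by linarith [min_le_right δ (ε / 4)]
    have h8 : Γ.hi (r y) x - Γ.lo (r y) x < ε / 2 := by
      by_contra hle
      exact hball (show x ∈ Metric.ball c δ from h6) ⟨⟨_, hx, not_lt.1 hle⟩, hxc⟩
    exact ⟨hy, by linarith, by linarith⟩

theorem notMem_frontier_of_eventually {E : Type*} [TopologicalSpace E] {L : Set E} {z : E}
    (h : (∀ᶠ w in 𝓝 z, w ∈ L) ∨ ∀ᶠ w in 𝓝 z, w ∉ L) : z ∉ frontier L := by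
  rcases h with h | h
  · exact fun hz => hz.2 (mem_interior_iff_mem_nhds.2 h)
  · rw [← frontier_compl]
    exact fun hz => hz.2 (mem_interior_iff_mem_nhds.2 h)

theorem tendsto_base_fst (z : Γ.split) :
    Filter.Tendsto (fun w : Γ.split => (base w).1) (𝓝 z) (𝓝[cantorSet] (base z).1) :=
  tendsto_nhdsWithin_iff.2 ⟨(continuous_fst.comp Γ.continuous_base).continuousAt,
    Filter.Eventually.of_forall fun w => w.2.1⟩

/-- Take the points below the selected curve, and below `t` over `c` itself. Away from `c` the
selection is locally constant and sides are clopen. Over `c`, the convergence of the selected curves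
leaves only height `t` undecided. -/
theorem exists_cut (hc : c ∈ cantorSet) (ht0 : 0 < t) (ht1 : t < 1) :
    ∃ L : Set Γ.split, frontier L ⊆ base ⁻¹' {(c, t)} ∧
      ∀ ε > 0, ∀ᶠ x in 𝓝[cantorSet] c, ∀ w : Γ.split, (base w).1 = x →
        (w ∈ L → (base w).2 < t + ε) ∧ (w ∉ L → t - ε < (base w).2) := by
  obtain ⟨r, hr1, hr2⟩ := Γ.exists_selector hc ht0 ht1
  let L : Set Γ.split := {w | ((base w).1 = c ∧ (base w).2 < t) ∨
    ((base w).1 ≠ c ∧ side w (r (base w).1) = false)}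
  have hL : ∀ ε > 0, ∀ᶠ x in 𝓝[cantorSet] c, ∀ w : Γ.split, (base w).1 = x →
      (w ∈ L → (base w).2 < t + ε) ∧ (w ∉ L → t - ε < (base w).2) := by
    intro ε hε
    filter_upwards [hr2 ε hε] with x hx w hw
    by_cases hxc : x = c
    · refine ⟨?_, fun hn => ?_⟩
      · rintro (h | h)
        · linarith [h.2]
        · exact absurd (hw.trans hxc) h.1
      · by_contra hle
        exact hn (Or.inl ⟨hw.trans hxc, by linarith⟩)
    · obtain ⟨h1, h2, h3⟩ := hx hxc
      rw [← hw] at h1 h2 h3 hxc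
      refine ⟨?_, fun hn => ?_⟩
      · rintro (h | h)
        · exact absurd h.1 hxc
        · exact ((w.2.2.2 _).2 h.2 h1).trans_lt h3
      · have : side w (r (base w).1) = true := by
          by_contra hs
          exact hn (Or.inr ⟨hxc, by simpa using hs⟩)
        exact h2.trans_le ((w.2.2.2 _).1 this).2
  refine ⟨L, fun z hz => ?_, hL⟩
  by_contra hne
  refine notMem_frontier_of_eventually ?_ hz
  by_cases hzc : (base z).1 = c
  · have hzt : (base z).2 ≠ t := fun h => hne (Prod.ext hzc h)
    have hpos : 0 < |(base z).2 - t| / 2 := half_pos (abs_pos.2 (sub_ne_zero.2 hzt))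
    have e1 := (Γ.tendsto_base_fst z).eventually (hzc.symm ▸ hL _ hpos)
    have hcont : Continuous fun w : Γ.split => (base w).2 := continuous_snd.comp Γ.continuous_base
    rcases lt_or_gt_of_ne hzt with h | h
    · rw [abs_of_neg (by linarith)] at e1
      left
      filter_upwards [e1, hcont.continuousAt.eventually_lt
        (continuousAt_const (y := ((base z).2 + t) / 2)) (by linarith)] with w h1 h2
      by_contra hw
      linarith [(h1 w rfl).2 hw]
    · rw [abs_of_pos (by linarith)] at e1
      right
      filter_upwards [e1, (continuousAt_const (y := ((base z).2 + t) / 2)).eventually_lt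
        hcont.continuousAt (by linarith)] with w h1 h2 hw
      linarith [(h1 w rfl).1 hw]
  · have e1 := (Γ.tendsto_base_fst z).eventually (hr1 _ z.2.1 hzc)
    have e2 := Γ.eventually_side_eq z (r (base z).1)
    cases hs : side z (r (base z).1)
    · left
      filter_upwards [e1, e2] with w h1 h2
      exact Or.inr ⟨h1.1, by rw [h1.2, h2, hs]⟩
    · right
      filter_upwards [e1, e2] with w h1 h2
      rintro (h | h)
      · exact h1.1 h.1
      · rw [h1.2, h2, hs] at h
        exact absurd h.2 (by simp)

/-- Sets of the split plane whose frontier lies over finitely many points outside the space. -/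
def Thin (L : Set Γ.split) : Prop :=
  ∃ T : Set (ℝ × ℝ), T.Finite ∧ (∀ p ∈ T, 0 < p.2 ∧ p ∉ Γ.space) ∧ frontier L ⊆ base ⁻¹' T

variable {Γ} {L L' : Set Γ.split}

theorem Thin.mono (h : Γ.Thin L) (hL : frontier L' ⊆ frontier L) : Γ.Thin L' := by
  obtain ⟨T, h1, h2, h3⟩ := h
  exact ⟨T, h1, h2, hL.trans h3⟩

theorem thin_of_frontier_subset (h : Γ.Thin L) (h' : Γ.Thin L') {A : Set Γ.split}
    (hA : frontier A ⊆ frontier L ∪ frontier L') : Γ.Thin A := by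
  obtain ⟨T, h1, h2, h3⟩ := h
  obtain ⟨T', h1', h2', h3'⟩ := h'
  exact ⟨T ∪ T', h1.union h1', fun p hp => hp.elim (h2 p) (h2' p),
    hA.trans (union_subset_union h3 h3')⟩

theorem Thin.inter (h : Γ.Thin L) (h' : Γ.Thin L') : Γ.Thin (L ∩ L') :=
  thin_of_frontier_subset h h' ((frontier_inter_subset _ _).trans
    (union_subset_union inter_subset_left inter_subset_right))

theorem Thin.union (h : Γ.Thin L) (h' : Γ.Thin L') : Γ.Thin (L ∪ L') :=
  thin_of_frontier_subset h h' ((frontier_union_subset _ _).trans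
    (union_subset_union inter_subset_left inter_subset_right))

theorem thin_of_isClopen (h : IsClopen L) : Γ.Thin L :=
  ⟨∅, finite_empty, by simp, by rw [h.frontier_eq]; exact empty_subset _⟩

variable (Γ)

/-- The space contains no vertical interval, so cuts can be placed at points off the space
arbitrarily close to any height. -/
theorem exists_notMem_space {u v : ℝ} (huv : u < v) : ∃ y ∈ Ioo u v, (c, y) ∉ Γ.space := by
  by_contra! h
  obtain ⟨w, hw⟩ := exists_between huv
  obtain ⟨w', hw'⟩ := exists_between hw.2
  have hsub : (fun y : ℝ => (c, y)) '' Ioo u v ⊆ Γ.space := by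
    rintro _ ⟨y, hy, rfl⟩
    exact h y hy
  have := Γ.isTotallyDisconnected_space _ hsub
    (isPreconnected_Ioo.image _ (by fun_prop)) (mem_image_of_mem _ (show w ∈ _ from hw))
    (mem_image_of_mem _ (show w' ∈ _ from ⟨hw.1.trans hw'.1, hw'.2⟩))
  exact hw'.1.ne (congrArg Prod.snd this)

theorem exists_lower_cut (z : Γ.split) {ε : ℝ} (hε : 0 < ε) :
    ∃ L : Set Γ.split, Γ.Thin L ∧ (∀ᶠ w in 𝓝 z, w ∈ L) ∧
      ∀ᶠ x in 𝓝[cantorSet] (base z).1, ∀ w ∈ L, (base w).1 = x → (base z).2 - ε < (base w).2 := by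
  have hz := z.2.2.1
  rcases eq_or_lt_of_le hz.1 with h0 | h0
  · refine ⟨univ, thin_of_isClopen isClopen_univ, Filter.Eventually.of_forall fun _ => trivial,
      Filter.Eventually.of_forall fun x w _ _ => ?_⟩
    have := w.2.2.1.1
    change (0 : ℝ) = (base z).2 at h0
    change (0 : ℝ) ≤ (base w).2 at this
    linarith
  · change (0 : ℝ) < (base z).2 at h0
    obtain ⟨t, ht, htX⟩ := Γ.exists_notMem_space (c := (base z).1)
      (u := max 0 ((base z).2 - ε)) (v := (base z).2) (max_lt h0 (by linarith))
    rw [mem_Ioo, max_lt_iff] at ht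
    obtain ⟨L, hL, hLε⟩ := Γ.exists_cut z.2.1 ht.1.1 (ht.2.trans_le hz.2)
    refine ⟨Lᶜ, ⟨{((base z).1, t)}, finite_singleton _, ?_, by rwa [frontier_compl]⟩, ?_, ?_⟩
    · rintro p rfl
      exact ⟨ht.1.1, htX⟩
    · have hcont : Continuous fun w : Γ.split => (base w).2 :=
        continuous_snd.comp Γ.continuous_base
      filter_upwards [(Γ.tendsto_base_fst z).eventually (hLε (((base z).2 - t) / 2) (by linarith)),
        (continuousAt_const (y := ((base z).2 + t) / 2)).eventually_lt hcont.continuousAt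
          (by linarith)] with w h1 h2 hw
      linarith [(h1 w rfl).1 hw]
    · filter_upwards [hLε (t - ((base z).2 - ε)) (by linarith)] with x hx w hw hwx
      linarith [(hx w hwx).2 hw]

theorem exists_upper_cut (z : Γ.split) {ε : ℝ} (hε : 0 < ε) :
    ∃ L : Set Γ.split, Γ.Thin L ∧ (∀ᶠ w in 𝓝 z, w ∈ L) ∧
      ∀ᶠ x in 𝓝[cantorSet] (base z).1, ∀ w ∈ L, (base w).1 = x → (base w).2 < (base z).2 + ε := by
  have hz := z.2.2.1
  rcases eq_or_lt_of_le hz.2 with h0 | h0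
  · refine ⟨univ, thin_of_isClopen isClopen_univ, Filter.Eventually.of_forall fun _ => trivial,
      Filter.Eventually.of_forall fun x w _ _ => ?_⟩
    have := w.2.2.1.2
    change (base z).2 = (1 : ℝ) at h0
    change (base w).2 ≤ (1 : ℝ) at this
    linarith
  · change (base z).2 < (1 : ℝ) at h0
    obtain ⟨t, ht, htX⟩ := Γ.exists_notMem_space (c := (base z).1)
      (u := (base z).2) (v := min 1 ((base z).2 + ε)) (lt_min h0 (by linarith))
    rw [mem_Ioo, lt_min_iff] at ht
    have ht0 : 0 < t := lt_of_le_of_lt hz.1 ht.1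
    obtain ⟨L, hL, hLε⟩ := Γ.exists_cut z.2.1 ht0 ht.2.1
    refine ⟨L, ⟨{((base z).1, t)}, finite_singleton _, ?_, hL⟩, ?_, ?_⟩
    · rintro p rfl
      exact ⟨ht0, htX⟩
    · have hcont : Continuous fun w : Γ.split => (base w).2 :=
        continuous_snd.comp Γ.continuous_base
      filter_upwards [(Γ.tendsto_base_fst z).eventually (hLε ((t - (base z).2) / 2) (by linarith)),
        hcont.continuousAt.eventually_lt (continuousAt_const (y := ((base z).2 + t) / 2))
          (by linarith)] with w h1 h2
      by_contra hw
      linarith [(h1 w rfl).2 hw]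
    · filter_upwards [hLε ((base z).2 + ε - t) (by linarith)] with x hx w hw hwx
      linarith [(hx w hwx).1 hw]

/-- A block of the Cantor set and finitely many sides are clopen conditions; only the height has to
be bounded by cuts, one on each side. -/
theorem exists_thin_nhds (z : Γ.split) {O : Set Γ.split} (hO : IsOpen O) (hz : z ∈ O) :
    ∃ U ⊆ O, IsOpen U ∧ z ∈ U ∧ Γ.Thin U := by
  obtain ⟨O', hO', rfl⟩ := isOpen_induced_iff.1 hO
  obtain ⟨P, Q, hP, hQ, hzP, hzQ, hPQ⟩ := isOpen_prod_iff.1 hO' z.1.1 z.1.2 hz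
  obtain ⟨I, u, hu, huQ⟩ := isOpen_pi_iff.1 hQ z.1.2 hzQ
  obtain ⟨ε, hε, hball⟩ := Metric.isOpen_iff.1 hP _ hzP
  obtain ⟨L₁, hL₁, hz₁, he₁⟩ := Γ.exists_lower_cut z hε
  obtain ⟨L₂, hL₂, hz₂, he₂⟩ := Γ.exists_upper_cut z hε
  have he₃ : ∀ᶠ x in 𝓝[cantorSet] (base z).1, x ∈ Metric.ball (base z).1 ε :=
    nhdsWithin_le_nhds (Metric.ball_mem_nhds _ hε)
  obtain ⟨δ, hδ, hev⟩ := Metric.mem_nhdsWithin_iff.1 (he₁.and (he₂.and he₃))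
  obtain ⟨n, hn⟩ := exists_block_subset z.2.1 hδ
  set B := cantorBlock (initialWord (address z.1.1.1) n)
  have hBcl : IsClopen ((fun w : Γ.split => (base w).1) ⁻¹' B) := by
    have hcont : Continuous fun w : Γ.split => (base w).1 :=
      continuous_fst.comp Γ.continuous_base
    refine ⟨(isClosed_cantorBlock _).preimage hcont, ?_⟩
    have : (fun w : Γ.split => (base w).1) ⁻¹' B = (fun w => (base w).1) ⁻¹' (cantorSet \ B)ᶜ := by
      ext w
      simp only [mem_preimage, mem_compl_iff, mem_sdiff, not_and, not_not]
      exact ⟨fun h _ => h, fun h => h w.2.1⟩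
    rw [this]
    exact (isClosed_cantorSet_diff_block _).isOpen_compl.preimage hcont
  have hScl : IsClopen {w : Γ.split | ∀ i ∈ I, side w i = side z i} := by
    have : {w : Γ.split | ∀ i ∈ I, side w i = side z i} =
        ⋂ i ∈ I, (fun w : Γ.split => side w i) ⁻¹' {side z i} := by
      ext w
      simp
    rw [this]
    exact isClopen_biInter_finset fun i _ => (isClopen_discrete _).preimage (Γ.continuous_side i)
  set A := (fun w : Γ.split => (base w).1) ⁻¹' B ∩
    {w : Γ.split | ∀ i ∈ I, side w i = side z i} ∩ (L₁ ∩ L₂)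
  refine ⟨interior A, ?_, isOpen_interior, ?_, ?_⟩
  · refine interior_subset.trans ?_
    rintro w ⟨⟨hwB, hws⟩, hw1, hw2⟩
    refine hPQ ⟨hball ?_, huQ fun i hi => ?_⟩
    · have := hev ⟨hn _ hwB, w.2.1⟩
      rw [Metric.mem_ball, Prod.dist_eq]
      refine max_lt this.2.2 ?_
      rw [Real.dist_eq, abs_lt]
      have h1 := this.1 w hw1 rfl
      have h2 := this.2.1 w hw2 rfl
      change -ε < (base w).2 - (base z).2 ∧ (base w).2 - (base z).2 < ε
      exact ⟨by linarith, by linarith⟩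
    · have : w.1.2 i = z.1.2 i := hws i hi
      rw [this]
      exact (hu i hi).2
  · rw [mem_interior_iff_mem_nhds]
    refine Filter.inter_mem (Filter.inter_mem (hBcl.2.mem_nhds (mem_cantorBlock_address z.2.1 n))
      (hScl.2.mem_nhds fun _ _ => rfl)) (Filter.inter_mem hz₁ hz₂)
  · exact (((thin_of_isClopen hBcl).inter (thin_of_isClopen hScl)).inter
      (hL₁.inter hL₂)).mono frontier_interior_subset

theorem exists_thin_of_isCompact {K O : Set Γ.split} (hK : IsCompact K) (hO : IsOpen O)
    (hKO : K ⊆ O) : ∃ U ⊆ O, IsOpen U ∧ K ⊆ U ∧ Γ.Thin U := by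
  refine hK.induction_on (p := fun K => ∃ U ⊆ O, IsOpen U ∧ K ⊆ U ∧ Γ.Thin U) ?_ ?_ ?_ ?_
  · exact ⟨∅, empty_subset _, isOpen_empty, subset_rfl, thin_of_isClopen isClopen_empty⟩
  · rintro s t hst ⟨U, h1, h2, h3, h4⟩
    exact ⟨U, h1, h2, hst.trans h3, h4⟩
  · rintro s t ⟨U, h1, h2, h3, h4⟩ ⟨U', h1', h2', h3', h4'⟩
    exact ⟨U ∪ U', union_subset h1 h1', h2.union h2', union_subset_union h3 h3', h4.union h4'⟩
  · intro z hz
    obtain ⟨U, h1, h2, h3, h4⟩ := Γ.exists_thin_nhds z hO (hKO hz)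
    exact ⟨U, mem_nhdsWithin_of_mem_nhds (h2.mem_nhds h3), U, h1, h2, subset_rfl, h4⟩

end CurveSystem

/-! ### Images under closed maps -/

theorem preimage_kernImage_subset {Z T : Type*} {f : Z → T} {A : Set T} {U : Set Z}
    (hA : A ⊆ range f) {O : Set T} (h : U ⊆ f ⁻¹' O) :
    ((↑) : A → T) ⁻¹' kernImage f U ⊆ (↑) ⁻¹' O := by
  intro b hb
  obtain ⟨z, hz⟩ := hA b.2
  have := h (hb hz)
  rwa [mem_preimage, hz] at this

section ClosedMap

variable {Z T : Type*} [TopologicalSpace Z] [TopologicalSpace T] {f : Z → T} {A : Set T}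
  {U : Set Z}

theorem IsClosedMap.isOpen_preimage_kernImage (hf : IsClosedMap f) (hU : IsOpen U) :
    IsOpen (((↑) : A → T) ⁻¹' kernImage f U) :=
  (isClosedMap_iff_kernImage.1 hf hU).preimage continuous_subtype_val

/-- Closedness of the map makes the image of `closure U` closed and the kernel image of `U` open,
and a frontier point belongs to the first but not to the second. -/
theorem IsClosedMap.frontier_preimage_kernImage (hf : IsClosedMap f) (hA : A ⊆ range f)
    (hU : IsOpen U) {a : A} (ha : a ∈ frontier (((↑) : A → T) ⁻¹' kernImage f U)) :
    (∃ z ∈ closure U, f z = a) ∧ ∃ z ∉ U, f z = a := by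
  constructor
  · have h1 : ((↑) : A → T) ⁻¹' kernImage f U ⊆ (↑) ⁻¹' (f '' closure U) := by
      intro b hb
      obtain ⟨z, hz⟩ := hA b.2
      exact ⟨z, subset_closure (hb hz), hz⟩
    have h2 : IsClosed (((↑) : A → T) ⁻¹' (f '' closure U)) :=
      (hf _ isClosed_closure).preimage continuous_subtype_val
    obtain ⟨z, hz, hza⟩ := closure_minimal h1 h2 ha.1
    exact ⟨z, hz, hza⟩
  · have h := ha.2
    rw [(hf.isOpen_preimage_kernImage hU).interior_eq] at h
    by_contra! hcon
    exact h fun z hz => by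
      by_contra hn
      exact hcon z hn hz

end ClosedMap

theorem rimDiscrete_of_nhds {E : Type*} [TopologicalSpace E]
    (h : ∀ (a : E) (O : Set E), a ∈ O → IsOpen O →
      ∃ V, IsOpen V ∧ a ∈ V ∧ V ⊆ O ∧ DiscreteTopology (frontier V)) : RimDiscrete E := by
  refine ⟨{V | IsOpen V ∧ DiscreteTopology (frontier V)},
    isTopologicalBasis_of_isOpen_of_nhds (fun V hV => hV.1) fun a O ha hO => ?_, fun V hV => hV.2⟩
  obtain ⟨V, h1, h2, h3, h4⟩ := h a O ha hO
  exact ⟨V, ⟨h1, h4⟩, h2, h3⟩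

theorem rationalSpace_of_nhds {E : Type*} [TopologicalSpace E]
    (h : ∀ (a : E) (O : Set E), a ∈ O → IsOpen O →
      ∃ V, IsOpen V ∧ a ∈ V ∧ V ⊆ O ∧ (frontier V).Countable) : RationalSpace E := by
  refine ⟨{V | IsOpen V ∧ (frontier V).Countable},
    isTopologicalBasis_of_isOpen_of_nhds (fun V hV => hV.1) fun a O ha hO => ?_, fun V hV => hV.2⟩
  obtain ⟨V, h1, h2, h3, h4⟩ := h a O ha hO
  exact ⟨V, ⟨h1, h4⟩, h2, h3⟩

theorem discreteTopology_of_isolated {E : Type*} [TopologicalSpace E] {S : Set E}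
    (h : ∀ a ∈ S, ∃ O, IsOpen O ∧ a ∈ O ∧ ∀ b ∈ O, b ∈ S → b = a) : DiscreteTopology S := by
  refine discreteTopology_iff_isOpen_singleton.2 fun a => ?_
  obtain ⟨O, hO, ha, hO'⟩ := h a a.2
  refine isOpen_induced_iff.2 ⟨O, hO, ?_⟩
  ext b
  constructor
  · intro hb
    exact Subtype.ext (hO' b hb b.2)
  · rintro rfl
    exact ha

/-- The boundary of a preimage embeds into the boundary. -/
theorem Topology.IsEmbedding.rimDiscrete {E F : Type*} [TopologicalSpace E] [TopologicalSpace F]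
    {φ : E → F} (hφ : IsEmbedding φ) (h : RimDiscrete F) : RimDiscrete E := by
  obtain ⟨𝓑, hB, hd⟩ := h
  refine ⟨preimage φ '' 𝓑, hB.isInducing hφ.isInducing, ?_⟩
  rintro _ ⟨U, hU, rfl⟩
  have := hd U hU
  have hsub := hφ.continuous.frontier_preimage_subset U
  let ψ : frontier (φ ⁻¹' U) → frontier U := fun x => ⟨φ x, hsub x.2⟩
  have hψ : IsEmbedding ψ := by
    have h1 : IsEmbedding (Subtype.val ∘ ψ) := hφ.comp IsEmbedding.subtypeVal
    exact .of_comp (by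
      have := hφ.continuous
      fun_prop) continuous_subtype_val h1
  exact hψ.discreteTopology

namespace CurveSystem

variable {ι : Type} (Γ : CurveSystem ι)

/-! #### Rim-discreteness -/

/-- The separated copies of `p` differ only in the side of the curve `j` through `p`, and `p` is the
midpoint of a jump of `j`. As `U` has no frontier over `p`, membership in `U` near the fibre is
decided by the side of `j` alone. A nearby point of the space with separated copies thus lies on
curve `j` at a height interior to the same jump, so it is the same midpoint. -/
theorem eq_of_split {U : Set Γ.split} (hU : IsOpen U) (hth : Γ.Thin U) {p : ℝ × ℝ}
    (hp : p ∈ Γ.space) {z z' : Γ.split} (hz : base z = p) (hz' : base z' = p) (hzU : z ∈ U)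
    (hzU' : z' ∉ U) :
    ∃ O : Set (ℝ × ℝ), IsOpen O ∧ p ∈ O ∧ ∀ q ∈ O, q ∈ Γ.space →
      ∀ w w' : Γ.split, base w = q → base w' = q → w ∈ U → w' ∉ U → q = p := by
  have hex : ∀ {w w' : Γ.split}, base w = base w' → w ∈ U → w' ∉ U →
      ∃ j, side w j ≠ side w' j := by
    intro w w' h h1 h2
    by_contra! hs
    exact h2 (split_ext h hs ▸ h1)
  obtain ⟨T, -, hT, hfr⟩ := hth
  obtain ⟨j, hj⟩ := hex (hz.trans hz'.symm) hzU hzU'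
  have hpj : p ∈ Γ.curve j := hz ▸ mem_curve_of_side_ne (hz.trans hz'.symm) hj
  have hm := hp.2.2 j hpj
  have huniq : ∀ {w w' : Γ.split}, base w = p → base w' = p → side w j = side w' j → w = w' := by
    intro w w' h h' hs
    refine split_ext (h.trans h'.symm) fun k => ?_
    by_contra hne
    have := mem_curve_of_side_ne (h.trans h'.symm) hne
    rw [h] at this
    rw [Γ.eq_of_mem_curve this hpj] at hne
    exact hne hs
  have hclosed : IsClosedMap (base : Γ.split → ℝ × ℝ) := Γ.continuous_base.isClosedMap
  have hev := hclosed.eventually_nhds_fiber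
    (p := fun w => w ∈ U ↔ ∃ v, base v = p ∧ side v j = side w j ∧ v ∈ U) p (by
      intro w hw
      have hwp : base w = p := hw
      have hwfr : w ∉ frontier U := fun h => (hT _ (hfr h)).2 (hwp ▸ hp)
      have hiff : (∃ v, base v = p ∧ side v j = side w j ∧ v ∈ U) ↔ w ∈ U :=
        ⟨fun ⟨v, h1, h2, h3⟩ => huniq h1 hwp h2 ▸ h3, fun h => ⟨w, hwp, rfl, h⟩⟩
      have e1 := Γ.eventually_side_eq w j
      by_cases hwU : w ∈ U
      · filter_upwards [e1, hU.mem_nhds hwU] with x h1 h2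
        rw [h1, hiff]
        exact iff_of_true h2 hwU
      · have : w ∈ (closure U)ᶜ := fun h => hwfr ⟨h, fun h' => hwU (interior_subset h')⟩
        filter_upwards [e1, isClosed_closure.isOpen_compl.mem_nhds this] with x h1 h2
        rw [h1, hiff]
        exact iff_of_false (fun h => h2 (subset_closure h)) hwU)
  have hwin : ∀ᶠ q : ℝ × ℝ in 𝓝 p, q.2 ∈ Ioo (Γ.lo j p.1) (Γ.hi j p.1) := by
    refine continuous_snd.continuousAt.eventually_mem (Ioo_mem_nhds ?_ ?_)
    · rw [hm.2.2]
      exact Γ.lo_lt_mid j _ hm.1 hm.2.1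
    · rw [hm.2.2]
      exact Γ.mid_lt_hi j _ hm.1 hm.2.1
  obtain ⟨O, hO', hO, hpO⟩ := eventually_nhds_iff.1 (hev.and hwin)
  refine ⟨O, hO, hpO, fun q hq hqX w w' hw hw' hwU hwU' => ?_⟩
  obtain ⟨k, hk⟩ := hex (hw.trans hw'.symm) hwU hwU'
  have hqk : q ∈ Γ.curve k := hw ▸ mem_curve_of_side_ne (hw.trans hw'.symm) hk
  by_cases hkj : k = j
  · subst hkj
    have h1 := Γ.fst_eq_of_mem_Ioo hm.1 hqk (hO' q hq).2
    refine Prod.ext h1 ?_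
    rw [(hqX.2.2 k hqk).2.2, hm.2.2, h1]
  · exfalso
    have hs : side w j = side w' j := by
      by_contra hne
      exact hkj (Γ.eq_of_mem_curve hqk (hw ▸ mem_curve_of_side_ne (hw.trans hw'.symm) hne))
    have h1 := (hO' q hq).1 w hw
    have h2 := (hO' q hq).1 w' hw'
    rw [hs] at h1
    exact hwU' (h2.2 (h1.1 hwU))

theorem continuous_nabla_base : Continuous fun z : Γ.split => nabla (base z) :=
  continuous_nabla.comp Γ.continuous_base

theorem nabla_mem_fan {p : ℝ × ℝ} (hp : p ∈ Γ.space) : nabla p ∈ fan Γ.space :=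
  Or.inl (mem_image_of_mem _ hp)

theorem apex_mem_fan : ((1 / 2, 0) : ℝ × ℝ) ∈ fan Γ.space := Or.inr rfl

theorem fan_subset_range : fan Γ.space ⊆ range fun z : Γ.split => nabla (base z) := by
  rintro a (⟨p, hp, rfl⟩ | ha)
  · obtain ⟨z, hz⟩ := Γ.exists_base_eq hp.1 (Ioo_subset_Icc_self hp.2.1)
    exact ⟨z, congrArg nabla hz⟩
  · obtain ⟨z, hz⟩ := Γ.exists_base_eq (p := (0, 0)) zero_mem_cantorSet (by norm_num)
    refine ⟨z, ?_⟩
    rw [mem_singleton_iff.1 ha]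
    simp [hz, nabla]

theorem eq_of_nabla_eq {p q : ℝ × ℝ} (h : nabla p = nabla q) (hq : q.2 ≠ 0) : p = q := by
  have hp : p.2 ≠ 0 := by
    have h2 := congrArg Prod.snd h
    exact fun h0 => hq (h2.symm.trans h0)
  rw [← unfan_nabla hp, h, unfan_nabla hq]

theorem discrete_frontier_fan {U : Set Γ.split} (hU : IsOpen U) (hth : Γ.Thin U)
    (hap : ∀ a : fan Γ.space, (a : ℝ × ℝ).2 = 0 →
      a ∉ frontier (((↑) : fan Γ.space → ℝ × ℝ) ⁻¹' kernImage (fun z => nabla (base z)) U)) :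
    DiscreteTopology (frontier (((↑) : fan Γ.space → ℝ × ℝ) ⁻¹'
      kernImage (fun z => nabla (base z)) U)) := by
  have hcl : IsClosedMap fun z : Γ.split => nabla (base z) := Γ.continuous_nabla_base.isClosedMap
  have key : ∀ a ∈ frontier (((↑) : fan Γ.space → ℝ × ℝ) ⁻¹'
      kernImage (fun z => nabla (base z)) U), ∃ p ∈ Γ.space, nabla p = a ∧
        ∃ z z' : Γ.split, base z = p ∧ base z' = p ∧ z ∈ U ∧ z' ∉ U := by
    intro a ha
    obtain ⟨⟨z, hz, hza⟩, z', hz', hza'⟩ :=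
      hcl.frontier_preimage_kernImage Γ.fan_subset_range hU ha
    obtain ⟨p, hp, hpa⟩ | ha0 := a.2
    · have hz1 : base z = p := eq_of_nabla_eq (hza.trans hpa.symm) hp.2.1.1.ne'
      have hz2 : base z' = p := eq_of_nabla_eq (hza'.trans hpa.symm) hp.2.1.1.ne'
      refine ⟨p, hp, hpa, z, z', hz1, hz2, ?_, hz'⟩
      -- The frontier of `U` avoids the points over the space, so a copy in the closure of `U` is
      -- already in `U`.
      obtain ⟨T, -, hT, hfr⟩ := hth
      by_contra hzU
      exact (hT _ (hfr ⟨hz, fun h => hzU (interior_subset h)⟩)).2 (hz1 ▸ hp)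
    · exact absurd ha (hap a (congrArg Prod.snd (mem_singleton_iff.1 ha0)))
  refine discreteTopology_of_isolated fun a ha => ?_
  obtain ⟨p, hp, hpa, z, z', h1, h2, h3, h4⟩ := key a ha
  obtain ⟨O, hO, hpO, hO'⟩ := Γ.eq_of_split hU hth hp h1 h2 h3 h4
  refine ⟨(↑) ⁻¹' ({q : ℝ × ℝ | q.2 ≠ 0} ∩ unfan ⁻¹' O), (continuousOn_unfan.isOpen_inter_preimage
    isOpen_snd_ne_zero hO).preimage continuous_subtype_val, ?_, ?_⟩
  · rw [mem_preimage, ← hpa]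
    refine ⟨hp.2.1.1.ne', ?_⟩
    rwa [mem_preimage, unfan_nabla hp.2.1.1.ne']
  · rintro b hb hbf
    obtain ⟨q, hq, hqb, w, w', g1, g2, g3, g4⟩ := key b hbf
    rw [mem_preimage, ← hqb] at hb
    have hqO := hb.2
    rw [mem_preimage, unfan_nabla hq.2.1.1.ne'] at hqO
    have := hO' q hqO hq w w' g1 g2 g3 g4
    exact Subtype.ext (by rw [← hqb, ← hpa, this])

/-- The vertex has to be kept off the boundary. A neighbourhood of the vertex contains it in its
interior, and other neighbourhoods are confined to heights above half that of the given point. -/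
theorem rimDiscrete_fan : RimDiscrete (fan Γ.space) := by
  refine rimDiscrete_of_nhds fun a O haO hO => ?_
  obtain ⟨O', hO', rfl⟩ := isOpen_induced_iff.1 hO
  have hcl : IsClosedMap fun z : Γ.split => nabla (base z) := Γ.continuous_nabla_base.isClosedMap
  by_cases ha : (a : ℝ × ℝ).2 = 0
  · obtain ⟨U, hUO, hU, haU, hth⟩ := Γ.exists_thin_of_isCompact
      (K := (fun z => nabla (base z)) ⁻¹' {(a : ℝ × ℝ)})
      (isClosed_singleton.preimage Γ.continuous_nabla_base).isCompact
      (hO'.preimage Γ.continuous_nabla_base) (preimage_mono (singleton_subset_iff.2 haO))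
    have hVo := hcl.isOpen_preimage_kernImage (A := fan Γ.space) hU
    refine ⟨_, hVo, fun z hz => haU hz, preimage_kernImage_subset Γ.fan_subset_range hUO,
      Γ.discrete_frontier_fan hU hth fun b hb hbf => ?_⟩
    have hba : b = a := by
      have h0 : ∀ b : fan Γ.space, (b : ℝ × ℝ).2 = 0 → (b : ℝ × ℝ) = (1 / 2, 0) := by
        rintro ⟨b, ⟨p, hp, rfl⟩ | hb⟩ h
        · exact absurd h hp.2.1.1.ne'
        · exact hb
      exact Subtype.ext ((h0 b hb).trans (h0 a ha).symm)
    subst hba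
    exact hbf.2 (mem_interior_iff_mem_nhds.2 (hVo.mem_nhds fun z hz => haU hz))
  · have ha0 : 0 < (a : ℝ × ℝ).2 := by
      obtain ⟨p, hp, hpa⟩ | h := a.2
      · rw [← hpa]
        exact hp.2.1.1
      · exact absurd (congrArg Prod.snd (mem_singleton_iff.1 h)) ha
    have hO₂ : IsOpen (O' ∩ {q : ℝ × ℝ | (a : ℝ × ℝ).2 / 2 < q.2}) :=
      hO'.inter (isOpen_lt continuous_const continuous_snd)
    obtain ⟨U, hUO, hU, haU, hth⟩ := Γ.exists_thin_of_isCompact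
      (K := (fun z => nabla (base z)) ⁻¹' {(a : ℝ × ℝ)})
      (isClosed_singleton.preimage Γ.continuous_nabla_base).isCompact
      (hO₂.preimage Γ.continuous_nabla_base)
      (preimage_mono (singleton_subset_iff.2 ⟨haO, half_lt_self ha0⟩))
    have hVs := preimage_kernImage_subset Γ.fan_subset_range hUO
    refine ⟨_, hcl.isOpen_preimage_kernImage hU, fun z hz => haU hz,
      hVs.trans fun b hb => hb.1, Γ.discrete_frontier_fan hU hth fun b hb hbf => ?_⟩
    have h1 : b ∈ ((↑) : fan Γ.space → ℝ × ℝ) ⁻¹' {q : ℝ × ℝ | (a : ℝ × ℝ).2 / 2 ≤ q.2} :=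
      closure_minimal (fun b hb => (hVs hb).2.le)
        ((isClosed_le continuous_const continuous_snd).preimage continuous_subtype_val) hbf.1
    simp only [mem_preimage, mem_ofPred_eq] at h1
    linarith

end CurveSystem

namespace CurveSystem

variable {ι : Type} (Γ : CurveSystem ι) {i j : ι} {p : ℝ × ℝ}

/-! #### The quotient continuum -/

/-- The end points of the jumps of the `i`-th curve and its points without a jump. -/
def edges (i : ι) : Set (ℝ × ℝ) :=
  {p | p.1 ∈ Γ.dom i ∧ (p.2 = Γ.lo i p.1 ∨ p.2 = Γ.hi i p.1)}

variable {Γ}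

theorem mem_curve_of_mem_edges (hp : p ∈ Γ.edges i) : p ∈ Γ.curve i := by
  have := Γ.lo_le_hi i _ hp.1
  rcases hp.2 with h | h
  · exact ⟨hp.1, h.ge, h.le.trans this⟩
  · exact ⟨hp.1, this.trans h.ge, h.le⟩

theorem notMem_mids_of_mem_edges (hp : p ∈ Γ.edges i) : p ∉ Γ.mids j := by
  intro hj
  obtain rfl := Γ.eq_of_mem_curve (mem_curve_of_mem_edges hp) (Γ.mids_subset_curve j hj)
  have h1 := Γ.lo_lt_mid i _ hp.1 hj.2.1
  have h2 := Γ.mid_lt_hi i _ hp.1 hj.2.1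
  rw [← hj.2.2] at h1 h2
  rcases hp.2 with h | h
  · exact h1.ne' h
  · exact h2.ne h

theorem snd_pos_of_mem_curve (hp : p ∈ Γ.curve i) : 0 < p.2 :=
  (Γ.lo_pos i _ hp.1).trans_le hp.2.1

variable (Γ)

/-- On a curve, the heights interior to some jump are attained in that jump only. Removing these
open slabs from the closed curve leaves the edges. -/
theorem isClosed_edges (i : ι) : IsClosed (Γ.edges i) := by
  have : Γ.edges i = Γ.curve i \ ⋃ c ∈ Γ.dom i, Prod.snd ⁻¹' Ioo (Γ.lo i c) (Γ.hi i c) := by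
    ext p
    constructor
    · intro hp
      have hc := mem_curve_of_mem_edges hp
      refine ⟨hc, fun hn => ?_⟩
      simp only [mem_iUnion] at hn
      obtain ⟨c, hcd, hpc⟩ := hn
      obtain rfl := Γ.fst_eq_of_mem_Ioo hcd hc hpc
      rcases hp.2 with h | h
      · exact hpc.1.ne' h
      · exact hpc.2.ne h
    · rintro ⟨hc, hn⟩
      refine ⟨hc.1, ?_⟩
      by_contra! hcon
      exact hn (mem_biUnion hc.1 ⟨lt_of_le_of_ne hc.2.1 hcon.1.symm, lt_of_le_of_ne hc.2.2 hcon.2⟩)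
  rw [this]
  exact (Γ.isClosed_curve i).sdiff
    (isOpen_biUnion fun c _ => isOpen_Ioo.preimage continuous_snd)

/-- Glue the bottom edge to a point, the edges of each curve to a point, and the two copies of
the midpoint of each jump. -/
def Glued (z w : Γ.split) : Prop :=
  z = w ∨ ((base z).2 = 0 ∧ (base w).2 = 0) ∨ (∃ i, base z ∈ Γ.edges i ∧ base w ∈ Γ.edges i) ∨
    (base z = base w ∧ ∃ i, base z ∈ Γ.mids i)

/-- The kinds of gluing do not interact: curves are disjoint and lie above the bottom, and an edge
is never a midpoint. -/
theorem glued_equivalence : Equivalence Γ.Glued := by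
  refine ⟨fun z => Or.inl rfl, ?_, ?_⟩
  · rintro z w (rfl | ⟨h1, h2⟩ | ⟨i, h1, h2⟩ | ⟨h1, i, h2⟩)
    · exact Or.inl rfl
    · exact Or.inr (Or.inl ⟨h2, h1⟩)
    · exact Or.inr (Or.inr (Or.inl ⟨i, h2, h1⟩))
    · exact Or.inr (Or.inr (Or.inr ⟨h1.symm, i, h1 ▸ h2⟩))
  · rintro x y z (rfl | ⟨h1, h2⟩ | ⟨i, h1, h2⟩ | ⟨h1, i, h2⟩) hyz
    · exact hyz
    · rcases hyz with rfl | ⟨h3, h4⟩ | ⟨j, h3, h4⟩ | ⟨h3, j, h4⟩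
      · exact Or.inr (Or.inl ⟨h1, h2⟩)
      · exact Or.inr (Or.inl ⟨h1, h4⟩)
      · exact absurd h2 (snd_pos_of_mem_curve (mem_curve_of_mem_edges h3)).ne'
      · exact absurd h2 (snd_pos_of_mem_curve (Γ.mids_subset_curve j h4)).ne'
    · rcases hyz with rfl | ⟨h3, h4⟩ | ⟨j, h3, h4⟩ | ⟨h3, j, h4⟩
      · exact Or.inr (Or.inr (Or.inl ⟨i, h1, h2⟩))
      · exact absurd h3 (snd_pos_of_mem_curve (mem_curve_of_mem_edges h2)).ne'
      · obtain rfl := Γ.eq_of_mem_curve (mem_curve_of_mem_edges h2) (mem_curve_of_mem_edges h3)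
        exact Or.inr (Or.inr (Or.inl ⟨i, h1, h4⟩))
      · exact absurd h4 (notMem_mids_of_mem_edges h2)
    · have h2' : base y ∈ Γ.mids i := h1 ▸ h2
      rcases hyz with rfl | ⟨h3, h4⟩ | ⟨j, h3, h4⟩ | ⟨h3, j, h4⟩
      · exact Or.inr (Or.inr (Or.inr ⟨h1, i, h2⟩))
      · exact absurd h3 (snd_pos_of_mem_curve (Γ.mids_subset_curve i h2')).ne'
      · exact absurd h2' (notMem_mids_of_mem_edges h3)
      · exact Or.inr (Or.inr (Or.inr ⟨h1.trans h3, i, h2⟩))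

/-- Each single curve gives a closed condition, so the task is to exclude all but finitely many
curves near an unglued pair. If the base points differ, small curves cannot join them. If they
agree, the pair sits on opposite sides of a curve `j`, interior to one of its jumps, while almost
every other curve has both its ends on one side of `j`. -/
theorem isClosed_glued : IsClosed {x : Γ.split × Γ.split | Γ.Glued x.1 x.2} := by
  rw [← isOpen_compl_iff, isOpen_iff_mem_nhds]
  rintro ⟨z, w⟩ hzw
  simp only [mem_compl_iff, mem_ofPred_eq, Glued, not_or] at hzw
  obtain ⟨hne, h0, he, hm⟩ := hzw
  have hb1 : Continuous fun x : Γ.split × Γ.split => base x.1 :=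
    Γ.continuous_base.comp continuous_fst
  have hb2 : Continuous fun x : Γ.split × Γ.split => base x.2 :=
    Γ.continuous_base.comp continuous_snd
  have e1 : ∀ᶠ x : Γ.split × Γ.split in 𝓝 (z, w), x.1 ≠ x.2 :=
    (isOpen_ne_fun continuous_fst continuous_snd).mem_nhds hne
  have e2 : ∀ᶠ x : Γ.split × Γ.split in 𝓝 (z, w), ¬ ((base x.1).2 = 0 ∧ (base x.2).2 = 0) := by
    have : IsClosed {x : Γ.split × Γ.split | (base x.1).2 = 0 ∧ (base x.2).2 = 0} :=
      (isClosed_eq (continuous_snd.comp hb1) continuous_const).inter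
        (isClosed_eq (continuous_snd.comp hb2) continuous_const)
    exact this.isOpen_compl.mem_nhds h0
  have e3 : ∀ i, ∀ᶠ x : Γ.split × Γ.split in 𝓝 (z, w),
      ¬ (base x.1 ∈ Γ.edges i ∧ base x.2 ∈ Γ.edges i) := by
    intro i
    have : IsClosed {x : Γ.split × Γ.split | base x.1 ∈ Γ.edges i ∧ base x.2 ∈ Γ.edges i} :=
      ((Γ.isClosed_edges i).preimage hb1).inter ((Γ.isClosed_edges i).preimage hb2)
    exact this.isOpen_compl.mem_nhds fun h => he ⟨i, h⟩
  suffices h : ∃ N : Set ι, N.Finite ∧ ∀ᶠ x : Γ.split × Γ.split in 𝓝 (z, w),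
      (∀ i ∉ N, ¬ (base x.1 ∈ Γ.edges i ∧ base x.2 ∈ Γ.edges i)) ∧
      ¬ (base x.1 = base x.2 ∧ ∃ i, base x.1 ∈ Γ.mids i) by
    obtain ⟨N, hN, h⟩ := h
    filter_upwards [e1, e2, (Filter.eventually_all_finite hN).2 fun i _ => e3 i, h]
      with x h1 h2 h3 h4
    rintro (h | h | ⟨i, h⟩ | h)
    · exact h1 h
    · exact h2 h
    · by_cases hi : i ∈ N
      · exact h3 i hi h
      · exact h4.1 i hi h
    · exact h4.2 h
  by_cases hzw : base z = base w
  · obtain ⟨j, hj⟩ : ∃ j, side z j ≠ side w j := by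
      by_contra! hs
      exact hne (split_ext hzw hs)
    have hcj := mem_curve_of_side_ne hzw hj
    have s1 : ∀ᶠ x : Γ.split × Γ.split in 𝓝 (z, w), side x.1 j = side z j :=
      (continuous_fst.tendsto (z, w)).eventually (Γ.eventually_side_eq z j)
    have s2 : ∀ᶠ x : Γ.split × Γ.split in 𝓝 (z, w), side x.2 j = side w j :=
      (continuous_snd.tendsto (z, w)).eventually (Γ.eventually_side_eq w j)
    have hlo : Γ.lo j (base z).1 < (base z).2 := lt_of_le_of_ne hcj.2.1 fun h =>
      he ⟨j, ⟨hcj.1, Or.inl h.symm⟩, hzw ▸ ⟨hcj.1, Or.inl h.symm⟩⟩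
    have hhi : (base z).2 < Γ.hi j (base z).1 := lt_of_le_of_ne hcj.2.2 fun h =>
      he ⟨j, ⟨hcj.1, Or.inr h⟩, hzw ▸ ⟨hcj.1, Or.inr h⟩⟩
    have hmid : (base z).2 ≠ Γ.mid j (base z).1 := fun h =>
      hm ⟨hzw, j, hcj.1, hlo.trans hhi, h⟩
    -- Inside this height window, away from the middle, curve `j` has no midpoints; this excludes
    -- the gluing of midpoint copies nearby.
    have s3 : ∀ᶠ x : Γ.split × Γ.split in 𝓝 (z, w),
        (base x.1).2 ∈ Ioo (Γ.lo j (base z).1) (Γ.hi j (base z).1) \ {Γ.mid j (base z).1} :=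
      (continuous_snd.comp hb1).continuousAt.eventually_mem
        ((isOpen_Ioo.sdiff isClosed_singleton).mem_nhds ⟨⟨hlo, hhi⟩, hmid⟩)
    refine ⟨_, Γ.one_side j, ?_⟩
    filter_upwards [s1, s2, s3] with x h1 h2 h3
    have hs : side x.1 j ≠ side x.2 j := by rwa [h1, h2]
    constructor
    · rintro i hi ⟨g1, g2⟩
      simp only [not_not] at hi
      have c1 := mem_curve_of_mem_edges g1
      have c2 := mem_curve_of_mem_edges g2
      rcases hi with h | h
      · have key : ∀ v : Γ.split, base v ∈ Γ.curve i → side v j = true := by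
          intro v hv
          by_contra hn
          have := (v.2.2.2 j).2 (Bool.eq_false_of_not_eq_true hn) (h _ hv.1).1
          change (base v).2 ≤ Γ.hi j (base v).1 at this
          linarith [(h _ hv.1).2, hv.2.1]
        exact hs ((key _ c1).trans (key _ c2).symm)
      · have key : ∀ v : Γ.split, base v ∈ Γ.curve i → side v j = false := by
          intro v hv
          by_contra hn
          have := (v.2.2.2 j).1 (Bool.eq_true_of_not_eq_false hn)
          change (base v).1 ∈ Γ.dom j ∧ Γ.lo j (base v).1 ≤ (base v).2 at this
          linarith [h _ hv.1 this.1, hv.2.2]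
        exact hs ((key _ c1).trans (key _ c2).symm)
    · rintro ⟨hx, i, hi⟩
      have hxj := mem_curve_of_side_ne hx hs
      obtain rfl := Γ.eq_of_mem_curve hxj (Γ.mids_subset_curve i hi)
      have := Γ.fst_eq_of_mem_Ioo hcj.1 hxj h3.1
      exact h3.2 (this ▸ hi.2.2)
  · have hδ : 0 < dist (base z) (base w) := dist_pos.2 hzw
    refine ⟨_, Γ.small (dist (base z) (base w) / 2) (half_pos hδ), ?_⟩
    have s1 : ∀ᶠ x : Γ.split × Γ.split in 𝓝 (z, w),
        dist (base z) (base w) / 2 < dist (base x.1) (base x.2) :=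
      (isOpen_lt continuous_const (hb1.dist hb2)).mem_nhds (half_lt_self hδ)
    filter_upwards [s1] with x h1
    constructor
    · rintro i hi ⟨g1, g2⟩
      simp only [not_not] at hi
      have c1 := mem_curve_of_mem_edges g1
      have c2 := mem_curve_of_mem_edges g2
      refine h1.not_ge ?_
      rw [Prod.dist_eq, Real.dist_eq, Real.dist_eq]
      have k1 := hi _ c1.1 _ c2.1
      have k2 := hi _ c2.1 _ c1.1
      refine max_le k1.1.le (abs_le.2 ⟨?_, ?_⟩)
      · linarith [c1.2.1, c2.2.2]
      · linarith [c1.2.2, c2.2.1]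
    · rintro ⟨hx, -⟩
      rw [hx, dist_self] at h1
      linarith

/-- The gluing relation as a setoid. -/
def glue : Setoid Γ.split := ⟨Γ.Glued, Γ.glued_equivalence⟩

/-- The quotient of the split plane. -/
def Quot : Type := Quotient Γ.glue

instance : TopologicalSpace Γ.Quot := inferInstanceAs (TopologicalSpace (Quotient Γ.glue))

/-- The quotient map. -/
def proj (z : Γ.split) : Γ.Quot := Quotient.mk Γ.glue z

theorem proj_eq_iff {z w : Γ.split} : Γ.proj z = Γ.proj w ↔ Γ.Glued z w :=
  Quotient.eq (r := Γ.glue)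

theorem isQuotientMap_proj : IsQuotientMap Γ.proj := isQuotientMap_quotient_mk'

theorem surjective_proj : Function.Surjective Γ.proj := Γ.isQuotientMap_proj.surjective

/-- The saturation of a closed set is the projection of a closed part of the compact relation. -/
theorem isClosedMap_proj : IsClosedMap Γ.proj := by
  intro S hS
  rw [← Γ.isQuotientMap_proj.isClosed_preimage]
  have : Γ.proj ⁻¹' (Γ.proj '' S) =
      Prod.snd '' ({x : Γ.split × Γ.split | Γ.Glued x.1 x.2} ∩ Prod.fst ⁻¹' S) := by
    ext w
    constructor
    · rintro ⟨z, hz, hzw⟩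
      exact ⟨(z, w), ⟨Γ.proj_eq_iff.1 hzw, hz⟩, rfl⟩
    · rintro ⟨⟨z, w'⟩, ⟨h, hz⟩, rfl⟩
      exact ⟨z, hz, Γ.proj_eq_iff.2 h⟩
  rw [this]
  exact ((Γ.isClosed_glued.inter (hS.preimage continuous_fst)).isCompact.image
    continuous_snd).isClosed

instance : CompactSpace Γ.Quot :=
  ⟨Γ.surjective_proj.range_eq ▸ isCompact_range Γ.isQuotientMap_proj.continuous⟩

theorem isClosed_fibre (k : Γ.Quot) : IsClosed (Γ.proj ⁻¹' {k}) := by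
  obtain ⟨z, rfl⟩ := Γ.surjective_proj k
  have := Γ.isClosedMap_proj {z} isClosed_singleton
  rw [image_singleton] at this
  exact this.preimage Γ.isQuotientMap_proj.continuous

instance : T2Space Γ.Quot := by
  refine ⟨fun k l hkl => ?_⟩
  obtain ⟨U, V, hU, hV, hkU, hlV, hUV⟩ := normal_separation (Γ.isClosed_fibre k)
    (Γ.isClosed_fibre l) (Disjoint.preimage _ (disjoint_singleton.2 hkl))
  refine ⟨kernImage Γ.proj U, kernImage Γ.proj V, isClosedMap_iff_kernImage.1 Γ.isClosedMap_proj hU,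
    isClosedMap_iff_kernImage.1 Γ.isClosedMap_proj hV, fun z hz => hkU hz, fun z hz => hlV hz, ?_⟩
  refine Set.disjoint_left.2 fun m h1 h2 => ?_
  obtain ⟨z, rfl⟩ := Γ.surjective_proj m
  exact Set.disjoint_left.1 hUV (h1 rfl) (h2 rfl)

/-- Fibres are compact, so kernel images of finite unions from a countable basis suffice. -/
instance [Countable ι] : SecondCountableTopology Γ.Quot := by
  let b := countableBasis Γ.split
  have hb : IsTopologicalBasis b := isBasis_countableBasis _
  have hbc : b.Countable := countable_countableBasis _
  refine IsTopologicalBasis.secondCountableTopology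
    (b := (fun F => kernImage Γ.proj (⋃₀ F)) '' {F | F.Finite ∧ F ⊆ b}) ?_
    ((countable_ofPred_finite_subset hbc).image _)
  refine isTopologicalBasis_of_isOpen_of_nhds ?_ fun k O hk hO => ?_
  · rintro _ ⟨F, ⟨-, hF⟩, rfl⟩
    exact isClosedMap_iff_kernImage.1 Γ.isClosedMap_proj
      (isOpen_sUnion fun s hs => hb.isOpen (hF hs))
  · have hO' := hO.preimage Γ.isQuotientMap_proj.continuous
    obtain ⟨F, hF1, hF2, hF3, hF4⟩ : ∃ F, F.Finite ∧ F ⊆ b ∧ Γ.proj ⁻¹' {k} ⊆ ⋃₀ F ∧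
        ⋃₀ F ⊆ Γ.proj ⁻¹' O := by
      refine (Γ.isClosed_fibre k).isCompact.induction_on
        (p := fun S => ∃ F, F.Finite ∧ F ⊆ b ∧ S ⊆ ⋃₀ F ∧ ⋃₀ F ⊆ Γ.proj ⁻¹' O) ?_ ?_ ?_ ?_
      · exact ⟨∅, finite_empty, empty_subset _, by simp, by simp⟩
      · rintro s t hst ⟨F, h1, h2, h3, h4⟩
        exact ⟨F, h1, h2, hst.trans h3, h4⟩
      · rintro s t ⟨F, h1, h2, h3, h4⟩ ⟨F', h1', h2', h3', h4'⟩
        refine ⟨F ∪ F', h1.union h1', union_subset h2 h2', ?_, ?_⟩ <;> rw [sUnion_union]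
        · exact union_subset_union h3 h3'
        · exact union_subset h4 h4'
      · intro z hz
        have hzO : z ∈ Γ.proj ⁻¹' O := by
          rw [mem_preimage, show Γ.proj z = k from hz]
          exact hk
        obtain ⟨s, hs, hzs, hsO⟩ := hb.exists_subset_of_mem_open hzO hO'
        exact ⟨s, mem_nhdsWithin_of_mem_nhds ((hb.isOpen hs).mem_nhds hzs), {s},
          finite_singleton _, singleton_subset_iff.2 hs, by simp, by simpa using hsO⟩
    refine ⟨_, ⟨F, ⟨hF1, hF2⟩, rfl⟩, fun z hz => hF3 hz, fun m hm => ?_⟩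
    obtain ⟨z, rfl⟩ := Γ.surjective_proj m
    exact hF4 (hm rfl)

theorem countable_mids (i : ι) : (Γ.mids i).Countable := by
  have hc : (⋃ n : ℕ, {c | ∃ i, c ∈ Γ.dom i ∧ 1 / ((n : ℝ) + 1) ≤ Γ.hi i c - Γ.lo i c}).Countable :=
    countable_iUnion fun n => (Γ.finite_jumps _ (by positivity)).countable
  refine (hc.image fun c => (c, Γ.mid i c)).mono fun p hp => ?_
  obtain ⟨n, hn⟩ := exists_nat_one_div_lt (sub_pos.2 hp.2.1)
  exact ⟨p.1, mem_iUnion.2 ⟨n, i, hp.1, hn.le⟩, Prod.ext rfl hp.2.2.symm⟩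

theorem countable_base_preimage {T : Set (ℝ × ℝ)} (hT : T.Countable) :
    ((base : Γ.split → ℝ × ℝ) ⁻¹' T).Countable := by
  refine (hT.biUnion fun p _ => (Γ.finite_base_fibre p).countable).mono fun z hz => ?_
  exact mem_biUnion hz rfl

/-- The points of the quotient that come from several points of the split plane. -/
theorem countable_multiple [Countable ι] :
    {k | ∃ z w, z ≠ w ∧ Γ.proj z = k ∧ Γ.proj w = k}.Countable := by
  have h1 : (Γ.proj '' {z | (base z).2 = 0}).Subsingleton := by
    rintro _ ⟨z, hz, rfl⟩ _ ⟨w, hw, rfl⟩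
    exact Γ.proj_eq_iff.2 (Or.inr (Or.inl ⟨hz, hw⟩))
  have h2 : ∀ i, (Γ.proj '' (base ⁻¹' Γ.edges i)).Subsingleton := by
    rintro i _ ⟨z, hz, rfl⟩ _ ⟨w, hw, rfl⟩
    exact Γ.proj_eq_iff.2 (Or.inr (Or.inr (Or.inl ⟨i, hz, hw⟩)))
  have h3 : ∀ i, (Γ.proj '' (base ⁻¹' Γ.mids i)).Countable := fun i =>
    (Γ.countable_base_preimage (Γ.countable_mids i)).image _
  refine ((h1.finite.countable.union (countable_iUnion fun i => (h2 i).finite.countable)).union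
    (countable_iUnion h3)).mono ?_
  rintro k ⟨z, w, hne, rfl, hw⟩
  rcases Γ.proj_eq_iff.1 hw.symm with h | h | ⟨i, h⟩ | ⟨-, i, h⟩
  · exact absurd h hne
  · exact Or.inl (Or.inl (mem_image_of_mem _ h.1))
  · exact Or.inl (Or.inr (mem_iUnion.2 ⟨i, mem_image_of_mem _ h.1⟩))
  · exact Or.inr (mem_iUnion.2 ⟨i, mem_image_of_mem _ h⟩)

/-- A boundary point either comes from the frontier of a thin set, which is countable since base
fibres are finite, or has two different preimages. -/
theorem rationalSpace_subset [Countable ι] (A : Set Γ.Quot) : RationalSpace A := by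
  have hA : A ⊆ range Γ.proj := by
    rw [Γ.surjective_proj.range_eq]
    exact subset_univ _
  refine rationalSpace_of_nhds fun a O haO hO => ?_
  obtain ⟨O', hO', rfl⟩ := isOpen_induced_iff.1 hO
  obtain ⟨U, hUO, hU, haU, T, hT, -, hfr⟩ := Γ.exists_thin_of_isCompact
    (Γ.isClosed_fibre a).isCompact (hO'.preimage Γ.isQuotientMap_proj.continuous)
    (preimage_mono (singleton_subset_iff.2 haO))
  refine ⟨_, Γ.isClosedMap_proj.isOpen_preimage_kernImage hU, fun z hz => haU hz,
    preimage_kernImage_subset hA hUO, ?_⟩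
  refine (((Γ.countable_base_preimage hT.countable).image Γ.proj).union
    Γ.countable_multiple).preimage_of_injOn (f := ((↑) : A → Γ.Quot))
    Subtype.val_injective.injOn |>.mono fun b hb => ?_
  obtain ⟨⟨z, hz, hzb⟩, w, hw, hwb⟩ := Γ.isClosedMap_proj.frontier_preimage_kernImage hA hU hb
  by_cases hzw : z = w
  · subst hzw
    exact Or.inl ⟨z, hfr ⟨hz, fun h => hw (interior_subset h)⟩, hzb⟩
  · exact Or.inr ⟨z, w, hzw, hzb, hwb⟩

/-- Two copies of a point of the space differ along a curve through it, so the point is a midpoint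
and its copies are glued. With `nabla_eq_of_glued` this shows that both maps out of `split` have the
same fibres over the fan. -/
theorem glued_of_nabla_eq {z w : Γ.split} (h : nabla (base z) = nabla (base w))
    (hw : nabla (base w) ∈ fan Γ.space) : Γ.Glued z w := by
  obtain ⟨p, hp, hpw⟩ | h0 := hw
  · have h1 : base w = p := eq_of_nabla_eq hpw.symm hp.2.1.1.ne'
    have h2 : base z = p := eq_of_nabla_eq (h.trans hpw.symm) hp.2.1.1.ne'
    by_cases hzw : z = w
    · exact Or.inl hzw
    · obtain ⟨j, hj⟩ : ∃ j, side z j ≠ side w j := by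
        by_contra! hs
        exact hzw (split_ext (h2.trans h1.symm) hs)
      have hcj := mem_curve_of_side_ne (h2.trans h1.symm) hj
      rw [h2] at hcj
      exact Or.inr (Or.inr (Or.inr ⟨h2.trans h1.symm, j, h2.symm ▸ hp.2.2 j hcj⟩))
  · have h1 := congrArg Prod.snd (mem_singleton_iff.1 h0)
    have h2 := congrArg Prod.snd h
    exact Or.inr (Or.inl ⟨h2.trans h1, h1⟩)

theorem nabla_eq_of_glued {z w : Γ.split} (h : Γ.Glued z w)
    (hw : nabla (base w) ∈ fan Γ.space) : nabla (base z) = nabla (base w) := by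
  rcases h with rfl | ⟨h1, h2⟩ | ⟨i, h1, h2⟩ | ⟨h, -⟩
  · rfl
  · simp [nabla, h1, h2]
  · exfalso
    have hpos := snd_pos_of_mem_curve (mem_curve_of_mem_edges h2)
    obtain ⟨p, hp, hpw⟩ | h0 := hw
    · have h3 : base w = p := eq_of_nabla_eq hpw.symm hp.2.1.1.ne'
      rw [h3] at h2
      exact notMem_mids_of_mem_edges h2 (hp.2.2 i (mem_curve_of_mem_edges h2))
    · exact hpos.ne' (congrArg Prod.snd (mem_singleton_iff.1 h0))
  · rw [h]

/-- Two continuous closed maps on `split` with the same fibres over the fan induce a homeomorphism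
of the fan onto its image. -/
theorem exists_embedding : ∃ φ : fan Γ.space → Γ.Quot, IsEmbedding φ := by
  choose s hs using Γ.fan_subset_range
  let φ : fan Γ.space → Γ.Quot := fun a => Γ.proj (s a.2)
  have hφ : ∀ (z : Γ.split) (a : fan Γ.space), Γ.proj z = φ a ↔ nabla (base z) = a := by
    intro z a
    have ha : nabla (base (s a.2)) = a := hs a.2
    have ham : nabla (base (s a.2)) ∈ fan Γ.space := by
      rw [ha]
      exact a.2
    rw [Γ.proj_eq_iff]
    exact ⟨fun h => (Γ.nabla_eq_of_glued h ham).trans ha,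
      fun h => Γ.glued_of_nabla_eq (h.trans ha.symm) ham⟩
  have hcl : IsClosedMap fun z : Γ.split => nabla (base z) := Γ.continuous_nabla_base.isClosedMap
  have hcont : Continuous φ := by
    refine continuous_iff_isClosed.2 fun B hB => ?_
    have : φ ⁻¹' B = (↑) ⁻¹' ((fun z : Γ.split => nabla (base z)) '' (Γ.proj ⁻¹' B)) := by
      ext a
      constructor
      · intro ha
        exact ⟨s a.2, ha, hs a.2⟩
      · rintro ⟨z, hz, hza⟩
        rwa [mem_preimage, (hφ z a).2 hza] at hz
    rw [this]
    exact (hcl _ (hB.preimage Γ.isQuotientMap_proj.continuous)).preimage continuous_subtype_val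
  refine ⟨φ, ⟨?_, ?_⟩⟩
  · rw [isInducing_iff]
    refine le_antisymm hcont.le_induced ?_
    rw [← isOpen_implies_isOpen_iff]
    intro O hO
    obtain ⟨O', hO', rfl⟩ := isOpen_induced_iff.1 hO
    refine isOpen_induced_iff.2 ⟨(Γ.proj '' ((fun z : Γ.split => nabla (base z)) ⁻¹' O'ᶜ))ᶜ,
      (Γ.isClosedMap_proj _
        (hO'.isClosed_compl.preimage Γ.continuous_nabla_base)).isOpen_compl, ?_⟩
    ext a
    simp only [mem_preimage, mem_compl_iff]
    constructor
    · intro h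
      by_contra hn
      refine h ⟨s a.2, ?_, rfl⟩
      have ha : nabla (base (s a.2)) = a := hs a.2
      rwa [mem_preimage, ha]
    · rintro h ⟨z, hz, hza⟩
      have := (hφ z a).1 hza
      rw [mem_preimage, this] at hz
      exact hz h
  · intro a b hab
    have h := (hφ (s a.2) b).1 hab
    exact Subtype.ext ((hs a.2).symm.trans h)

/-- The closure of the image inherits connectedness from the fan, and every subspace of the quotient
is rational. -/
theorem embedsInRationalContinuum_fan [Countable ι] : EmbedsInRationalContinuum (fan Γ.space) := by
  obtain ⟨φ, hφ⟩ := Γ.exists_embedding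
  have hconn : ConnectedSpace (fan Γ.space) := isConnected_iff_connectedSpace.1 Γ.isConnected_fan
  have hc : IsConnected (closure (range φ)) := (isConnected_range hφ.continuous).closure
  let ψ : fan Γ.space → closure (range φ) := fun a => ⟨φ a, subset_closure (mem_range_self a)⟩
  have hψ : IsEmbedding ψ := hφ.codRestrict _ _
  refine ⟨closure (range φ), inferInstance, ⟨isConnected_iff_connectedSpace.1 hc,
    isCompact_iff_compactSpace.1 isClosed_closure.isCompact, inferInstance, ?_⟩,
    Γ.rationalSpace_subset _, ψ, hψ⟩
  obtain ⟨p, hp⟩ := Γ.space_nonempty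
  refine ⟨ψ ⟨_, Γ.nabla_mem_fan hp⟩, ψ ⟨_, Γ.apex_mem_fan⟩, fun h => ?_⟩
  have := congrArg Subtype.val (hψ.injective h)
  exact hp.2.1.1.ne' (congrArg Prod.snd this)

end CurveSystem

/-! ### The curve system of a tiling sequence -/

theorem leftEnd_initialWord_false (m : ℕ) : leftEnd (initialWord (fun _ => false) m) = 0 := by
  simp [leftEnd_initialWord]

theorem rightEnd_initialWord_true (m : ℕ) : rightEnd (initialWord (fun _ => true) m) = 1 := by
  rw [rightEnd, leftEnd_initialWord]
  induction m with
  | zero => simp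
  | succ m ih =>
    have : (2 : ℝ) * 1 / 3 ^ (m + 1) + 1 / 3 ^ (m + 1) = 1 / 3 ^ m := by
      rw [pow_succ]
      field_simp
      norm_num
    rw [Finset.sum_range_succ]
    simp only [if_true] at ih ⊢
    linarith

/-- Padding the word with constant digits does not move the endpoint, so it may be assumed to come
from a word that extends σ. -/
theorem blockCoord_mem_cantorEndpoints {n : ℕ} {σ : Fin n → Bool} {x : ℝ}
    (hx : x ∈ cantorEndpoints) (hσ : x ∈ cantorBlock σ) : blockCoord σ x ∈ cantorEndpoints := by
  obtain ⟨k, τ, h⟩ := hx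
  have hword : ∀ b : Bool, ∃ s : ℕ → Bool, initialWord s k = τ ∧
      (fun i => s (k + i)) = fun _ => b :=
    fun b => ⟨fun i => if h : i < k then τ ⟨i, h⟩ else b, by funext i; simp [initialWord],
      by funext i; simp⟩
  rcases h with h | h
  · obtain ⟨s, rfl, hs⟩ := hword false
    have h1 : x = leftEnd (initialWord s (k + n)) := by
      rw [leftEnd_initialWord_add, hs, leftEnd_initialWord_false, h]
      simp
    have h2 : x ∈ cantorBlock (initialWord s (k + n)) := h1 ▸ leftEnd_mem_cantorBlock _
    obtain rfl := eq_initialWord (Nat.le_add_left n k) h2 hσ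
    rw [h1, add_comm k n, blockCoord_leftEnd]
    exact ⟨_, _, Or.inl rfl⟩
  · obtain ⟨s, rfl, hs⟩ := hword true
    have h1 : x = rightEnd (initialWord s (k + n)) := by
      rw [rightEnd_initialWord_add, hs, rightEnd_initialWord_true, h]
      rfl
    have h2 : x ∈ cantorBlock (initialWord s (k + n)) := h1 ▸ rightEnd_mem_cantorBlock _
    obtain rfl := eq_initialWord (Nat.le_add_left n k) h2 hσ
    rw [h1, add_comm k n, blockCoord_rightEnd]
    exact ⟨_, _, Or.inr rfl⟩

/-- The second coordinate of `squeeze`. -/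
noncomputable def squeezeHeight (r : ℝ) : ℝ := 1 / Real.pi * Real.arctan r + 1 / 2

theorem continuous_squeezeHeight : Continuous squeezeHeight := by
  unfold squeezeHeight
  fun_prop

theorem strictMono_squeezeHeight : StrictMono squeezeHeight := by
  intro a b h
  have := Real.pi_pos
  have := Real.arctan_strictMono h
  unfold squeezeHeight
  gcongr

theorem squeezeHeight_mem_Ioo (r : ℝ) : squeezeHeight r ∈ Ioo 0 1 := by
  have hpi := Real.pi_pos
  have h1 := Real.neg_pi_div_two_lt_arctan r
  have h2 := Real.arctan_lt_pi_div_two r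
  have e : squeezeHeight r = Real.arctan r / Real.pi + 1 / 2 := by unfold squeezeHeight; ring
  have h3 : -(1 / 2) < Real.arctan r / Real.pi := by rw [lt_div_iff₀ hpi]; linarith
  have h4 : Real.arctan r / Real.pi < 1 / 2 := by rw [div_lt_iff₀ hpi]; linarith
  rw [e]
  constructor <;> linarith

/-- The inverse of `squeezeHeight`. -/
noncomputable def unsqueezeHeight (y : ℝ) : ℝ := Real.tan (Real.pi * (y - 1 / 2))

theorem unsqueezeHeight_squeezeHeight (r : ℝ) : unsqueezeHeight (squeezeHeight r) = r := by
  have hpi := Real.pi_ne_zero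
  unfold unsqueezeHeight squeezeHeight
  rw [show Real.pi * (1 / Real.pi * Real.arctan r + 1 / 2 - 1 / 2) = Real.arctan r by
    field_simp; ring, Real.tan_arctan]

theorem mul_sub_half_mem {y : ℝ} (hy : y ∈ Ioo (0 : ℝ) 1) :
    Real.pi * (y - 1 / 2) ∈ Ioo (-(Real.pi / 2)) (Real.pi / 2) := by
  have hpi := Real.pi_pos
  constructor <;> nlinarith [hy.1, hy.2]

theorem squeezeHeight_unsqueezeHeight {y : ℝ} (hy : y ∈ Ioo (0 : ℝ) 1) :
    squeezeHeight (unsqueezeHeight y) = y := by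
  have hpi := Real.pi_ne_zero
  have h := mul_sub_half_mem hy
  unfold squeezeHeight unsqueezeHeight
  rw [Real.arctan_tan h.1 h.2]
  field_simp
  ring

theorem continuousOn_unsqueezeHeight : ContinuousOn unsqueezeHeight (Ioo 0 1) :=
  Real.continuousOn_tan_Ioo.comp (by fun_prop) fun _ hy => mul_sub_half_mem hy

/-- The derivative is at most 1/π, so heights and jumps only shrink. -/
theorem squeezeHeight_sub_le {a b : ℝ} (h : a ≤ b) :
    squeezeHeight b - squeezeHeight a ≤ b - a := by
  have hd : ∀ t, HasDerivAt (fun t => t - squeezeHeight t)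
      (1 - 1 / Real.pi * (1 / (1 + t ^ 2))) t := fun t =>
    (hasDerivAt_id t).sub (((Real.hasDerivAt_arctan t).const_mul _).add_const _)
  have hm : Monotone fun t => t - squeezeHeight t := by
    refine monotone_of_deriv_nonneg (fun t => (hd t).differentiableAt) fun t => ?_
    rw [(hd t).deriv, sub_nonneg]
    have h1 : 1 / Real.pi ≤ 1 := by
      rw [div_le_one Real.pi_pos]
      linarith [Real.pi_gt_three]
    have h2 : 1 / (1 + t ^ 2) ≤ 1 := by
      rw [div_le_one (by positivity)]
      linarith [sq_nonneg t]
    exact mul_le_one₀ h1 (by positivity) h2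
  have := hm h
  simp only at this
  linarith

/-- The second coordinate may leave (0,1), where the inverse of the squeeze is not available; hence
the condition is tested against all levels `t`. -/
theorem isClosed_squeezeHeight_le {S : Set ℝ} {g : ℝ → ℝ} (hS : IsClosed S)
    (h : IsClosed {p : ℝ × ℝ | p.1 ∈ S ∧ g p.1 ≤ p.2}) :
    IsClosed {p : ℝ × ℝ | p.1 ∈ S ∧ squeezeHeight (g p.1) ≤ p.2} := by
  have : {p : ℝ × ℝ | p.1 ∈ S ∧ squeezeHeight (g p.1) ≤ p.2} = (Prod.fst ⁻¹' S) ∩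
      ⋂ t : ℝ, ({p : ℝ × ℝ | squeezeHeight t ≤ p.2} ∪
        (fun p : ℝ × ℝ => (p.1, t)) ⁻¹' {p | p.1 ∈ S ∧ g p.1 ≤ p.2}) := by
    ext p
    simp only [mem_ofPred_eq, mem_inter_iff, mem_preimage, mem_iInter, mem_union]
    constructor
    · rintro ⟨h1, h2⟩
      refine ⟨h1, fun t => (le_or_gt (squeezeHeight t) p.2).imp_right fun ht => ⟨h1, ?_⟩⟩
      exact (strictMono_squeezeHeight.lt_iff_lt.1 (h2.trans_lt ht)).le
    · rintro ⟨h1, h2⟩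
      refine ⟨h1, ?_⟩
      by_contra! hlt
      have hev : ∀ᶠ t in 𝓝[<] g p.1, p.2 < squeezeHeight t := nhdsWithin_le_nhds
        ((continuous_squeezeHeight.tendsto (g p.1)).eventually (lt_mem_nhds hlt))
      obtain ⟨t, ht, htg⟩ := (hev.and self_mem_nhdsWithin).exists
      rcases h2 t with h3 | h3
      · exact ht.not_ge h3
      · exact (mem_Iio.1 htg).not_ge h3.2
  rw [this]
  exact (hS.preimage continuous_fst).inter (isClosed_iInter fun t =>
    (isClosed_le continuous_const continuous_snd).union (h.preimage (by fun_prop)))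

theorem isClosed_le_squeezeHeight {S : Set ℝ} {g : ℝ → ℝ} (hS : IsClosed S)
    (h : IsClosed {p : ℝ × ℝ | p.1 ∈ S ∧ p.2 ≤ g p.1}) :
    IsClosed {p : ℝ × ℝ | p.1 ∈ S ∧ p.2 ≤ squeezeHeight (g p.1)} := by
  have : {p : ℝ × ℝ | p.1 ∈ S ∧ p.2 ≤ squeezeHeight (g p.1)} = (Prod.fst ⁻¹' S) ∩
      ⋂ t : ℝ, ({p : ℝ × ℝ | p.2 ≤ squeezeHeight t} ∪
        (fun p : ℝ × ℝ => (p.1, t)) ⁻¹' {p | p.1 ∈ S ∧ p.2 ≤ g p.1}) := by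
    ext p
    simp only [mem_ofPred_eq, mem_inter_iff, mem_preimage, mem_iInter, mem_union]
    constructor
    · rintro ⟨h1, h2⟩
      refine ⟨h1, fun t => (le_or_gt p.2 (squeezeHeight t)).imp_right fun ht => ⟨h1, ?_⟩⟩
      exact (strictMono_squeezeHeight.lt_iff_lt.1 (ht.trans_le h2)).le
    · rintro ⟨h1, h2⟩
      refine ⟨h1, ?_⟩
      by_contra! hlt
      have hev : ∀ᶠ t in 𝓝[>] g p.1, squeezeHeight t < p.2 := nhdsWithin_le_nhds
        ((continuous_squeezeHeight.tendsto (g p.1)).eventually (gt_mem_nhds hlt))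
      obtain ⟨t, ht, htg⟩ := (hev.and self_mem_nhdsWithin).exists
      rcases h2 t with h3 | h3
      · exact ht.not_ge h3
      · exact (mem_Ioi.1 htg).not_ge h3.2
  rw [this]
  exact (hS.preimage continuous_fst).inter (isClosed_iInter fun t =>
    (isClosed_le continuous_snd continuous_const).union (h.preimage (by fun_prop)))

/-! ### Every vertical segment meets a curve -/

section Instantiate

variable {d : ℕ → ℝ} {R : ∀ n, Set (Box n)}

theorem hi_lt_lo_or_of_le (hd : IsDebskiSequence d) (hst : ∀ n s, IsStacked d R s n)
    {n k : ℕ} (hk : k ≤ n) {ρ : Box n} {τ : Box k} (hρ : ρ ∈ R n) (hτ : τ ∈ R k)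
    (hne : (⟨n, ρ⟩ : Σ k, Box k) ≠ ⟨k, τ⟩) {c : ℝ} (h1 : c ∈ cantorBlock ρ.word)
    (h2 : c ∈ cantorBlock τ.word) :
    (∀ x ∈ cantorBlock ρ.word, x ∈ cantorBlock τ.word ∧ ρ.hi d x < τ.lo d x) ∨
      ∀ x ∈ cantorBlock ρ.word, x ∈ cantorBlock τ.word ∧ τ.hi d x < ρ.lo d x := by
  obtain ⟨s, hs, hs'⟩ := sameWord_of_mem hk h1 h2
  have h := (hst n s).hi_lt_lo_or hd (p := ⟨n, ρ⟩) (q := ⟨k, τ⟩) ⟨le_rfl, hρ, hs⟩ ⟨hk, hτ, hs'⟩ hne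
  rw [hs, hs']
  exact h.imp (fun h x hx => ⟨cantorBlock_antitone s hk hx, h x hx⟩)
    fun h x hx => ⟨cantorBlock_antitone s hk hx, h x hx⟩

theorem finite_stage_lt (hst : ∀ n s, IsStacked d R s n) (N : ℕ) :
    {i : Σ n, R n | i.1 < N}.Finite := by
  have : {i : Σ n, R n | i.1 < N} ⊆ ⋃ n ∈ Iio N, range (Sigma.mk n) := by
    rintro ⟨n, ρ⟩ hn
    exact mem_biUnion hn (mem_range_self ρ)
  refine ((finite_Iio N).biUnion fun n _ => ?_).subset this
  have := (tiling_finite hst n).to_subtype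
  exact finite_range _

/-- A segment that misses all curves has positive distance from the finitely many early ones. For
large `n` it is covered by a rectangle of stage `n` and one whose curve is close to the segment,
hence of late stage. Both are shorter than half the segment. -/
theorem exists_curve_meets (hd : IsDebskiSequence d) (hR : IsTilingSequence d R) {c a b : ℝ}
    (hc : c ∈ cantorSet) (hab : a < b) :
    ∃ n, ∃ ρ ∈ R n, c ∈ cantorBlock ρ.word ∧ ρ.lo d c ≤ b ∧ a ≤ ρ.hi d c := by
  have hst := hR.isStacked hd
  have hpos := fun n => bot_lt_top_of_isStacked (hst n) n le_rfl
  by_contra! hcon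
  have hmiss : ∀ n, ∀ ρ ∈ R n, Disjoint ({c} ×ˢ Icc a b : Set (ℝ × ℝ)) (ρ.curve d) := by
    intro n ρ hρ
    rw [Set.disjoint_left]
    rintro ⟨c', y⟩ ⟨hc', hy⟩ hy'
    obtain rfl : c' = c := hc'
    rw [Box.mem_curve hd (hpos n ρ hρ)] at hy'
    have := hcon n ρ hρ hy'.1 (hy'.2.1.trans hy.2)
    simp only at hy' hy
    linarith [hy'.2.2, hy.1]
  obtain ⟨K, hK⟩ := exists_nat_one_div_lt (half_pos (sub_pos.2 hab))
  set E : Set (ℝ × ℝ) := ⋃ k ∈ Iio K, ⋃ ρ ∈ R k, ρ.curve d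
  have hE : IsClosed E := (finite_Iio K).isClosed_biUnion fun k _ =>
    (tiling_finite hst k).isClosed_biUnion fun ρ hρ => Box.isClosed_curve hd (hpos k ρ hρ)
  have hIE : Disjoint ({c} ×ˢ Icc a b : Set (ℝ × ℝ)) E := by
    simp only [E, Set.disjoint_iUnion_right]
    exact fun k _ ρ hρ => hmiss k ρ hρ
  obtain ⟨δ, hδ, hdisj⟩ := hIE.exists_thickenings (isCompact_singleton.prod isCompact_Icc) hE
  have hlim : Filter.Tendsto (fun n : ℕ => 1 / ((n : ℝ) + 1) + 1 / 3 ^ n) Filter.atTop (𝓝 0) := by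
    have h1 := tendsto_one_div_add_atTop_nhds_zero_nat (𝕜 := ℝ)
    have h2 := tendsto_pow_atTop_nhds_zero_of_lt_one (r := (1 / 3 : ℝ)) (by norm_num) (by norm_num)
    simpa [one_div, inv_pow] using h1.add h2
  obtain ⟨A, hA⟩ := exists_nat_ge (-a)
  obtain ⟨B, hB⟩ := exists_nat_ge b
  obtain ⟨n, hnδ, hnK, hnA, hnB⟩ := ((hlim.eventually_lt_const hδ).and
    ((Filter.eventually_ge_atTop K).and ((Filter.eventually_ge_atTop A).and
      (Filter.eventually_ge_atTop B)))).exists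
  have hnA' : (A : ℝ) ≤ n := Nat.cast_le.2 hnA
  have hnB' : (B : ℝ) ≤ n := Nat.cast_le.2 hnB
  obtain ⟨ρ, hρ, k, hk, τ, hτ, hcov, p, hp, q, hq, hpq⟩ :=
    exists_boxes_of_arc hd hst n hc hab.le (by
    rintro ⟨c', y⟩ ⟨hc', hy⟩
    obtain rfl : c' = c := hc'
    refine ⟨⟨hc, ?_, ?_⟩, fun h => ?_⟩
    · have := hy.1
      simp only at this ⊢
      linarith
    · have := hy.2
      simp only at this ⊢
      linarith
    · simp only [mem_iUnion] at h
      obtain ⟨k, -, ρ, hρ, h⟩ := h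
      exact Set.disjoint_left.1 (hmiss k ρ hρ)
        (show ((c', y) : ℝ × ℝ) ∈ ({c'} : Set ℝ) ×ˢ Icc a b from ⟨rfl, hy⟩) h)
  have hdist : dist p q < δ := by
    refine lt_of_le_of_lt ?_ (hpq.trans hnδ)
    rw [Prod.dist_eq, Real.dist_eq, Real.dist_eq]
    exact max_le (Real.abs_le_sqrt (by nlinarith [sq_nonneg (p.2 - q.2)]))
      (Real.abs_le_sqrt (by nlinarith [sq_nonneg (p.1 - q.1)]))
  have hkK : K ≤ k := by
    by_contra hlt
    have hqE : q ∈ E := mem_biUnion (show k ∈ Iio K from not_le.1 hlt) (mem_biUnion hτ hq)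
    exact Set.disjoint_left.1 hdisj (Metric.self_subset_thickening hδ _ hp)
      (Metric.mem_thickening_iff.2 ⟨q, hqE, hdist⟩)
  have hh : ∀ m, K ≤ m → ∀ χ ∈ R m, χ.top - χ.bot < (b - a) / 2 := by
    intro m hm χ hχ
    refine (hR.height_le hd m hχ).trans_lt (lt_of_le_of_lt ?_ hK)
    have : (K : ℝ) ≤ m := Nat.cast_le.2 hm
    gcongr
  have h1 := hh n hnK ρ hρ
  have h2 := hh k hkK τ hτ
  have key : ∀ y ∈ Icc a b, y ∈ Icc ρ.bot ρ.top ∪ Icc τ.bot τ.top := by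
    intro y hy
    exact (hcov (show (c, y) ∈ ({c} ×ˢ Icc a b : Set (ℝ × ℝ)) from ⟨rfl, hy⟩)).imp
      (fun h => h.2) fun h => h.2
  have ka := key a ⟨le_rfl, hab.le⟩
  have kb := key b ⟨hab.le, le_rfl⟩
  -- Two of the three points `a`, the middle and `b` would share an interval shorter than half of `b
  -- - a`.
  have km := key ((a + b) / 2) ⟨by linarith, by linarith⟩
  rcases ka with ka | ka <;> rcases kb with kb | kb <;> rcases km with km | km <;>
    linarith [ka.1, ka.2, kb.1, kb.2, km.1, km.2]

end Instantiate

/-- The curves of a tiling sequence, carried to `C × (0,1)`. -/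
noncomputable def IsTilingSequence.curveSystem {d : ℕ → ℝ} {R : ∀ n, Set (Box n)}
    (hd : IsDebskiSequence d) (hR : IsTilingSequence d R) : CurveSystem (Σ n, R n) where
  dom i := cantorBlock i.2.1.word
  lo i c := squeezeHeight (i.2.1.lo d c)
  hi i c := squeezeHeight (i.2.1.hi d c)
  mid i c := squeezeHeight ((i.2.1.lo d c + i.2.1.hi d c) / 2)
  dom_subset i := cantorBlock_subset _
  isClosed_diff_dom i := isClosed_cantorSet_diff_block _
  lo_pos i c _ := (squeezeHeight_mem_Ioo _).1
  hi_lt_one i c _ := (squeezeHeight_mem_Ioo _).2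
  lo_le_hi i c _ := strictMono_squeezeHeight.monotone
    (Box.lo_le_hi (bot_lt_top_of_isStacked (hR.isStacked hd i.1) _ le_rfl _ i.2.2) c)
  lo_lt_mid i c _ h := by
    rw [strictMono_squeezeHeight.lt_iff_lt] at h ⊢
    linarith
  mid_lt_hi i c _ h := by
    rw [strictMono_squeezeHeight.lt_iff_lt] at h ⊢
    linarith
  isClosed_above i := isClosed_squeezeHeight_le (isClosed_cantorBlock _)
    (Box.isClosed_lo_le (bot_lt_top_of_isStacked (hR.isStacked hd i.1) _ le_rfl _ i.2.2))
  isClosed_below i := isClosed_le_squeezeHeight (isClosed_cantorBlock _)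
    (Box.isClosed_le_hi (bot_lt_top_of_isStacked (hR.isStacked hd i.1) _ le_rfl _ i.2.2))
  hi_le_lo i c _ c' _ h := strictMono_squeezeHeight.monotone
    (Box.hi_le_lo (bot_lt_top_of_isStacked (hR.isStacked hd i.1) _ le_rfl _ i.2.2) h)
  separated := by
    rintro ⟨n, ρ, hρ⟩ ⟨k, τ, hτ⟩ hne c h1 h2
    simp only [strictMono_squeezeHeight.lt_iff_lt] at h1 h2 ⊢
    rcases le_total k n with hk | hk
    · rcases hi_lt_lo_or_of_le hd (hR.isStacked hd) hk hρ hτ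
        (by rintro h; cases h; exact hne rfl) h1 h2 with h | h
      · exact Or.inl (h c h1).2
      · exact Or.inr (h c h1).2
    · rcases hi_lt_lo_or_of_le hd (hR.isStacked hd) hk hτ hρ
        (by rintro h; cases h; exact hne rfl) h2 h1 with h | h
      · exact Or.inr (h c h2).2
      · exact Or.inl (h c h2).2
  -- A jump is scaled by the height of its rectangle, so late stages drop out and each remaining
  -- curve has finitely many large jumps.
  finite_jumps η hη := by
    obtain ⟨N, hN⟩ := exists_nat_one_div_lt hη
    refine ((finite_stage_lt (hR.isStacked hd) N).biUnion fun i _ =>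
      (finite_jump_ge hd.injective hη).preimage
        (blockCoord_strictMono i.2.1.word).injective.injOn).subset ?_
    rintro c ⟨i, -, h⟩
    have hpos := bot_lt_top_of_isStacked (hR.isStacked hd i.1) _ le_rfl _ i.2.2
    have h1 := squeezeHeight_sub_le (Box.lo_le_hi (d := d) hpos c)
    have h2 := hR.height_le hd i.1 i.2.2
    have h3 : i.2.1.hi d c - i.2.1.lo d c = (debskiUp d (blockCoord i.2.1.word c) -
        debski d (blockCoord i.2.1.word c)) * (i.2.1.top - i.2.1.bot) := by
      unfold Box.hi Box.lo
      ring
    have h4 := debski_le_debskiUp (d := d) (blockCoord i.2.1.word c)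
    have h5 := debski_nonneg (d := d) (blockCoord i.2.1.word c)
    have h6 := debskiUp_le_one (d := d) (blockCoord i.2.1.word c)
    have h7 : (1 : ℝ) / (i.1 + 1) ≤ 1 := by
      rw [div_le_one (by positivity)]
      linarith [Nat.cast_nonneg (α := ℝ) i.1]
    refine mem_biUnion (x := i) ?_ ?_
    · by_contra hn
      have hn' : (N : ℝ) ≤ i.1 := Nat.cast_le.2 (not_lt.1 hn)
      have : (1 : ℝ) / (i.1 + 1) ≤ 1 / (N + 1) := by gcongr
      nlinarith
    · simp only [mem_preimage, mem_ofPred_eq]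
      nlinarith
  meets c hc u v hu huv hv := by
    obtain ⟨a, hua, hav⟩ := exists_between huv
    obtain ⟨b, hab, hbv⟩ := exists_between hav
    have ha : a ∈ Ioo (0 : ℝ) 1 := ⟨by linarith, by linarith⟩
    have hb : b ∈ Ioo (0 : ℝ) 1 := ⟨by linarith, by linarith⟩
    have hlt : unsqueezeHeight a < unsqueezeHeight b := by
      rw [← strictMono_squeezeHeight.lt_iff_lt, squeezeHeight_unsqueezeHeight ha,
        squeezeHeight_unsqueezeHeight hb]
      exact hab
    obtain ⟨n, ρ, hρ, h1, h2, h3⟩ := exists_curve_meets hd hR hc hlt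
    refine ⟨⟨n, ρ, hρ⟩, h1, ?_, ?_⟩
    · have := strictMono_squeezeHeight.monotone h2
      rw [squeezeHeight_unsqueezeHeight hb] at this
      exact this.trans_lt hbv
    · have := strictMono_squeezeHeight.monotone h3
      rw [squeezeHeight_unsqueezeHeight ha] at this
      exact hua.trans_le this
  small ε hε := by
    obtain ⟨N₁, hN₁⟩ := exists_nat_one_div_lt hε
    obtain ⟨N₂, hN₂⟩ := exists_one_div_three_pow_lt hε
    refine (finite_stage_lt (hR.isStacked hd) (max N₁ N₂)).subset fun i hi => ?_
    by_contra hn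
    simp only [mem_ofPred_eq, lt_max_iff, not_or, not_lt] at hn
    have hpos := bot_lt_top_of_isStacked (hR.isStacked hd i.1) _ le_rfl _ i.2.2
    refine hi fun c hc c' hc' => ⟨(dist_le_of_mem_cantorBlock hc hc').trans_lt ?_, ?_⟩
    · refine lt_of_le_of_lt ?_ hN₂
      gcongr
      · norm_num
      · exact hn.2
    · rcases le_total (i.2.1.hi d c) (i.2.1.lo d c') with h | h
      · have := strictMono_squeezeHeight.monotone h
        linarith
      · have h1 := squeezeHeight_sub_le h
        have h2 := hR.height_le hd i.1 i.2.2
        have h3 := Box.hi_le_top (d := d) hpos c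
        have h4 := Box.bot_le_lo (d := d) hpos c'
        have h5 : (N₁ : ℝ) ≤ i.1 := Nat.cast_le.2 hn.1
        have : (1 : ℝ) / (i.1 + 1) ≤ 1 / (N₁ + 1) := by gcongr
        linarith
  -- Only `i` and the curves of earlier stages can fail: the block of a curve of the same or a later
  -- stage is contained in that of `i` or disjoint from it.
  one_side i := by
    refine ((finite_stage_lt (hR.isStacked hd) i.1).union
      (finite_singleton i)).subset fun j hj => ?_
    by_contra hn
    simp only [mem_union, mem_ofPred_eq, not_or, not_lt, mem_singleton_iff] at hn
    obtain ⟨hij, hne⟩ := hn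
    apply hj
    simp only [strictMono_squeezeHeight.lt_iff_lt]
    by_cases hc : ∃ c ∈ cantorBlock j.2.1.word, c ∈ cantorBlock i.2.1.word
    · obtain ⟨c, h1, h2⟩ := hc
      have hne' : (⟨j.1, j.2.1⟩ : Σ k, Box k) ≠ ⟨i.1, i.2.1⟩ := by
        obtain ⟨n, ρ, hρ⟩ := i
        obtain ⟨k, τ, hτ⟩ := j
        rintro h
        cases h
        exact hne rfl
      rcases hi_lt_lo_or_of_le hd (hR.isStacked hd) hij j.2.2 i.2.2 hne' h1 h2 with h | h
      · exact Or.inr fun x hx _ => (h x hx).2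
      · exact Or.inl h
    · push Not at hc
      exact Or.inr fun x hx hx' => absurd hx' (hc x hx)
  hi_eq_lo i c hc hcE := by
    rw [Box.hi_eq_lo_of_endpoint hd _ (blockCoord_mem_cantorEndpoints hcE hc)]
  exists_jump i O hO hne := by
    obtain ⟨x, hxO, hx⟩ := hne
    have hpos := bot_lt_top_of_isStacked (hR.isStacked hd i.1) _ le_rfl _ i.2.2
    have hcont : Continuous fun y : ℝ => leftEnd i.2.1.word + y / 3 ^ i.1 := by fun_prop
    obtain ⟨_, hy, k, rfl⟩ := mem_closure_iff.1 (hd.dense ((mem_cantorBlock_iff _ _).1 hx)) _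
      (hO.preimage hcont) (by
        rw [mem_preimage, leftEnd_add_blockCoord]
        exact hxO)
    refine ⟨leftEnd i.2.1.word + d k / 3 ^ i.1, ⟨hy, ?_⟩, ?_⟩
    · rw [mem_cantorBlock_iff, blockCoord_add]
      exact hd.mem k
    · refine strictMono_squeezeHeight ?_
      have h1 := debski_lt_debskiUp hd.injective k
      have h2 := sub_pos.2 hpos
      unfold Box.lo Box.hi
      rw [blockCoord_add]
      gcongr

/-! ### The sets Y and X as the space of the curve system -/

section Space

variable {d : ℕ → ℝ} {R : ∀ n, Set (Box n)}

theorem IsTilingSequence.countable_index (hd : IsDebskiSequence d) (hR : IsTilingSequence d R) :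
    Countable (Σ n, R n) := by
  have : ∀ n, Countable (R n) := fun n => (tiling_finite (hR.isStacked hd) n).countable.to_subtype
  infer_instance

theorem mem_setY_iff (hd : IsDebskiSequence d) (hR : IsTilingSequence d R) (p : ℝ × ℝ) :
    p ∈ setY d R ↔ squeeze p ∈ (hR.curveSystem hd).space := by
  have hpos := fun n => bot_lt_top_of_isStacked (hR.isStacked hd n) n le_rfl
  have hsq : ∀ r, 1 / Real.pi * Real.arctan r + 1 / 2 = squeezeHeight r := fun _ => rfl
  simp only [setY, squeeze, hsq, CurveSystem.space, CurveSystem.curve, CurveSystem.mids,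
    IsTilingSequence.curveSystem, mem_sdiff, mem_prod, mem_univ, and_true, mem_iUnion,
    mem_ofPred_eq, squeezeHeight_mem_Ioo, true_and, strictMono_squeezeHeight.le_iff_le,
    strictMono_squeezeHeight.lt_iff_lt, strictMono_squeezeHeight.injective.eq_iff]
  refine and_congr_right fun _ => ⟨?_, ?_⟩
  · rintro h ⟨n, ρ, hρ⟩ hc
    by_contra hn
    refine h ⟨n, ρ, hρ, (Box.mem_map_diff hd (hpos n ρ hρ) p).2 ⟨hc, fun h' => hn ⟨hc.1, h'⟩⟩⟩
  · rintro h ⟨n, ρ, hρ, hp⟩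
    have hp' := (Box.mem_map_diff hd (hpos n ρ hρ) p).1 hp
    exact hp'.2 (h ⟨n, ρ, hρ⟩ hp'.1).2

theorem setX_eq_space (hd : IsDebskiSequence d) (hR : IsTilingSequence d R) :
    setX d R = (hR.curveSystem hd).space := by
  ext p
  constructor
  · rintro ⟨q, hq, rfl⟩
    exact (mem_setY_iff hd hR q).1 hq
  · intro hp
    have h : squeeze (p.1, unsqueezeHeight p.2) = p :=
      Prod.ext rfl (squeezeHeight_unsqueezeHeight hp.2.1)
    exact ⟨(p.1, unsqueezeHeight p.2), (mem_setY_iff hd hR _).2 (h.symm ▸ hp), h⟩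

/-- There is a continuous left inverse on the strip of heights in (0,1). Thus Y embeds in the fan
and inherits its rim-discreteness. -/
theorem isEmbedding_nabla_squeeze : IsEmbedding fun p : ℝ × ℝ => nabla (squeeze p) := by
  have hcont : Continuous fun p : ℝ × ℝ => nabla (squeeze p) := by
    refine continuous_nabla.comp ?_
    unfold squeeze
    fun_prop
  let f : ℝ × ℝ → {q : ℝ × ℝ // q.2 ∈ Ioo (0 : ℝ) 1} :=
    fun p => ⟨nabla (squeeze p), squeezeHeight_mem_Ioo p.2⟩
  let g : {q : ℝ × ℝ // q.2 ∈ Ioo (0 : ℝ) 1} → ℝ × ℝ :=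
    fun q => ((unfan q).1, unsqueezeHeight (unfan q).2)
  have hg : Continuous g := by
    have h1 : Continuous fun q : {q : ℝ × ℝ // q.2 ∈ Ioo (0 : ℝ) 1} => unfan q :=
      continuousOn_unfan.comp_continuous continuous_subtype_val fun q => q.2.1.ne'
    exact (continuous_fst.comp h1).prodMk
      (continuousOn_unsqueezeHeight.comp_continuous (continuous_snd.comp h1) fun q => q.2)
  have hgf : g ∘ f = id := by
    funext p
    have h : unfan (nabla (squeeze p)) = squeeze p :=
      unfan_nabla (squeezeHeight_mem_Ioo p.2).1.ne'
    simp only [g, f, Function.comp, h, id]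
    exact Prod.ext rfl (unsqueezeHeight_squeezeHeight p.2)
  have hf : IsEmbedding f := .of_comp (hcont.subtype_mk _) hg (hgf ▸ IsEmbedding.id)
  exact IsEmbedding.subtypeVal.comp hf

theorem exists_embedding_setY_fan : ∃ φ : setY d R → fan (setX d R), IsEmbedding φ :=
  ⟨_, (isEmbedding_nabla_squeeze.comp IsEmbedding.subtypeVal).codRestrict (fan (setX d R))
    fun p => Or.inl (mem_image_of_mem _ (mem_image_of_mem _ p.2))⟩

end Space

/-! ### Assembly of the theorem -/

theorem mainTheorem1 :
    (∃ d : ℕ → ℝ, IsDebskiSequence d) ∧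
    (∀ d : ℕ → ℝ, IsDebskiSequence d →
      (∃ R : ∀ n, Set (Box n), IsTilingSequence d R) ∧
      ∀ R : ∀ n, Set (Box n), IsTilingSequence d R →
        TilingConditions d R ∧
        setX d R ⊆ cantorSet ×ˢ Ioo 0 1 ∧
        IsTotallyDisconnected (setX d R) ∧
        IsConnected (fan (setX d R)) ∧
        RimDiscrete (setY d R) ∧
        RimDiscrete (fan (setX d R)) ∧
        IsCompletelyMetrizableSpace (setX d R) ∧
        IsCompletelyMetrizableSpace (fan (setX d R)) ∧
        IsBiconnected (fan (setX d R)) ∧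
        IsDispersionPoint (fan (setX d R)) (1 / 2, 0) ∧
        EmbedsInRationalContinuum (fan (setX d R))) ∧
    (∃ S : Set (ℝ × ℝ), IsBiconnected S ∧ (∃ x, IsDispersionPoint S x) ∧
      EmbedsInRationalContinuum S) := by
  have main : ∀ d : ℕ → ℝ, IsDebskiSequence d →
      (∃ R : ∀ n, Set (Box n), IsTilingSequence d R) ∧
      ∀ R : ∀ n, Set (Box n), IsTilingSequence d R →
        TilingConditions d R ∧
        setX d R ⊆ cantorSet ×ˢ Ioo 0 1 ∧
        IsTotallyDisconnected (setX d R) ∧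
        IsConnected (fan (setX d R)) ∧
        RimDiscrete (setY d R) ∧
        RimDiscrete (fan (setX d R)) ∧
        IsCompletelyMetrizableSpace (setX d R) ∧
        IsCompletelyMetrizableSpace (fan (setX d R)) ∧
        IsBiconnected (fan (setX d R)) ∧
        IsDispersionPoint (fan (setX d R)) (1 / 2, 0) ∧
        EmbedsInRationalContinuum (fan (setX d R)) := by
    intro d hd
    refine ⟨exists_isTilingSequence hd, fun R hR => ?_⟩
    have hY := exists_embedding_setY_fan (d := d) (R := R)
    have := hR.countable_index hd
    rw [setX_eq_space hd hR] at hY ⊢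
    obtain ⟨φ, hφ⟩ := hY
    set Γ := hR.curveSystem hd
    have hpX : PolishSpace Γ.space := Γ.isGδ_space.polishSpace
    have hpF : PolishSpace (fan Γ.space) := (isGδ_fan Γ.space_subset Γ.isGδ_space).polishSpace
    have hdisp := isDispersionPoint_fan Γ.space_subset Γ.space_nonempty
      Γ.isTotallyDisconnected_space Γ.isConnected_fan
    exact ⟨hR.tilingConditions hd, Γ.space_subset, Γ.isTotallyDisconnected_space,
      Γ.isConnected_fan, hφ.rimDiscrete Γ.rimDiscrete_fan, Γ.rimDiscrete_fan, inferInstance,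
      inferInstance, hdisp.isBiconnected, hdisp, Γ.embedsInRationalContinuum_fan⟩
  refine ⟨exists_debskiSequence, main, ?_⟩
  obtain ⟨d, hd⟩ := exists_debskiSequence
  obtain ⟨⟨R, hR⟩, h⟩ := main d hd
  obtain ⟨-, -, -, -, -, -, -, -, h1, h2, h3⟩ := h R hR
  exact ⟨_, h1, ⟨_, h2⟩, h3⟩
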